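/- **Conventions.** Theories are complete and first order; structures are nonempty. $\operatorname{tp}_{qf}(\bar t,A,I)$ is the quantifier-free type of the finite tuple $\bar t$ over $A$ in $I$; equality of such types for tuples includes equality of lengths. **Index model classes.** Let $\tau$ be a signature containing $<$, whose function symbols may be interpreted by partial functions (quantifier-free formulas can express that a term is defined). Let $\mathcal K$ be a class of $\tau$-structures. Call $J\in\mathcal K$ *$\aleph_0$-saturated* if (i) every countably generated member of $\mathcal K$ embeds in $J$, and (ii) whenever finite tuples $\bar s,\bar t$ of $J$ have the same quantifier-free type, for each $x\in J$ there is $y\in J$ such that $\bar s^\frown x$ and $\bar t^\frown y$ have the same quantifier-free type. A *template* $\Phi$ consists of a signature $\tau_\Phi$ and a map from quantifier-free types of finite tuples of index models to quantifier-free types of finite tuples of $\tau_\Phi$-structures. A $\tau_\Phi$-structure $N$ is $\operatorname{GEM}(I,\Phi)$ with skeleton $\langle \bar a_t:t\in I\rangle$ (finite tuples of $N$) if the entries of the skeleton generate $N$ and, for all $t_0,\dots,t_{n-1}\in I$, $\Phi$ maps $\operatorname{tp}_{qf}(\langle t_0,\dots,t_{n-1}\rangle,\emptyset,I)$ to $\operatorname{tp}_{qf}(\bar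 a_{t_0}{}^\frown\cdots{}^\frown\bar a_{t_{n-1}},\emptyset,N)$. $T_\Phi$ is the set of sentences true in all $\operatorname{GEM}(I,\Phi)$, $I\in\mathcal K$. Let $\Upsilon_{\mathcal K}$ be the class of templates $\Phi$ such that: $\operatorname{GEM}(I,\Phi)$ exists for every $I\in\mathcal K$; skeletons consist of nonempty tuples, without repetition; $T_\Phi$ is complete and has Skolem functions; skeletons are indiscernible for all formulas ($\operatorname{tp}_{qf}(\bar s,\emptyset,I)=\operatorname{tp}_{qf}(\bar t,\emptyset,I)$ implies $\operatorname{tp}(\bar a_{\bar s},\emptyset)=\operatorname{tp}(\bar a_{\bar t},\emptyset)$); $\operatorname{GEM}(I,\Phi)\preceq\operatorname{GEM}(J,\Phi)$, with the induced skeleton, for $I\subseteq J$ in $\mathcal K$; and $\operatorname{GEM}(I,\Phi)$ is unique up to isomorphism. For $\Phi,\Psi\in\Upsilon_{\mathcal K}$, $\Phi\le\Psi$ means that $\tau_\Phi\subseteq\tau_\Psi$ and that, for all $I\in\mathcal K$, $\operatorname{GEM}(I,\Phi)\preceq\operatorname{GEM}(I,\Psi)\restriction\tau_\Phi$ with the same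 skeleton. For a theory $T$, $\Upsilon_{\mathcal K}[T]$ is the class of $\Phi\in\Upsilon_{\mathcal K}$ with $\tau(T)\subseteq\tau_\Phi$ and $T\subseteq T_\Phi$, such that $T_\Phi$ has Skolem functions for all $\tau(T)$-formulas. $\mathcal K$ is *Ramsey* if for every $\aleph_0$-saturated $J\in\mathcal K$, every structure $M$, and every sequence $\langle\bar b_t:t\in J\rangle$ without repetition of nonempty finite tuples of $M$, where the length of $\bar b_t$ depends only on $\operatorname{tp}_{qf}(t,\emptyset,J)$, there is $\Psi\in\Upsilon_{\mathcal K}$ with $\tau(M)\subseteq\tau_\Psi$ such that for every finite tuple $\bar s$ of $J$ and every $\tau(M)$-formula $\varphi$: if $M\models\varphi[\bar b_{\bar t}]$ for all $\bar t$ in $J$ with $\operatorname{tp}_{qf}(\bar t,\emptyset,J)=\operatorname{tp}_{qf}(\bar s,\emptyset,J)$, then $\operatorname{GEM}(J,\Psi)\models\varphi[\bar a_{\bar s}]$. $\mathcal K$ is an *index model class* if it is closed under isomorphism, $<^I$ linearly orders every $I\in\mathcal K$, $I\in\mathcal K$ iff all finitely generated submodels of $I$ are in $\mathcal K$, every $I\in\mathcal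 K$ has an $\aleph_0$-saturated extension in $\mathcal K$, and $\mathcal K$ is Ramsey. A *countable context* is a pair $\mathbf c=(I,\mathcal K)$ where $\mathcal K$ is an index model class, $I\in\mathcal K$ is countable and not finitely generated, and for every $\aleph_0$-saturated $J\supseteq I$ in $\mathcal K$, finite tuple $\bar t$ from $I$ and $s\in J$: if $s$ is the only realization in $J$ of $\operatorname{tp}_{qf}(s,\bar t,J)$ then $s\in\operatorname{cl}_I(\bar t)$; and if $s\notin\operatorname{cl}(\bar t)$ then $\operatorname{tp}_{qf}(s,\bar t,J)$ has infinitely many realizations in $J$. Write $\Upsilon_{\mathbf c}=\Upsilon_{\mathcal K}$, $\Upsilon_{\mathbf c}[T]=\Upsilon_{\mathcal K}[T]$. **Shearing.** Let $I_0\subseteq I_1$ be finite subsets of $I$, $M\models T$ and $A\subseteq M$. A formula $\varphi(\bar x,\bar c)$ with $\bar c$ from $M$ *shears over $A$ for $(I_0,I_1)$* if there are $N\succeq M$, enumerations $\bar s_0$ of $I_0$ and $\bar t$ of $I_1$, an $\aleph_0$-saturated $J\supseteq I$ in $\mathcal K$, and finite tuples $\bar b_{\bar s}$ of $N$, for $\bar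 s\in{}^{\omega>}J$, such that: whenever $\operatorname{lgn}(\bar t_\ell)=\operatorname{lgn}(\bar t'_\ell)$ for $\ell<k$ and $\operatorname{tp}_{qf}(\bar t_0{}^\frown\cdots{}^\frown\bar t_{k-1},\bar s_0,J)=\operatorname{tp}_{qf}(\bar t'_0{}^\frown\cdots{}^\frown\bar t'_{k-1},\bar s_0,J)$, the tuples $\bar b_{\bar t_0}{}^\frown\cdots{}^\frown\bar b_{\bar t_{k-1}}$ and $\bar b_{\bar t'_0}{}^\frown\cdots{}^\frown\bar b_{\bar t'_{k-1}}$ have the same complete type over $A$ in $N$; $\bar c=\bar b_{\bar t}$; and $\{\varphi(\bar x,\bar b_{\bar t'}):\operatorname{tp}_{qf}(\bar t',\bar s_0,J)=\operatorname{tp}_{qf}(\bar t,\bar s_0,I)\}$ is inconsistent. $T$ is *$\mathbf c$-unsuperstable* if there are an increasing sequence of nonempty finite sets $I_n$ with union $I$ (with enumerations $\bar s_n$, where $\bar s_n$ is an initial segment of $\bar s_{n+1}$), an increasing sequence of nonempty subsets $B_n$ of a model of $T$, and a (consistent) partial type $p(\bar x)$, in finitely many variables, over $\bigcup_nB_n$,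 such that for each $n$ some formula of $p\restriction B_{n+1}$ shears over $B_n$ for $(I_n,I_{n+1})$. Otherwise $T$ is *$\mathbf c$-superstable*. **Theorem (Separation Theorem).** Let $\mathbf c=(I,\mathcal K)$ be a countable context, and let $T_0,T_1$ be complete theories in disjoint signatures of any size, where $T_0$ has infinite models. Suppose that $T_0$ is $\mathbf c$-superstable and $T_1$ is $\mathbf c$-unsuperstable. 1. Let $\Phi\in\Upsilon_{\mathbf c}$, where for each $i\in\{0,1\}$ either $\Phi\in\Upsilon_{\mathbf c}[T_i]$ or $\tau(T_i)$ is disjoint from $\tau_\Phi$. Then for arbitrarily large $\mu$ there is $\Psi\ge\Phi$ with $\Psi\in\Upsilon_{\mathbf c}[T_0]\cap\Upsilon_{\mathbf c}[T_1]$ such that, writing $M=\operatorname{GEM}(I,\Psi)$, the reduct $M\restriction\tau(T_0)$ is $\mu$-saturated but $M\restriction\tau(T_1)$ is not $\aleph_1$-saturated. 2. For every consistent theory $T_*$ with $\tau(T_*)\supseteq\tau(T_0)\cup\tau(T_1)$ which implies $T_0\cup T_1$, and for arbitrarily large $\mu$, there is a model $M_*\models T_*$ such that $M_*\restriction\tau(T_0)$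 is $\mu$-saturated but $M_*\restriction\tau(T_1)$ is not $\aleph_1$-saturated. -/

import Mathlib

universe u

open FirstOrder FirstOrder.Language

namespace Shearing

/-! ### Index models: structures with relations and partial functions -/

/-- A nonempty structure for the signature `τ` whose function symbols are interpreted by partial
functions.  The domain predicate of a function symbol `F` is `fun x => (fn F x).Dom`. -/
structure IndexModel (τ : FirstOrder.Language.{u, u}) where
  carrier : Type u
  nonempty : Nonempty carrier
  fn : ∀ {n : ℕ}, τ.Functions n → (Fin n → carrier) → Part carrier
  rel : ∀ {n : ℕ}, τ.Relations n → (Fin n → carrier) → Prop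

instance (τ : FirstOrder.Language.{u, u}) : CoeSort (IndexModel τ) (Type u) := ⟨IndexModel.carrier⟩

/-- Atomic formulas of the signature `τ`, in the variables `0, 1, 2, …`. -/
inductive AtomicFormula (τ : FirstOrder.Language.{u, u}) : Type u
  | equal (s t : τ.Term ℕ) : AtomicFormula τ
  | rel {n : ℕ} (R : τ.Relations n) (ts : Fin n → τ.Term ℕ) : AtomicFormula τ

namespace IndexModel

variable {τ : FirstOrder.Language.{u, u}}

/-- `I.Eval v s x`: the term `s` is defined at the finite tuple `v`, with value `x`
(the variable `i` stands for the `i`-th entry of `v`). -/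
inductive Eval (I : IndexModel τ) (v : List I) : τ.Term ℕ → I → Prop
  | var (i : ℕ) (x : I) (h : v[i]? = some x) : Eval I v (Term.var i) x
  | func {n : ℕ} (F : τ.Functions n) (ts : Fin n → τ.Term ℕ) (xs : Fin n → I) (y : I)
      (hts : ∀ k, Eval I v (ts k) (xs k)) (hy : y ∈ I.fn F xs) : Eval I v (Term.func F ts) y

/-- Truth of an atomic formula at a finite tuple: all the terms in it are defined, and the
relation holds.  (So `F(t̄) = F(t̄)` expresses that `t̄` is in the domain of `F`.) -/
def Holds (I : IndexModel τ) (v : List I) : AtomicFormula τ → Prop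
  | .equal s t => ∃ x, I.Eval v s x ∧ I.Eval v t x
  | .rel R ts => ∃ xs, (∀ k, I.Eval v (ts k) (xs k)) ∧ I.rel R xs

/-- The quantifier-free type of a finite tuple in `I`, given by the atomic formulas true of it
(these decide all quantifier-free formulas; the length of the tuple is decided as well, through
the formulas `xᵢ = xᵢ`).  The quantifier-free type of `t̄` over a finite tuple `s̄` is the
quantifier-free type of `s̄ ++ t̄`. -/
def qfType (I : IndexModel τ) (v : List I) : Set (AtomicFormula τ) := {φ | I.Holds v φ}

/-- The closure of `A` under the partial functions of `I`. -/
def cl (I : IndexModel τ) (A : Set I) : Set I :=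
  {x | ∀ S : Set I, A ⊆ S →
    (∀ (n : ℕ) (F : τ.Functions n) (xs : Fin n → I), (∀ k, xs k ∈ S) → ∀ y ∈ I.fn F xs, y ∈ S) →
    x ∈ S}

/-- `f` is an isomorphism of `I` with a submodel of `J`. -/
structure IsEmbedding (I J : IndexModel τ) (f : I → J) : Prop where
  injective : Function.Injective f
  map_fn : ∀ (n : ℕ) (F : τ.Functions n) (xs : Fin n → I),
    J.fn F (fun k => f (xs k)) = (I.fn F xs).map f
  map_rel : ∀ (n : ℕ) (R : τ.Relations n) (xs : Fin n → I),
    J.rel R (fun k => f (xs k)) ↔ I.rel R xs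

/-- `J` is an `ℵ₀`-saturated member of the class `K`: it is homogeneous for finite tuples, and
universal for the countably generated members of `K`. -/
structure IsAlephZeroSaturated (K : IndexModel τ → Prop) (J : IndexModel τ) : Prop where
  mem : K J
  universal : ∀ G : IndexModel τ, K G → (∃ A : Set G, A.Countable ∧ G.cl A = Set.univ) →
    ∃ f : G → J, IsEmbedding G J f
  homogeneous : ∀ s t : List J, J.qfType s = J.qfType t →
    ∀ x : J, ∃ y : J, J.qfType (s ++ [x]) = J.qfType (t ++ [y])

end IndexModel

open IndexModel

/-! ### Types of finite tuples in ordinary structures, saturation -/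

section Types

variable (L : FirstOrder.Language.{u, u}) {N : Type u} [L.Structure N]

/-- A list of length `m` as an `m`-tuple. -/
def tuple {X : Type u} {m : ℕ} (l : List X) (h : l.length = m) : Fin m → X :=
  fun i => l.get (i.cast h.symm)

/-- The complete type over `∅` of a finite tuple. -/
def tp (l : List N) : Set (Σ m : ℕ, L.Formula (Fin m)) :=
  {φ | ∃ h : l.length = φ.1, φ.2.Realize (tuple l h)}

/-- The quantifier-free type over `∅` of a finite tuple. -/
def qftp (l : List N) : Set (Σ m : ℕ, L.Formula (Fin m)) :=
  {φ | φ ∈ tp L l ∧ BoundedFormula.IsQF φ.2}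

/-- The complete type over `A` of a finite tuple. -/
def tpOver (A : Set N) (l : List N) : Set (Σ m : ℕ, L.Formula (A ⊕ Fin m)) :=
  {φ | ∃ h : l.length = φ.1, φ.2.Realize (Sum.elim Subtype.val (tuple l h))}

/-- `μ`-saturation: every type in one variable over fewer than `μ` parameters is realized. -/
def IsSaturated (M : Type u) [L.Structure M] (μ : Cardinal.{u}) : Prop :=
  ∀ A : Set M, Cardinal.mk A < μ → ∀ p : Set (L.Formula (A ⊕ Unit)),
    (∀ F : Set (L.Formula (A ⊕ Unit)), F.Finite → F ⊆ p →
      ∃ x : M, ∀ φ ∈ F, φ.Realize (Sum.elim Subtype.val fun _ => x)) →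
    ∃ x : M, ∀ φ ∈ p, φ.Realize (Sum.elim Subtype.val fun _ => x)

end Types

/-- The formula `φ(x̄, c̄)` in the variables `x̄ = (x₀, …, x_{k-1})` with parameters `c̄` from `M`. -/
structure ParamFormula (L : FirstOrder.Language.{u, u}) (M : Type u) (k : ℕ) where
  arity : ℕ
  formula : L.Formula (Fin k ⊕ Fin arity)
  params : Fin arity → M

/-- A set of formulas with parameters from `M` is finitely satisfiable in `M`, that is, it is
consistent with the elementary diagram of `M`. -/
def FinSat {L : FirstOrder.Language.{u, u}} {M : Type u} [L.Structure M] {k : ℕ}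
    (p : Set (ParamFormula L M k)) : Prop :=
  ∀ F ⊆ p, F.Finite → ∃ x : Fin k → M, ∀ ψ ∈ F, ψ.formula.Realize (Sum.elim x ψ.params)

/-- The signatures `L₁` and `L₂` are disjoint inside `L`. -/
def DisjointIn {L₁ L₂ L : FirstOrder.Language.{u, u}} (e₁ : L₁ →ᴸ L) (e₂ : L₂ →ᴸ L) : Prop :=
  (∀ (n : ℕ) (F : L₁.Functions n) (G : L₂.Functions n), e₁.onFunction F ≠ e₂.onFunction G) ∧
  (∀ (n : ℕ) (R : L₁.Relations n) (S : L₂.Relations n), e₁.onRelation R ≠ e₂.onRelation S)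

/-- `T` has Skolem functions, as symbols of its signature, for all formulas of the signature `L`
included in its signature by `j`. -/
def HasSkolemFunctionsFor {L L' : FirstOrder.Language.{u, u}} (j : L →ᴸ L') (T : L'.Theory) : Prop :=
  ∀ (n : ℕ) (φ : L.BoundedFormula Empty (n + 1)), ∃ F : L'.Functions n,
    ∀ (M : Type u) [L'.Structure M] [Nonempty M], M ⊨ T → ∀ x : Fin n → M,
      (∃ y : M, (j.onBoundedFormula φ).Realize default (Fin.snoc x y : Fin (n + 1) → M)) →
      (j.onBoundedFormula φ).Realize default
        (Fin.snoc x (Structure.funMap F x) : Fin (n + 1) → M)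

/-! ### Templates and generalized Ehrenfeucht–Mostowski models -/

/-- A template: a signature `L`, and a map from quantifier-free types of finite tuples of index
models to quantifier-free types of finite tuples of `L`-structures. -/
structure Template (τ : FirstOrder.Language.{u, u}) where
  L : FirstOrder.Language.{u, u}
  map : Set (AtomicFormula τ) → Set (Σ m : ℕ, L.Formula (Fin m))

namespace Template

variable {τ : FirstOrder.Language.{u, u}}

/-- `N` is `GEM(I, Φ)` with skeleton `a = ⟨āₜ : t ∈ I⟩`; for `t̄ = ⟨t₀, …, tₙ₋₁⟩` the tuple `ā_t̄`
is the concatenation of the `āₜᵢ`. -/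
structure IsGEM (I : IndexModel τ) (Φ : Template τ) (N : Type u) [Φ.L.Structure N]
    (a : I → List N) : Prop where
  qftp_eq : ∀ t : List I, qftp Φ.L (t.flatMap a) = Φ.map (I.qfType t)
  generates : Substructure.closure Φ.L {x : N | ∃ t : I, x ∈ a t} = ⊤

/-- The theory `T_Φ` of all the models `GEM(I, Φ)`, `I ∈ K`. -/
def theory (K : IndexModel τ → Prop) (Φ : Template τ) : Φ.L.Theory :=
  {φ | ∀ (I : IndexModel τ) (N : Type u) [Φ.L.Structure N] (a : I → List N),
    K I → IsGEM I Φ N a → N ⊨ φ}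

/-- `Φ ∈ Υ_K`: the template `Φ` is proper for `K`, nontrivial, and has a well defined theory with
Skolem functions. -/
structure InUpsilon (K : IndexModel τ → Prop) (Φ : Template τ) : Prop where
  proper : ∀ I : IndexModel τ, K I →
    ∃ (N : Type u) (_ : Φ.L.Structure N) (a : I → List N), IsGEM I Φ N a
  nontrivial : ∀ (I : IndexModel τ) (N : Type u) [Φ.L.Structure N] (a : I → List N),
    K I → IsGEM I Φ N a → (∀ t, a t ≠ []) ∧ Function.Injective a
  skolem : HasSkolemFunctionsFor (LHom.id Φ.L) (Φ.theory K)
  complete : (Φ.theory K).IsComplete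
  indiscernible : ∀ (I : IndexModel τ) (N : Type u) [Φ.L.Structure N] (a : I → List N),
    K I → IsGEM I Φ N a → ∀ s t : List I, I.qfType s = I.qfType t →
      tp Φ.L (s.flatMap a) = tp Φ.L (t.flatMap a)
  elementary : ∀ (I J : IndexModel τ) (f : I → J), K I → K J → IsEmbedding I J f →
    ∀ (M : Type u) [Φ.L.Structure M] (a : I → List M)
      (N : Type u) [Φ.L.Structure N] (b : J → List N), IsGEM I Φ M a → IsGEM J Φ N b →
      ∃ g : M ↪ₑ[Φ.L] N, ∀ t, (a t).map g = b (f t)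
  unique : ∀ (I : IndexModel τ), K I →
    ∀ (M : Type u) [Φ.L.Structure M] (a : I → List M)
      (N : Type u) [Φ.L.Structure N] (b : I → List N), IsGEM I Φ M a → IsGEM I Φ N b →
      Nonempty (M ≃[Φ.L] N)

/-- `Φ ≤ Ψ`, where `e` is the inclusion of the signature of `Φ` in that of `Ψ`: for `I ∈ K`,
`GEM(I, Φ)` is an elementary submodel, with the same skeleton, of the reduct of `GEM(I, Ψ)`. -/
structure Le (K : IndexModel τ → Prop) (Φ Ψ : Template τ) (e : Φ.L →ᴸ Ψ.L) : Prop where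
  injective : e.Injective
  elementary : ∀ I : IndexModel τ, K I →
    ∀ (M : Type u) [Φ.L.Structure M] (a : I → List M)
      (N : Type u) [Ψ.L.Structure N] (b : I → List N), IsGEM I Φ M a → IsGEM I Ψ N b →
      letI : Φ.L.Structure N := e.reduct N
      ∃ g : M ↪ₑ[Φ.L] N, ∀ t, (a t).map g = b t

/-- `Φ ∈ Υ_K[T]`, where `j` is the inclusion of the signature of `T` in that of `Φ`. -/
structure InUpsilonOver (K : IndexModel τ → Prop) (Φ : Template τ) {L : FirstOrder.Language.{u, u}}
    (T : L.Theory) (j : L →ᴸ Φ.L) : Prop where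
  mem : InUpsilon K Φ
  injective : j.Injective
  le_theory : ∀ φ ∈ T, j.onSentence φ ∈ Φ.theory K
  skolem : HasSkolemFunctionsFor j (Φ.theory K)

end Template

open Template

/-! ### Index model classes and contexts -/

section Contexts

variable {τ : FirstOrder.Language.{u, u}}

/-- The Ramsey property.  Since templates in `Υ_K` have skeletons of nonempty tuples without
repetition, the sequence `b` to be reflected is of this kind.  A formula applied to terms is again
a formula, so the terms need no separate mention. -/
def IsRamsey (K : IndexModel τ → Prop) : Prop :=
  ∀ J : IndexModel τ, IsAlephZeroSaturated K J →
  ∀ (L : FirstOrder.Language.{u, u}) (M : Type u) [L.Structure M] (b : J → List M),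
    (∀ s t : J, J.qfType [s] = J.qfType [t] → (b s).length = (b t).length) →
    (∀ t, b t ≠ []) → Function.Injective b →
    ∃ (Ψ : Template τ) (e : L →ᴸ Ψ.L), e.Injective ∧ InUpsilon K Ψ ∧
      ∀ (N : Type u) [Ψ.L.Structure N] (a : J → List N), IsGEM J Ψ N a →
        ∀ (s : List J) (m : ℕ) (φ : L.Formula (Fin m)),
          (∀ t : List J, J.qfType t = J.qfType s →
            (⟨m, φ⟩ : Σ m : ℕ, L.Formula (Fin m)) ∈ tp L (t.flatMap b)) →
          (⟨m, e.onFormula φ⟩ : Σ m : ℕ, Ψ.L.Formula (Fin m)) ∈ tp Ψ.L (s.flatMap a)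

/-- `K` is an index model class for the signature `τ ∋ lt`. -/
structure IsIndexModelClass (lt : τ.Relations 2) (K : IndexModel τ → Prop) : Prop where
  iso_closed : ∀ (I J : IndexModel τ) (f : I → J), IsEmbedding I J f → Function.Surjective f →
    K I → K J
  linear : ∀ I : IndexModel τ, K I →
    (∀ x : I, ¬ I.rel lt ![x, x]) ∧
    (∀ x y z : I, I.rel lt ![x, y] → I.rel lt ![y, z] → I.rel lt ![x, z]) ∧
    (∀ x y : I, I.rel lt ![x, y] ∨ x = y ∨ I.rel lt ![y, x])
  universal : ∀ I : IndexModel τ, K I ↔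
    ∀ (G : IndexModel τ) (f : G → I), IsEmbedding G I f →
      (∃ A : Set G, A.Finite ∧ G.cl A = Set.univ) → K G
  saturated_extension : ∀ I : IndexModel τ, K I →
    ∃ (J : IndexModel τ) (f : I → J), IsAlephZeroSaturated K J ∧ IsEmbedding I J f
  ramsey : IsRamsey K

/-- `(I, K)` is a countable context. -/
structure IsCountableContext (lt : τ.Relations 2) (K : IndexModel τ → Prop)
    (I : IndexModel τ) : Prop where
  isIndexModelClass : IsIndexModelClass lt K
  mem : K I
  countable : Countable I
  nontrivial : ∀ A : Set I, A.Finite → I.cl A ≠ Set.univ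
  reasonable : ∀ (J : IndexModel τ) (f : I → J), IsAlephZeroSaturated K J → IsEmbedding I J f →
    ∀ (t : List I) (s : J),
      (∀ r : J, J.qfType (t.map f ++ [r]) = J.qfType (t.map f ++ [s]) → r = s) →
      s ∈ f '' I.cl {x | x ∈ t}
  non_one_trivial : ∀ (J : IndexModel τ) (f : I → J), IsAlephZeroSaturated K J →
    IsEmbedding I J f → ∀ (t : List I) (s : J), s ∉ J.cl {x | x ∈ t.map f} →
      {r : J | J.qfType (t.map f ++ [r]) = J.qfType (t.map f ++ [s])}.Infinite

/-! ### Shearing and superstability -/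

/-- `b = ⟨b_t̄ : t̄ a finite tuple of J[s̄₀]⟩` is a `K`-indiscernible sequence over `A`, where
`J[s̄₀]` is `J` with constants for the entries of `s̄₀`. -/
def IsIndiscernibleOver (L : FirstOrder.Language.{u, u}) {N : Type u} [L.Structure N] (J : IndexModel τ)
    (s₀ : List J) (A : Set N) (b : List J → List N) : Prop :=
  ∀ ts ts' : List (List J), ts.map List.length = ts'.map List.length →
    J.qfType (s₀ ++ ts.flatten) = J.qfType (s₀ ++ ts'.flatten) →
    tpOver L A (ts.flatMap b) = tpOver L A (ts'.flatMap b)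

/-- The list `s` enumerates the finite set `A`. -/
def Enumerates {X : Type u} (s : List X) (A : Finset X) : Prop :=
  s.Nodup ∧ ∀ x, x ∈ s ↔ x ∈ A

/-- The formula `ψ = φ(x̄, c̄)` shears over `A` in `M` for `(I₀, I₁, (I, K))`. -/
def Shears (K : IndexModel τ → Prop) (I : IndexModel τ) {L : FirstOrder.Language.{u, u}} {M : Type u}
    [L.Structure M] (A : Set M) {k : ℕ} (ψ : ParamFormula L M k) (I₀ I₁ : Finset I) : Prop :=
  I₀ ⊆ I₁ ∧
  ∃ (N : Type u) (_ : L.Structure N) (ι : M ↪ₑ[L] N) (J : IndexModel τ) (f : I → J)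
    (s₀ t : List I) (b : List J → List N),
    IsAlephZeroSaturated K J ∧ IsEmbedding I J f ∧ Enumerates s₀ I₀ ∧ Enumerates t I₁ ∧
    IsIndiscernibleOver L J (s₀.map f) (ι '' A) b ∧
    (List.ofFn ψ.params).map ι = b (t.map f) ∧
    ¬ FinSat {χ : ParamFormula L N k | ∃ (t' : List J) (c' : Fin ψ.arity → N),
      J.qfType (s₀.map f ++ t') = I.qfType (s₀ ++ t) ∧ List.ofFn c' = b t' ∧
      χ = ⟨ψ.arity, ψ.formula, c'⟩}

/-- `T` is unsuperstable for the countable context `(I, K)`; the model `M` is the part of the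
monster model of `T` in which the sets `Bₙ` lie. -/
def IsUnsuperstable (K : IndexModel τ → Prop) (I : IndexModel τ) {L : FirstOrder.Language.{u, u}}
    (T : L.Theory) : Prop :=
  ∃ (M : Type u) (_ : L.Structure M) (_ : Nonempty M) (k : ℕ) (In : ℕ → Finset I)
    (s : ℕ → List I) (B : ℕ → Set M) (p : Set (ParamFormula L M k)),
    M ⊨ T ∧
    Monotone In ∧ (∀ n, (In n).Nonempty) ∧ (∀ x : I, ∃ n, x ∈ In n) ∧
    (∀ n, Enumerates (s n) (In n) ∧ s n <+: s (n + 1)) ∧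
    Monotone B ∧ (∀ n, (B n).Nonempty) ∧
    FinSat p ∧ (∀ ψ ∈ p, ∀ i, ψ.params i ∈ ⋃ n, B n) ∧
    ∀ n, ∃ ψ ∈ p, (∀ i, ψ.params i ∈ B (n + 1)) ∧ Shears K I (B n) ψ (In n) (In (n + 1))

/-- `T` is superstable for the countable context `(I, K)`. -/
def IsSuperstable (K : IndexModel τ → Prop) (I : IndexModel τ) {L : FirstOrder.Language.{u, u}}
    (T : L.Theory) : Prop :=
  ¬ IsUnsuperstable K I T

end Contexts

end Shearing

open Shearing

/-!
A template `Φ` which contains both theories is extended twice: to a template which forces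
non-saturation for the unsuperstable theory, however it is extended further, and then to one for
which the models over `I` are saturated for the superstable theory. Both extensions rest on the
Ramsey property, used in the following form: an elementary extension of `GEM(J, Φ)`, with additional
structure and with new elements as parameters, is reflected in a template `Ψ ≥ Φ` in which the
parameters are constants (`exists_le_reflects`, `exists_le_params`).

*Non-saturation.* Unsuperstability provides an increasing chain of finite sets `Iₙ` with union `I`,
and formulas `ψₙ` with parameters which are jointly consistent, but such that finitely many
conjugates of `ψₙ` over `Iₙ` are inconsistent. By compactness, the parameters can be arranged in a
tree indexed by the copies of the sets `Iₙ₊₁` in an `ℵ₀`-saturated `J ⊇ I`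
(`UnsuperstableData.exists_tree`). A binary operation whose values can be updated one at a time
serves to code functions of finite tuples by elements, in an elementary extension
(`exists_coding`), and such an operation can be added to any template. Hence in some
template above `Φ` the parameters attached to a copy of `Iₙ₊₁` are values of terms, in the part of
the skeleton with indices in that copy (`exists_le_tree`). In `GEM(I, Ψ)`, for any larger `Ψ`, the
countable type along the branch given by `I` itself is finitely satisfiable. A realization of it
would be the value of a term in the skeleton over some `Iₙ`; in `GEM(J, Ψ)` this value would then
satisfy, by indiscernibility, all conjugates of `ψₙ` over `Iₙ`, which are inconsistent
(`UnsuperstableData.not_isSaturated`).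

*Saturation.* Let `κ` be large. A *blueprint* (`IsBlueprint`) is an indiscernible complete type of
the skeleton and of a set of parameters; a blueprint for all parameters gives a template above `Φ`,
with constants for the parameters (`IsBlueprint.exists_template`). A *scheme* is a family of
formulas in one variable, over the skeleton and the parameters, together with a finite base in `J`;
it is good if its conjugates over the base are jointly finitely satisfiable. Since finite functions
are coded by elements, a single new parameter suffices to realize a good scheme by a term in the
part of the skeleton over the base (`IsBlueprint.exists_step`). There are at most `2 ^ κ` schemes,
so all of them can be taken care of, at each of `κ⁺` levels (`exists_isBlueprint_chain`). Now let
`p` be a type over at most `κ` elements of `GEM(I, Ψ)`, where `Ψ` is the resulting template. By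
the regularity of `κ⁺` these elements are terms in the skeleton and the parameters of the levels
below some `w`, and for each finite base in `I` the type `p` becomes a scheme. If it is good for
some base, then it is realized at the level `w`. Otherwise, for every finite part `E` of `I`,
finitely many conjugates over `E` of a finite part of `p` are inconsistent, so that the
conjunction of that part shears over the hull of `E` (`shears_of_inconsistent`); choosing such sets
successively shows the theory to be unsuperstable (`isUnsuperstable_of_forall_shears`). This proves
`isSaturated_of_isSuperstable`.

For models of a theory which contains both of the given ones, no template is given. The Ramsey
property, applied to a sequence of distinct elements in a large model, provides one
(`exists_ramsey_extension`).
-/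

universe v w

namespace Shearing

open IndexModel Template

/-! ### Quantifier-free types of indexed families -/

namespace IndexModel

variable {τ : FirstOrder.Language.{u, u}}

/-- The substitution of variables in atomic formulas. -/
def _root_.Shearing.AtomicFormula.rename (ρ : ℕ → ℕ) : AtomicFormula τ → AtomicFormula τ
  | .equal s t => .equal (s.relabel ρ) (t.relabel ρ)
  | .rel R ts => .rel R fun i => (ts i).relabel ρ

theorem eval_relabel {I : IndexModel τ} {v w : List I} {ρ : ℕ → ℕ}
    (h : ∀ i, v[i]? = w[ρ i]?) (t : τ.Term ℕ) (x : I) :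
    I.Eval w (t.relabel ρ) x ↔ I.Eval v t x := by
  constructor
  · intro H
    induction t generalizing x with
    | var i =>
      cases H with
      | var i' x hx => exact .var _ _ (by rw [h, hx])
    | func F ts ih =>
      cases H with
      | func F' ts' xs y hts hy => exact .func F ts xs x (fun k => ih k _ (hts k)) hy
  · intro H
    induction H with
    | var i x hx => exact .var _ _ (by rw [← h, hx])
    | func F ts xs y _ hy ih => exact .func F _ xs y ih hy

theorem holds_rename {I : IndexModel τ} {v w : List I} {ρ : ℕ → ℕ}
    (h : ∀ i, v[i]? = w[ρ i]?) (φ : AtomicFormula τ) :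
    I.Holds w (φ.rename ρ) ↔ I.Holds v φ := by
  cases φ with
  | equal s t => simp only [AtomicFormula.rename, Holds, eval_relabel h]
  | rel R ts => simp only [AtomicFormula.rename, Holds, eval_relabel h]

theorem IsEmbedding.eval_map {I J : IndexModel τ} {f : I → J} (hf : IsEmbedding I J f)
    (v : List I) (t : τ.Term ℕ) (y : J) :
    J.Eval (v.map f) t y ↔ ∃ x, f x = y ∧ I.Eval v t x := by
  constructor
  · intro H
    induction H with
    | var i y hy =>
      rw [List.getElem?_map, Option.map_eq_some_iff] at hy
      obtain ⟨x, hx, rfl⟩ := hy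
      exact ⟨x, rfl, .var _ _ hx⟩
    | func F ts ys y _ hy ih =>
      choose xs hxs hx using ih
      obtain rfl : (fun k => f (xs k)) = ys := funext hxs
      rw [hf.map_fn, Part.mem_map_iff] at hy
      obtain ⟨x, hx', rfl⟩ := hy
      exact ⟨x, rfl, .func F ts xs x hx hx'⟩
  · rintro ⟨x, rfl, H⟩
    induction H with
    | var i x hx => exact .var _ _ (by simp [hx])
    | func F ts xs x _ hx ih =>
      refine .func F ts (fun k => f (xs k)) _ ih ?_
      rw [hf.map_fn]
      exact Part.mem_map f hx

theorem IsEmbedding.qfType_map {I J : IndexModel τ} {f : I → J} (hf : IsEmbedding I J f)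
    (v : List I) : J.qfType (v.map f) = I.qfType v := by
  ext φ
  cases φ with
  | equal s t =>
    simp only [qfType, Set.mem_ofPred_eq, Holds, hf.eval_map]
    constructor
    · rintro ⟨_, ⟨x, rfl, hx⟩, x', hxx, hx'⟩
      obtain rfl := hf.injective hxx
      exact ⟨_, hx, hx'⟩
    · rintro ⟨x, hx, hx'⟩
      exact ⟨_, ⟨x, rfl, hx⟩, x, rfl, hx'⟩
  | rel R ts =>
    simp only [qfType, Set.mem_ofPred_eq, Holds, hf.eval_map]
    constructor
    · rintro ⟨ys, hys, hR⟩
      choose xs hxs hx using hys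
      obtain rfl : (fun k => f (xs k)) = ys := funext hxs
      exact ⟨xs, hx, (hf.map_rel _ _ _).1 hR⟩
    · rintro ⟨xs, hxs, hR⟩
      exact ⟨_, fun k => ⟨_, rfl, hxs k⟩, (hf.map_rel _ _ _).2 hR⟩

/-- Families `s`, `t` of elements of index models, with the same index set, *have the same
quantifier-free type* if corresponding finite tuples of their entries do. -/
def SameQf {I J : IndexModel τ} {ι : Type v} (s : ι → I) (t : ι → J) : Prop :=
  ∀ l : List ι, I.qfType (l.map s) = J.qfType (l.map t)

namespace SameQf

variable {I J H : IndexModel τ} {ι : Type v} {κ : Type w}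

theorem symm {s : ι → I} {t : ι → J} (h : SameQf s t) : SameQf t s := fun l => (h l).symm

theorem trans {s : ι → I} {t : ι → J} {r : ι → H} (h : SameQf s t) (h' : SameQf t r) :
    SameQf s r := fun l => (h l).trans (h' l)

theorem comp {s : ι → I} {t : ι → J} (h : SameQf s t) (g : κ → ι) : SameQf (s ∘ g) (t ∘ g) :=
  fun l => by rw [← List.map_map, ← List.map_map, h]

theorem of_embedding {f : I → J} (hf : IsEmbedding I J f) (s : ι → I) : SameQf s (f ∘ s) :=
  fun l => by rw [← List.map_map, hf.qfType_map]

/-- A single enumeration of the index set determines the type of a family. -/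
theorem of_list {s : ι → I} {t : ι → J} (l : List ι) (hl : ∀ i, i ∈ l)
    (h : I.qfType (l.map s) = J.qfType (l.map t)) : SameQf s t := by
  classical
  intro l₀
  let ρ : ℕ → ℕ := fun i => if hi : i < l₀.length then l.idxOf l₀[i] else l.length
  have key : ∀ {H : IndexModel τ} (r : ι → H) (i : ℕ), (l₀.map r)[i]? = (l.map r)[ρ i]? := by
    intro H r i
    by_cases hi : i < l₀.length
    · have : l.idxOf l₀[i] < l.length := List.idxOf_lt_length_of_mem (hl _)
      simp [ρ, hi, this]
    · simp [ρ, hi]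
  ext φ
  have h' := Set.ext_iff.1 h (φ.rename ρ)
  simp only [qfType, Set.mem_ofPred_eq] at h' ⊢
  rwa [holds_rename (key s), holds_rename (key t)] at h'

theorem eq_iff {s : ι → I} {t : ι → J} (h : SameQf s t) (i j : ι) : s i = s j ↔ t i = t j := by
  have key : ∀ {H : IndexModel τ} (r : ι → H),
      AtomicFormula.equal (Term.var 0) (Term.var 1) ∈ H.qfType ([i, j].map r) ↔ r i = r j := by
    intro H r
    constructor
    · rintro ⟨x, h0, h1⟩
      cases h0 with
      | var _ _ h0 =>
        cases h1 with
        | var _ _ h1 =>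
          simp only [List.map_cons, List.map_nil, List.getElem?_cons_zero, Option.some.injEq,
            List.getElem?_cons_succ] at h0 h1
          rw [h0, h1]
    · intro hr
      exact ⟨r i, .var _ _ (by simp), .var _ _ (by simp [hr])⟩
  rw [← key s, ← key t, h]

end SameQf

/-- Quantifier-free types know the length of the tuple. -/
theorem length_eq_of_qfType_eq {I J : IndexModel τ} {l : List I} {l' : List J}
    (h : I.qfType l = J.qfType l') : l.length = l'.length := by
  have key : ∀ {H : IndexModel τ} (r : List H) (i : ℕ),
      AtomicFormula.equal (Term.var i) (Term.var i) ∈ H.qfType r ↔ i < r.length := by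
    intro H r i
    constructor
    · rintro ⟨x, h0, -⟩
      cases h0 with
      | var _ _ h0 => exact (List.getElem?_eq_some_iff.1 h0).1
    · intro hi
      exact ⟨r[i], .var _ _ (List.getElem?_eq_getElem hi), .var _ _ (List.getElem?_eq_getElem hi)⟩
  have h' : ∀ i, i < l.length ↔ i < l'.length := fun i => by rw [← key, ← key, h]
  exact le_antisymm (by_contra fun hc => by have := (h' l'.length).1 (by omega); omega)
    (by_contra fun hc => by have := (h' l.length).2 (by omega); omega)

/-! ### Generated submodels, and the extension of finite families -/

theorem subset_cl {I : IndexModel τ} (A : Set I) : A ⊆ I.cl A := fun _ hx _ hS _ => hS hx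

theorem fn_mem_cl {I : IndexModel τ} {A : Set I} {n : ℕ} (F : τ.Functions n) (xs : Fin n → I)
    (h : ∀ k, xs k ∈ I.cl A) {y : I} (hy : y ∈ I.fn F xs) : y ∈ I.cl A :=
  fun S hS hF => hF n F xs (fun k => h k S hS hF) y hy

/-- The submodel generated by a nonempty set. -/
def generated (I : IndexModel τ) (A : Set I) (hA : A.Nonempty) : IndexModel τ where
  carrier := {x : I // x ∈ I.cl A}
  nonempty := ⟨⟨hA.some, subset_cl A hA.some_mem⟩⟩
  fn F xs := ⟨(I.fn F fun k => (xs k).1).Dom, fun h =>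
    ⟨(I.fn F fun k => (xs k).1).get h, fn_mem_cl F _ (fun k => (xs k).2) (Part.get_mem h)⟩⟩
  rel R xs := I.rel R fun k => (xs k).1

theorem isEmbedding_generated (I : IndexModel τ) (A : Set I) (hA : A.Nonempty) :
    IsEmbedding (I.generated A hA) I Subtype.val where
  injective := Subtype.val_injective
  map_fn n F xs := by
    refine Part.ext' Iff.rfl ?_
    intro _ _
    rfl
  map_rel _ _ _ := Iff.rfl

theorem cl_generated (I : IndexModel τ) (A : Set I) (hA : A.Nonempty) :
    (I.generated A hA).cl {x | x.1 ∈ A} = Set.univ := by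
  refine Set.eq_univ_of_forall fun x S hS hF => ?_
  have := x.2 {y | ∃ h : y ∈ I.cl A, (⟨y, h⟩ : I.generated A hA) ∈ S}
    (fun y hy => ⟨subset_cl A hy, hS hy⟩) ?_
  · obtain ⟨_, h⟩ := this
    exact h
  · intro n F xs hxs y hy
    choose h1 h2 using hxs
    refine ⟨fn_mem_cl F xs h1 hy, hF n F (fun k => ⟨xs k, h1 k⟩) h2 _ ?_⟩
    obtain ⟨hd, rfl⟩ := hy
    exact ⟨hd, rfl⟩

/-- A finitely generated submodel of `I` through which a given finite family factors, embedded in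
an `ℵ₀`-saturated `J`. -/
theorem exists_generated {lt : τ.Relations 2} {K : IndexModel τ → Prop}
    (hK : IsIndexModelClass lt K) {I J : IndexModel τ} (hI : K I) (hJ : IsAlephZeroSaturated K J)
    {ι : Type v} [Finite ι] (s : ι → I) :
    ∃ (G : IndexModel τ) (g : G → I) (h : G → J) (r : ι → G), K G ∧ IsEmbedding G I g ∧
      IsEmbedding G J h ∧ g ∘ r = s := by
  let A : Set I := insert (Classical.choice I.nonempty) (Set.range s)
  have hA : A.Nonempty := ⟨_, Set.mem_insert _ _⟩
  have hfin : A.Finite := (Set.finite_range s).insert _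
  have hG : K (I.generated A hA) :=
    (hK.universal I).1 hI _ _ (isEmbedding_generated I A hA)
      ⟨_, hfin.preimage (Subtype.val_injective.injOn), cl_generated I A hA⟩
  obtain ⟨h, hh⟩ := hJ.universal _ hG
    ⟨_, (hfin.preimage (Subtype.val_injective.injOn)).countable, cl_generated I A hA⟩
  exact ⟨_, _, h, fun i => ⟨s i, subset_cl A (Set.mem_insert_of_mem _ ⟨i, rfl⟩)⟩, hG,
    isEmbedding_generated I A hA, hh, rfl⟩

/-- Finite families are copied into every `ℵ₀`-saturated model. -/
theorem exists_sameQf {lt : τ.Relations 2} {K : IndexModel τ → Prop}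
    (hK : IsIndexModelClass lt K) {I J : IndexModel τ} (hI : K I) (hJ : IsAlephZeroSaturated K J)
    {ι : Type v} [Finite ι] (s : ι → I) : ∃ t : ι → J, SameQf s t := by
  obtain ⟨G, g, h, r, -, hg, hh, rfl⟩ := exists_generated hK hI hJ s
  exact ⟨h ∘ r, (SameQf.of_embedding hg r).symm.trans (SameQf.of_embedding hh r)⟩

/-- Back and forth: partial maps into an `ℵ₀`-saturated model extend to finitely many elements. -/
theorem exists_sameQf_extend {lt : τ.Relations 2} {K : IndexModel τ → Prop}
    (hK : IsIndexModelClass lt K) {I J : IndexModel τ} (hI : K I) (hJ : IsAlephZeroSaturated K J)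
    {ι : Type v} {κ : Type w} [Finite ι] [Finite κ] {s : ι → I} {s' : ι → J} (hs : SameQf s s')
    (t : κ → I) : ∃ t' : κ → J, SameQf (Sum.elim s t) (Sum.elim s' t') := by
  classical
  obtain ⟨st, hst⟩ := exists_sameQf hK hI hJ (Sum.elim s t)
  have := Fintype.ofFinite ι
  have := Fintype.ofFinite κ
  set l := (Finset.univ : Finset ι).toList with hl
  have h0 : SameQf (st ∘ Sum.inl) s' := (hst.symm.comp Sum.inl).trans hs
  have key : ∀ lk : List κ, lk.Nodup → ∃ t' : κ → J,
      J.qfType (l.map (st ∘ Sum.inl) ++ lk.map (st ∘ Sum.inr)) =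
        J.qfType (l.map s' ++ lk.map t') := by
    intro lk
    induction lk using List.reverseRecOn with
    | nil => intro _; exact ⟨st ∘ Sum.inr, by simpa using h0 l⟩
    | append_singleton lk k ih =>
      intro hnd
      rw [List.nodup_append] at hnd
      obtain ⟨t', ht'⟩ := ih hnd.1
      obtain ⟨y, hy⟩ := hJ.homogeneous _ _ ht' (st (Sum.inr k))
      refine ⟨Function.update t' k y, ?_⟩
      have : lk.map (Function.update t' k y) = lk.map t' := by
        refine List.map_congr_left fun a ha => ?_
        rw [Function.update_of_ne]
        rintro rfl
        exact hnd.2.2 a ha a (by simp) rfl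
      simpa [this] using hy
  obtain ⟨t', ht'⟩ := key (Finset.univ : Finset κ).toList (Finset.nodup_toList _)
  refine ⟨t', hst.trans (SameQf.of_list (l.map Sum.inl ++
    (Finset.univ : Finset κ).toList.map Sum.inr) ?_ ?_)⟩
  · rintro (i | k) <;> simp [hl]
  · simpa [Function.comp_def] using ht'

end IndexModel

/-! ### Formulas: finite supports, reducts, quantifiers over infinitely many variables -/

section Formulas

variable {L : FirstOrder.Language.{u, u}}

theorem realize_congr_of_support {α : Type v} [DecidableEq α] (φ : L.Formula α) {N : Type w}
    [L.Structure N] {v v' : α → N} (h : ∀ x ∈ φ.freeVarFinset, v x = v' x) :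
    φ.Realize v ↔ φ.Realize v' := by
  have h' : v ∘ ((↑) : ↥(φ.freeVarFinset : Set α) → α) = v' ∘ (↑) :=
    funext fun x => h x.1 x.2
  unfold Formula.Realize
  rw [← BoundedFormula.realize_restrictFreeVar' (Set.Subset.refl _) (v := v), h',
    BoundedFormula.realize_restrictFreeVar']

theorem term_realize_congr_of_support {α : Type v} [DecidableEq α] (t : L.Term α) {N : Type w}
    [L.Structure N] {v v' : α → N} (h : ∀ x ∈ t.varFinset, v x = v' x) :
    t.realize v = t.realize v' := by
  have h' : v ∘ ((↑) : ↥(t.varFinset : Set α) → α) = v' ∘ (↑) :=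
    funext fun x => h x.1 x.2
  rw [← Term.realize_restrictVar' (Set.Subset.refl _) (v := v), h', Term.realize_restrictVar']

theorem realize_subst_formula {α : Type v} {β : Type w} (φ : L.Formula α) (tf : α → L.Term β)
    {N : Type*} [L.Structure N] (v : β → N) :
    Formula.Realize (BoundedFormula.subst φ tf) v ↔ φ.Realize fun x => (tf x).realize v :=
  BoundedFormula.realize_subst

/-- Realization of the image of a formula under a map of signatures is realization in the
reduct. -/
theorem realize_onFormula_reduct {L' : FirstOrder.Language.{u, u}} (e : L →ᴸ L') {α : Type v}
    {N : Type w} [L'.Structure N] (φ : L.Formula α) (v : α → N) :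
    (e.onFormula φ).Realize v ↔ @Formula.Realize L N (e.reduct N) α φ v :=
  letI := e.reduct N
  e.realize_onFormula φ

theorem realize_onSentence_reduct {L' : FirstOrder.Language.{u, u}} (e : L →ᴸ L')
    {N : Type w} [L'.Structure N] (φ : L.Sentence) :
    N ⊨ e.onSentence φ ↔ @Sentence.Realize L N (e.reduct N) φ :=
  letI := e.reduct N
  e.realize_onSentence N φ

/-- Existential quantification over an arbitrary set of variables is expressed by a formula, as
only finitely many of them occur. -/
theorem exists_formula_ex {α : Type v} {β : Type w} (φ : L.Formula (α ⊕ β)) :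
    ∃ θ : L.Formula α, ∀ (N : Type u) [L.Structure N] [Nonempty N] (v : α → N),
      θ.Realize v ↔ ∃ y : β → N, φ.Realize (Sum.elim v y) := by
  classical
  let B : Set β := {b | Sum.inr b ∈ φ.freeVarFinset}
  have hB : B.Finite := (φ.freeVarFinset.finite_toSet.preimage Sum.inr_injective.injOn)
  have : Finite B := hB
  let f : φ.freeVarFinset → α ⊕ B := fun x =>
    match x with
    | ⟨Sum.inl a, _⟩ => Sum.inl a
    | ⟨Sum.inr b, h⟩ => Sum.inr ⟨b, h⟩
  refine ⟨Formula.iExs B (φ.restrictFreeVar f), fun N _ _ v => ?_⟩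
  rw [Formula.realize_iExs]
  have key : ∀ (y : β → N) (y' : B → N), (∀ b : B, y' b = y b) →
      (Formula.Realize (φ.restrictFreeVar f) (Sum.elim v y') ↔ φ.Realize (Sum.elim v y)) := by
    intro y y' h
    refine BoundedFormula.realize_restrictFreeVar (Sum.elim v y) ?_
    rintro ⟨a | b, hab⟩
    · rfl
    · exact h _
  constructor
  · rintro ⟨y', h⟩
    let y : β → N := fun b => if hb : b ∈ B then y' ⟨b, hb⟩ else Classical.arbitrary N
    exact ⟨y, (key y y' fun b => by simp [y]).1 h⟩
  · rintro ⟨y, h⟩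
    exact ⟨fun b => y b, (key y _ fun b => rfl).2 h⟩

/-- The conjunction of a finite set of formulas. -/
noncomputable def conj {α : Type v} (F : Set (L.Formula α)) (hF : F.Finite) : L.Formula α :=
  haveI : Finite F := hF.to_subtype
  Formula.iInf fun φ : F => φ.1

theorem realize_conj {α : Type v} {F : Set (L.Formula α)} (hF : F.Finite) {N : Type w}
    [L.Structure N] (v : α → N) : (conj F hF).Realize v ↔ ∀ φ ∈ F, φ.Realize v := by
  have : Finite F := hF.to_subtype
  unfold conj
  rw [Formula.realize_iInf]
  simp

/-! ### Compactness -/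

/-- A set of formulas, each of whose finite subsets is realized in some structure, is realized. -/
theorem exists_realize_of_finite {α : Type u} (Q : Set (L.Formula α))
    (h : ∀ F ⊆ Q, F.Finite → ∃ (N : Type u) (_ : L.Structure N) (_ : Nonempty N) (v : α → N),
      ∀ φ ∈ F, φ.Realize v) :
    ∃ (N : Type u) (_ : L.Structure N) (_ : Nonempty N) (v : α → N), ∀ φ ∈ Q, φ.Realize v := by
  let T : L[[α]].Theory := Formula.equivSentence '' Q
  have hT : T.IsSatisfiable := by
    rw [Theory.isSatisfiable_iff_isFinitelySatisfiable]
    intro T₀ hT₀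
    obtain ⟨N, _, _, v, hv⟩ := h (Formula.equivSentence.symm '' (T₀ : Set L[[α]].Sentence))
      (by
        rintro _ ⟨ψ, hψ, rfl⟩
        obtain ⟨φ, hφ, rfl⟩ := hT₀ hψ
        simpa using hφ) (T₀.finite_toSet.image _)
    let _ := constantsOn.structure v
    have : N ⊨ (T₀ : L[[α]].Theory) := by
      rw [Theory.model_iff]
      intro ψ hψ
      have := hv _ ⟨ψ, hψ, rfl⟩
      rwa [Formula.realize_equivSentence_symm] at this
    exact Theory.Model.isSatisfiable N
  obtain ⟨M⟩ := hT
  let _ : L.Structure M := (L.lhomWithConstants α).reduct M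
  refine ⟨M, inferInstance, inferInstance, fun a => (L.con a : M), fun φ hφ => ?_⟩
  have : M ⊨ Formula.equivSentence φ := M.is_model.realize_of_mem _ ⟨φ, hφ, rfl⟩
  rwa [Formula.realize_equivSentence] at this

/-- Formulas with parameters in `N` and new variables, finitely satisfiable in `N`, are realized in
an elementary extension of `N`. -/
theorem exists_elementary_extension {N : Type u} [L.Structure N] [Nonempty N] {Γ : Type u}
    (Q : Set (L.Formula (N ⊕ Γ)))
    (h : ∀ F ⊆ Q, F.Finite → ∃ c : Γ → N, ∀ φ ∈ F, φ.Realize (Sum.elim id c)) :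
    ∃ (N' : Type u) (_ : L.Structure N') (_ : Nonempty N') (g : N ↪ₑ[L] N') (c : Γ → N'),
      ∀ φ ∈ Q, φ.Realize (Sum.elim g c) := by
  let D : Set (L.Formula (N ⊕ Γ)) := {φ | ∃ ψ : L.Formula N, ψ.Realize id ∧ φ = ψ.relabel Sum.inl}
  obtain ⟨N', _, _, v, hv⟩ := exists_realize_of_finite (Q ∪ D) (by
    intro F hF hfin
    obtain ⟨c, hc⟩ := h (F ∩ Q) Set.inter_subset_right (hfin.inter_of_left _)
    refine ⟨N, inferInstance, inferInstance, Sum.elim id c, fun φ hφ => ?_⟩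
    rcases hF hφ with hQ | ⟨ψ, hψ, rfl⟩
    · exact hc φ ⟨hφ, hQ⟩
    · rw [Formula.realize_relabel]
      exact hψ)
  have hD : ∀ ψ : L.Formula N, ψ.Realize id → ψ.Realize (v ∘ Sum.inl) := fun ψ hψ => by
    have := hv _ (Or.inr ⟨ψ, hψ, rfl⟩)
    rwa [Formula.realize_relabel] at this
  refine ⟨N', inferInstance, inferInstance, ⟨v ∘ Sum.inl, fun n φ x => ?_⟩, v ∘ Sum.inr,
    fun φ hφ => ?_⟩
  · have h1 := hD (φ.relabel x)
    have h2 := hD (φ.relabel x).not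
    rw [Formula.realize_not, Formula.realize_not] at h2
    rw [Formula.realize_relabel, Formula.realize_relabel] at h1 h2
    exact ⟨fun h => by_contra fun h' => h2 h' h, h1⟩
  · have := hv φ (Or.inl hφ)
    rwa [← Sum.elim_comp_inl_inr v] at this

/-! ### Embeddings determined by generating families -/

/-- Every element of a structure generated by a family is the value of a term. -/
theorem exists_term_of_closure {α : Type v} {N : Type u} [L.Structure N] {v : α → N}
    {x : N} (hx : x ∈ Substructure.closure L (Set.range v)) :
    ∃ t : L.Term α, t.realize v = x := by
  obtain ⟨t, rfl⟩ := Substructure.mem_closure_iff_exists_term.1 hx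
  choose g hg using fun y : Set.range v => y.2
  refine ⟨t.relabel g, ?_⟩
  rw [Term.realize_relabel]
  congr 1
  exact funext hg

theorem exists_elementaryEmbedding_of_realize_iff {α : Type v} {N N' : Type u} [L.Structure N]
    [L.Structure N'] {v : α → N} {v' : α → N'}
    (hgen : Substructure.closure L (Set.range v) = ⊤)
    (h : ∀ φ : L.Formula α, φ.Realize v ↔ φ.Realize v') :
    ∃ g : N ↪ₑ[L] N', ∀ x, g (v x) = v' x := by
  choose t ht using fun x : N => exists_term_of_closure (v := v) (x := x) (by rw [hgen]; trivial)
  refine ⟨⟨fun x => (t x).realize v', fun n φ x => ?_⟩, fun x => ?_⟩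
  · have := h (BoundedFormula.subst φ (fun i => t (x i)))
    rw [realize_subst_formula, realize_subst_formula] at this
    simp only [ht] at this
    exact this.symm
  · have := (h ((t (v x)).equal (Term.var x))).1
    simp only [Formula.realize_equal, Term.realize_var, ht] at this
    exact this trivial

theorem exists_embedding_of_realize_iff {α : Type v} {N N' : Type u} [L.Structure N]
    [L.Structure N'] {v : α → N} {v' : α → N'}
    (hgen : Substructure.closure L (Set.range v) = ⊤)
    (h : ∀ φ : L.Formula α, BoundedFormula.IsQF φ → (φ.Realize v ↔ φ.Realize v')) :
    ∃ g : N ↪[L] N', ∀ x, g (v x) = v' x := by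
  choose t ht using fun x : N => exists_term_of_closure (v := v) (x := x) (by rw [hgen]; trivial)
  have heq : ∀ t₁ t₂ : L.Term α, t₁.realize v = t₂.realize v ↔ t₁.realize v' = t₂.realize v' := by
    intro t₁ t₂
    have := h (t₁.equal t₂) (BoundedFormula.IsAtomic.equal _ _).isQF
    simpa only [Formula.realize_equal] using this
  refine ⟨⟨⟨fun x => (t x).realize v', fun x y hxy => ?_⟩, fun F x => ?_, fun R x => ?_⟩,
    fun x => ?_⟩
  · have := (heq (t x) (t y)).2 hxy
    rwa [ht, ht] at this
  · have := (heq (t (Structure.funMap F x)) (Term.func F fun i => t (x i))).1 (by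
      rw [ht, Term.realize_func]
      simp only [ht])
    exact this
  · have := h (R.formula fun i => t (x i)) (BoundedFormula.IsAtomic.rel _ _).isQF
    simp only [Formula.realize_rel, ht] at this
    exact this.symm
  · exact (heq (t (v x)) (Term.var x)).1 (ht _)

end Formulas

/-! ### Skeletons of finite tuples as families indexed by `I × ℕ` -/

section Entries

variable {L : FirstOrder.Language.{u, u}} {N : Type u} {J : Type v}

/-- The `i`-th entry of the `t`-th tuple of a sequence of nonempty tuples.  Beyond the length of
the tuple its first entry is repeated, so that each tuple becomes an infinite sequence. -/
def entry (a : J → List N) (ha : ∀ t, a t ≠ []) (x : J × ℕ) : N :=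
  (a x.1).getD x.2 ((a x.1).head (ha x.1))

theorem map_entry_range (a : J → List N) (ha : ∀ t, a t ≠ []) (t : J) :
    (List.range (a t).length).map (fun i => entry a ha (t, i)) = a t := by
  refine List.ext_getElem (by simp) fun i h1 h2 => ?_
  simp [entry, h2]

theorem entry_eq_zero (a : J → List N) (ha : ∀ t, a t ≠ []) (t : J) {i : ℕ}
    (hi : (a t).length ≤ i) : entry a ha (t, i) = entry a ha (t, 0) := by
  have := List.length_pos_of_ne_nil (ha t)
  have h0 : ¬ i < (a t).length := by omega
  simp [entry, h0, List.head_eq_getElem, this]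

theorem entry_mem (a : J → List N) (ha : ∀ t, a t ≠ []) (x : J × ℕ) : entry a ha x ∈ a x.1 := by
  by_cases h : x.2 < (a x.1).length
  · simp [entry, h]
  · simp [entry, h]

theorem entry_map {N' : Type u} (g : N → N') (a : J → List N) (ha : ∀ t, a t ≠ [])
    (ha' : ∀ t, (a t).map g ≠ []) (x : J × ℕ) :
    entry (fun t => (a t).map g) ha' x = g (entry a ha x) := by
  by_cases h : x.2 < (a x.1).length
  · simp [entry, h]
  · simp [entry, h]

/-- The variables `(k, i)`, `i < ℓ k`, for the entries of a finite sequence of finite tuples. -/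
def varList {ι : Type w} (ℓ : ι → ℕ) (l : List ι) : List (ι × ℕ) :=
  l.flatMap fun k => (List.range (ℓ k)).map fun i => (k, i)

theorem mem_varList {ι : Type w} {ℓ : ι → ℕ} {l : List ι} {x : ι × ℕ} :
    x ∈ varList ℓ l ↔ x.1 ∈ l ∧ x.2 < ℓ x.1 := by
  obtain ⟨k, i⟩ := x
  simp only [varList, List.mem_flatMap, List.mem_map, List.mem_range, Prod.mk.injEq]
  constructor
  · rintro ⟨k, hk, i, hi, rfl, rfl⟩
    exact ⟨hk, hi⟩
  · rintro ⟨hk, hi⟩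
    exact ⟨k, hk, i, hi, rfl, rfl⟩

theorem flatMap_eq_varList_map {ι : Type w} (a : J → List N) (ha : ∀ t, a t ≠ []) (s : ι → J)
    (l : List ι) : (l.map s).flatMap a =
      (varList (fun k => (a (s k)).length) l).map fun x => entry a ha (s x.1, x.2) := by
  induction l with
  | nil => rfl
  | cons k l ih =>
    simp only [varList, List.flatMap_cons, List.map_append, List.map_cons, List.map_map] at ih ⊢
    rw [← ih]
    congr 1
    exact (map_entry_range a ha (s k)).symm

/-- The type of `v` along a list of variables, in terms of the realized formulas. -/
theorem mem_tp_map_iff [L.Structure N] {α : Type w} (l : List α) (v : α → N) {m : ℕ}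
    (φ : L.Formula (Fin m)) :
    (⟨m, φ⟩ : Σ m : ℕ, L.Formula (Fin m)) ∈ tp L (l.map v) ↔
      ∃ h : l.length = m, φ.Realize fun i => v (l.get (i.cast h.symm)) := by
  simp only [tp, Set.mem_ofPred_eq, List.length_map]
  refine exists_congr fun h => ?_
  refine iff_of_eq (congrArg _ (funext fun i => ?_))
  simp [tuple]

theorem length_eq_of_tp_eq {L : FirstOrder.Language.{u, u}} {N N' : Type u} [L.Structure N]
    [L.Structure N'] {l : List N} {l' : List N'} (h : tp L l = tp L l') :
    l.length = l'.length := by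
  have : (⟨l.length, ⊤⟩ : Σ m : ℕ, L.Formula (Fin m)) ∈ tp L l := ⟨rfl, by simp⟩
  rw [h] at this
  exact this.1.symm

theorem length_eq_of_qftp_eq {L : FirstOrder.Language.{u, u}} {N N' : Type u} [L.Structure N]
    [L.Structure N'] {l : List N} {l' : List N'} (h : qftp L l = qftp L l') :
    l.length = l'.length := by
  have : (⟨l.length, ⊤⟩ : Σ m : ℕ, L.Formula (Fin m)) ∈ qftp L l :=
    ⟨⟨rfl, by simp⟩, BoundedFormula.IsQF.top⟩
  rw [h] at this
  exact this.1.1.symm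

theorem tp_map_eq_of_realize_iff {N' : Type u} [L.Structure N] [L.Structure N'] {α : Type w}
    (v : α → N) (v' : α → N') (h : ∀ φ : L.Formula α, φ.Realize v ↔ φ.Realize v') (l : List α) :
    tp L (l.map v) = tp L (l.map v') := by
  ext ⟨m, φ⟩
  rw [mem_tp_map_iff, mem_tp_map_iff]
  refine exists_congr fun hm => ?_
  have := h (φ.relabel fun i => l.get (i.cast hm.symm))
  rwa [Formula.realize_relabel, Formula.realize_relabel] at this

/-- A formula about the entries of a sequence of tuples, as a formula about their
concatenation. -/
theorem exists_index {ι : Type w} (ℓ : ι → ℕ) (hℓ : ∀ k, 0 < ℓ k) (l : List ι)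
    (hl : l ≠ [] ∨ IsEmpty ι) :
    ∃ idx : ι × ℕ → Fin (varList ℓ l).length, ∀ x : ι × ℕ, x.1 ∈ l →
      (varList ℓ l).get (idx x) = (x.1, if x.2 < ℓ x.1 then x.2 else 0) := by
  classical
  have hmem : ∀ x : ι × ℕ, x.1 ∈ l → (x.1, if x.2 < ℓ x.1 then x.2 else 0) ∈ varList ℓ l := by
    intro x hx
    rw [mem_varList]
    refine ⟨hx, ?_⟩
    dsimp only
    split_ifs with h
    · exact h
    · exact hℓ _
  rcases hl with hl | hl
  · obtain ⟨k₀, hk₀⟩ := List.exists_mem_of_ne_nil l hl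
    refine ⟨fun x => if hx : x.1 ∈ l then ⟨_, List.idxOf_lt_length_of_mem (hmem x hx)⟩
      else ⟨_, List.idxOf_lt_length_of_mem (hmem (k₀, 0) hk₀)⟩, fun x hx => ?_⟩
    simp [hx]
  · exact ⟨fun x => (hl.false x.1).elim, fun x => (hl.false x.1).elim⟩

theorem mem_tp_flatMap_iff [L.Structure N] {ι : Type w} [DecidableEq ι] {ℓ : ι → ℕ} {l : List ι}
    {idx : ι × ℕ → Fin (varList ℓ l).length}
    (hidx : ∀ x : ι × ℕ, x.1 ∈ l →
      (varList ℓ l).get (idx x) = (x.1, if x.2 < ℓ x.1 then x.2 else 0))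
    (a : J → List N) (ha : ∀ t, a t ≠ []) (s : ι → J) (hs : ∀ k, (a (s k)).length = ℓ k)
    (φ : L.Formula (ι × ℕ)) (hφ : ∀ x ∈ φ.freeVarFinset, x.1 ∈ l) :
    (⟨_, φ.relabel idx⟩ : Σ m : ℕ, L.Formula (Fin m)) ∈ tp L ((l.map s).flatMap a) ↔
      φ.Realize fun x => entry a ha (s x.1, x.2) := by
  obtain rfl : (fun k => (a (s k)).length) = ℓ := funext hs
  rw [flatMap_eq_varList_map a ha, mem_tp_map_iff]
  constructor
  · rintro ⟨_, h⟩
    rw [Formula.realize_relabel] at h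
    refine (realize_congr_of_support φ fun x hx => ?_).1 h
    dsimp only [Function.comp]
    rw [Fin.cast_eq_self, hidx x (hφ x hx)]
    dsimp only
    split_ifs with hlt
    · rfl
    · exact (entry_eq_zero a ha _ (not_lt.1 hlt)).symm
  · intro h
    refine ⟨rfl, ?_⟩
    rw [Formula.realize_relabel]
    refine (realize_congr_of_support φ fun x hx => ?_).1 h
    dsimp only [Function.comp]
    rw [Fin.cast_eq_self, hidx x (hφ x hx)]
    dsimp only
    split_ifs with hlt
    · rfl
    · exact entry_eq_zero a ha _ (not_lt.1 hlt)

/-- Two sequences whose finite subsequences have the same types satisfy the same formulas;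
likewise for quantifier-free types and formulas. -/
theorem realize_entry_iff_of_tp {N' : Type u} {J' : Type v} [L.Structure N] [L.Structure N']
    {ι : Type w} (a : J → List N) (ha : ∀ t, a t ≠ []) (a' : J' → List N') (ha' : ∀ t, a' t ≠ [])
    (s : ι → J) (s' : ι → J') (P : ∀ {m : ℕ}, L.Formula (Fin m) → Prop)
    (hP0 : ∀ m, P (⊤ : L.Formula (Fin m)))
    (h : ∀ (l : List ι) (m : ℕ) (φ : L.Formula (Fin m)), P φ →
      ((⟨m, φ⟩ : Σ m : ℕ, L.Formula (Fin m)) ∈ tp L ((l.map s).flatMap a) ↔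
        (⟨m, φ⟩ : Σ m : ℕ, L.Formula (Fin m)) ∈ tp L ((l.map s').flatMap a')))
    (φ : L.Formula (ι × ℕ)) (hPφ : ∀ (m : ℕ) (g : ι × ℕ → Fin m), P (φ.relabel g)) :
    (φ.Realize fun x => entry a ha (s x.1, x.2)) ↔
      φ.Realize fun x => entry a' ha' (s' x.1, x.2) := by
  classical
  have hlen : ∀ k, (a' (s' k)).length = (a (s k)).length := by
    intro k
    have := (h [k] (a (s k)).length ⊤ (hP0 _)).1 ⟨by simp, by simp⟩
    obtain ⟨h1, -⟩ := this
    simpa using h1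
  by_cases hι : IsEmpty ι
  · obtain ⟨idx, hidx⟩ := exists_index (fun k => (a (s k)).length)
      (fun k => List.length_pos_of_ne_nil (ha _)) [] (Or.inr hι)
    rw [← mem_tp_flatMap_iff hidx a ha s (fun _ => rfl) φ (fun x _ => (hι.false x.1).elim),
      ← mem_tp_flatMap_iff hidx a' ha' s' hlen φ (fun x _ => (hι.false x.1).elim)]
    exact h _ _ _ (hPφ _ _)
  · rw [not_isEmpty_iff] at hι
    obtain ⟨k₀⟩ := hι
    let l : List ι := k₀ :: (φ.freeVarFinset.image Prod.fst).toList
    have hl : ∀ x ∈ φ.freeVarFinset, x.1 ∈ l := fun x hx => by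
      refine List.mem_cons_of_mem _ ?_
      rw [Finset.mem_toList]
      exact Finset.mem_image_of_mem _ hx
    obtain ⟨idx, hidx⟩ := exists_index (fun k => (a (s k)).length)
      (fun k => List.length_pos_of_ne_nil (ha _)) l (Or.inl (List.cons_ne_nil _ _))
    rw [← mem_tp_flatMap_iff hidx a ha s (fun _ => rfl) φ hl,
      ← mem_tp_flatMap_iff hidx a' ha' s' hlen φ hl]
    exact h _ _ _ (hPφ _ _)

end Entries

/-! ### Models `GEM(I, Φ)` and the relation `Φ ≤ Ψ` -/

section GEM

variable {τ : FirstOrder.Language.{u, u}} {K : IndexModel τ → Prop}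

theorem range_entry {N : Type u} {J : Type v} (a : J → List N) (ha : ∀ t, a t ≠ []) :
    Set.range (entry a ha) = {x | ∃ t, x ∈ a t} := by
  ext x
  constructor
  · rintro ⟨y, rfl⟩
    exact ⟨_, entry_mem a ha y⟩
  · rintro ⟨t, ht⟩
    rw [← map_entry_range a ha t, List.mem_map] at ht
    obtain ⟨i, -, rfl⟩ := ht
    exact ⟨_, rfl⟩

theorem map_eq_of_entry {N N' : Type u} {J : Type v} {a : J → List N} (ha : ∀ t, a t ≠ [])
    {a' : J → List N'} (ha' : ∀ t, a' t ≠ []) {g : N → N'}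
    (hg : ∀ x, g (entry a ha x) = entry a' ha' x) {t : J} (hl : (a t).length = (a' t).length) :
    (a t).map g = a' t := by
  rw [← map_entry_range a ha t, ← map_entry_range a' ha' t, hl, List.map_map]
  exact List.map_congr_left fun i _ => hg _

theorem ne_nil_of_length_eq {N N' : Type u} {J : Type v} {a : J → List N} (ha : ∀ t, a t ≠ [])
    {a' : J → List N'} (hl : ∀ t, (a t).length = (a' t).length) (t : J) : a' t ≠ [] := by
  intro h
  have := hl t
  rw [h, List.length_nil] at this
  exact ha t (List.length_eq_zero_iff.1 this)

theorem exists_elementaryEmbedding_of_tp_eq {L : FirstOrder.Language.{u, u}} {N N' : Type u}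
    [L.Structure N] [L.Structure N'] {J : Type v} {a : J → List N} (ha : ∀ t, a t ≠ [])
    {a' : J → List N'} (hgen : Substructure.closure L {x : N | ∃ t, x ∈ a t} = ⊤)
    (h : ∀ l : List J, tp L (l.flatMap a) = tp L (l.flatMap a')) :
    ∃ g : N ↪ₑ[L] N', ∀ t, (a t).map g = a' t := by
  have hl : ∀ t, (a t).length = (a' t).length := fun t => by
    simpa using length_eq_of_tp_eq (h [t])
  have ha' := ne_nil_of_length_eq ha hl
  obtain ⟨g, hg⟩ := exists_elementaryEmbedding_of_realize_iff (v := entry a ha)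
    (v' := entry a' ha') (by rwa [range_entry]) fun φ =>
      realize_entry_iff_of_tp a ha a' ha' id id (fun _ => True) (fun _ => trivial)
        (fun l m φ _ => by rw [List.map_id, h]) φ fun _ _ => trivial
  exact ⟨g, fun t => map_eq_of_entry ha ha' hg (hl t)⟩

theorem exists_embedding_of_qftp_eq {L : FirstOrder.Language.{u, u}} {N N' : Type u}
    [L.Structure N] [L.Structure N'] {J : Type v} {a : J → List N} (ha : ∀ t, a t ≠ [])
    {a' : J → List N'} (hgen : Substructure.closure L {x : N | ∃ t, x ∈ a t} = ⊤)
    (h : ∀ l : List J, qftp L (l.flatMap a) = qftp L (l.flatMap a')) :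
    ∃ g : N ↪[L] N', ∀ t, (a t).map g = a' t := by
  have hl : ∀ t, (a t).length = (a' t).length := fun t => by
    simpa using length_eq_of_qftp_eq (h [t])
  have ha' := ne_nil_of_length_eq ha hl
  obtain ⟨g, hg⟩ := exists_embedding_of_realize_iff (v := entry a ha)
    (v' := entry a' ha') (by rwa [range_entry]) fun φ hφ =>
      realize_entry_iff_of_tp a ha a' ha' id id (fun φ => BoundedFormula.IsQF φ)
        (fun _ => BoundedFormula.IsQF.top)
        (fun l m φ hφ => by
          have := Set.ext_iff.1 (h l) ⟨m, φ⟩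
          simpa only [List.map_id, qftp, Set.mem_ofPred_eq, hφ, and_true] using this) φ
        fun _ _ => (hφ.relabel _)
  exact ⟨g, fun t => map_eq_of_entry ha ha' hg (hl t)⟩

theorem tp_map_elementaryEmbedding {L : FirstOrder.Language.{u, u}} {N N' : Type u}
    [L.Structure N] [L.Structure N'] (g : N ↪ₑ[L] N') (l : List N) :
    tp L (l.map g) = tp L l := by
  have := tp_map_eq_of_realize_iff (L := L) g id (fun φ => g.map_formula φ id) l
  rwa [List.map_id] at this

theorem flatMap_map_map {N N' : Type u} {I : Type v} {J : Type w} {a : I → List N}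
    {b : J → List N'} {g : N → N'} {f : I → J} (h : ∀ t, (a t).map g = b (f t)) (l : List I) :
    (l.map f).flatMap b = (l.flatMap a).map g := by
  rw [List.flatMap_map, List.map_flatMap]
  simp only [h]

theorem _root_.FirstOrder.Language.LHom.Injective.comp {L L' L'' : FirstOrder.Language.{u, u}}
    {e' : L' →ᴸ L''} {e : L →ᴸ L'} (h' : e'.Injective) (h : e.Injective) :
    (e'.comp e).Injective :=
  ⟨fun hx => h.onFunction (h'.onFunction hx), fun hx => h.onRelation (h'.onRelation hx)⟩

namespace Template

theorem IsGEM.tp_eq {lt : τ.Relations 2} (hK : IsIndexModelClass lt K) {Φ : Template τ}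
    (hΦ : Φ.InUpsilon K) {I J : IndexModel τ} (hI : K I) (hJ : IsAlephZeroSaturated K J)
    {M N : Type u} [Φ.L.Structure M] [Φ.L.Structure N] {a : I → List M} {b : J → List N}
    (ha : IsGEM I Φ M a) (hb : IsGEM J Φ N b) {l : List I} {l' : List J}
    (hl : I.qfType l = J.qfType l') : tp Φ.L (l.flatMap a) = tp Φ.L (l'.flatMap b) := by
  obtain ⟨G, g, h, r, hG, hg, hh, hr⟩ := exists_generated hK hI hJ l.get
  obtain ⟨P, _, c, hc⟩ := hΦ.proper G hG
  obtain ⟨g', hg'⟩ := hΦ.elementary G I g hG hI hg P c M a hc ha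
  obtain ⟨h', hh'⟩ := hΦ.elementary G J h hG hJ.mem hh P c N b hc hb
  have hr' : l = ((List.finRange _).map r).map g := by
    rw [List.map_map, hr, ← List.ofFn_eq_map, List.ofFn_get]
  have h1 : tp Φ.L (l.flatMap a) = tp Φ.L (((List.finRange l.length).map r).flatMap c) := by
    rw [← tp_map_elementaryEmbedding g', ← flatMap_map_map hg', ← hr']
  have h2 : tp Φ.L ((((List.finRange l.length).map r).map h).flatMap b) =
      tp Φ.L (((List.finRange l.length).map r).flatMap c) := by
    rw [← tp_map_elementaryEmbedding h', ← flatMap_map_map hh']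
  rw [h1, ← h2]
  refine hΦ.indiscernible J N b hJ.mem hb _ _ ?_
  rw [hh.qfType_map, ← hg.qfType_map, ← hr', hl]

theorem Le.of_tp_eq {lt : τ.Relations 2} (hK : IsIndexModelClass lt K) {Φ Ψ : Template τ}
    (hΦ : Φ.InUpsilon K) (hΨ : Ψ.InUpsilon K) {J : IndexModel τ}
    (hJ : IsAlephZeroSaturated K J) {e : Φ.L →ᴸ Ψ.L} (he : e.Injective) {M N : Type u}
    [Φ.L.Structure M] [Ψ.L.Structure N] {a : J → List M} {b : J → List N} (ha : IsGEM J Φ M a)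
    (hb : IsGEM J Ψ N b)
    (h : ∀ l : List J, tp Φ.L (l.flatMap a) = @tp Φ.L N (e.reduct N) (l.flatMap b)) :
    Le K Φ Ψ e where
  injective := he
  elementary I hI M' _ a' N' _ b' ha' hb' := by
    let _ : Φ.L.Structure N' := e.reduct N'
    refine exists_elementaryEmbedding_of_tp_eq (hΦ.nontrivial I M' a' hI ha').1 ha'.generates
      fun l => ?_
    obtain ⟨t, ht⟩ := exists_sameQf hK hI hJ l.get
    have hl : I.qfType l = J.qfType (List.ofFn t) := by
      have := ht (List.finRange _)
      rwa [← List.ofFn_eq_map, ← List.ofFn_eq_map, List.ofFn_get] at this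
    rw [ha'.tp_eq hK hΦ hI hJ ha hl, h]
    have h2 := hb'.tp_eq hK hΨ hI hJ hb hl
    ext ⟨m, φ⟩
    have h3 := Set.ext_iff.1 h2 ⟨m, e.onFormula φ⟩
    simp only [tp, Set.mem_ofPred_eq, realize_onFormula_reduct] at h3
    exact h3.symm

theorem Le.trans {Φ Ψ Χ : Template τ} (hΨ : Ψ.InUpsilon K) {e : Φ.L →ᴸ Ψ.L} {e' : Ψ.L →ᴸ Χ.L}
    (h : Le K Φ Ψ e) (h' : Le K Ψ Χ e') : Le K Φ Χ (e'.comp e) where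
  injective := h'.injective.comp h.injective
  elementary I hI M _ a N _ b ha hb := by
    let _ : Φ.L.Structure N := (e'.comp e).reduct N
    obtain ⟨P, _, c, hc⟩ := hΨ.proper I hI
    let _ : Φ.L.Structure P := e.reduct P
    let _ : Ψ.L.Structure N := e'.reduct N
    obtain ⟨g, hg⟩ := h.elementary I hI M a P c ha hc
    obtain ⟨g', hg'⟩ := h'.elementary I hI P c N b hc hb
    refine ⟨⟨g' ∘ g, fun n φ x => ?_⟩, fun t => ?_⟩
    · have h1 := g'.map_formula (e.onFormula φ) (g ∘ x)
      rw [realize_onFormula_reduct, realize_onFormula_reduct] at h1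
      exact h1.trans (g.map_formula φ x)
    · rw [← hg', ← hg, List.map_map]
      rfl

theorem IsGEM.nonempty {Φ : Template τ} (hΦ : Φ.InUpsilon K) {I : IndexModel τ} (hI : K I)
    {M : Type u} [Φ.L.Structure M] {a : I → List M} (ha : IsGEM I Φ M a) : Nonempty M := by
  obtain ⟨t⟩ := I.nonempty
  exact ⟨(a t).head ((hΦ.nontrivial I M a hI ha).1 t)⟩

theorem IsGEM.models {Φ : Template τ} {I : IndexModel τ} (hI : K I)
    {M : Type u} [Φ.L.Structure M] {a : I → List M} (ha : IsGEM I Φ M a) : M ⊨ Φ.theory K :=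
  (Theory.model_iff _).2 fun _ hφ => hφ I M a hI ha

theorem mem_theory_of_realize {Φ : Template τ} (hΦ : Φ.InUpsilon K) {I : IndexModel τ} (hI : K I)
    {M : Type u} [Φ.L.Structure M] {a : I → List M} (ha : IsGEM I Φ M a) {φ : Φ.L.Sentence}
    (hφ : M ⊨ φ) : φ ∈ Φ.theory K := by
  have := ha.nonempty hΦ hI
  have := ha.models hI
  rcases hΦ.complete.2 φ with h | h
  · intro I' N _ b hI' hb
    have := hb.nonempty hΦ hI'
    have := hb.models hI'
    exact h.realize_sentence N
  · exact absurd hφ ((Sentence.realize_not M).1 (h.realize_sentence M))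

theorem InUpsilonOver.of_subset {Φ : Template τ} (hΦ : Φ.InUpsilon K)
    {L : FirstOrder.Language.{u, u}} {T : L.Theory} {j : L →ᴸ Φ.L} (hj : j.Injective)
    (hT : ∀ φ ∈ T, j.onSentence φ ∈ Φ.theory K) : Φ.InUpsilonOver K T j where
  mem := hΦ
  injective := hj
  le_theory := hT
  skolem n φ := by
    have := hΦ.skolem n (j.onBoundedFormula φ)
    simpa only [LHom.id_onBoundedFormula, id_eq] using this

theorem Le.theory_mono {Φ Ψ : Template τ} (hΦ : Φ.InUpsilon K) {e : Φ.L →ᴸ Ψ.L}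
    (h : Le K Φ Ψ e) {φ : Φ.L.Sentence} (hφ : φ ∈ Φ.theory K) :
    e.onSentence φ ∈ Ψ.theory K := by
  intro I N _ b hI hb
  obtain ⟨M, _, a, ha⟩ := hΦ.proper I hI
  let _ : Φ.L.Structure N := e.reduct N
  obtain ⟨g, -⟩ := h.elementary I hI M a N b ha hb
  rw [realize_onSentence_reduct]
  exact (g.map_sentence φ).1 (hφ I M a hI ha)

theorem InUpsilonOver.mono {Φ Ψ : Template τ} {L : FirstOrder.Language.{u, u}} {T : L.Theory}
    {j : L →ᴸ Φ.L} (h : Φ.InUpsilonOver K T j) (hΨ : Ψ.InUpsilon K) {e : Φ.L →ᴸ Ψ.L}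
    (he : Le K Φ Ψ e) : Ψ.InUpsilonOver K T (e.comp j) :=
  .of_subset hΨ (he.injective.comp h.injective) fun φ hφ => by
      have := he.theory_mono h.mem (h.le_theory φ hφ)
      unfold LHom.onSentence LHom.onFormula at this ⊢
      rwa [LHom.comp_onBoundedFormula]

end Template

/-! ### The Ramsey property for formulas about entries of the skeleton -/

/-- `(N', a)` reflects the formulas, in the smaller signature `L`, which hold throughout a
quantifier-free type in `(N, b)`. -/
structure Reflects {L L' : FirstOrder.Language.{u, u}} (e : L →ᴸ L') (J : IndexModel τ)
    {N N' : Type u} [L.Structure N] [L'.Structure N'] (b : J → List N) (hb : ∀ t, b t ≠ [])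
    (a : J → List N') (ha : ∀ t, a t ≠ []) : Prop where
  length_eq : ∀ t, (a t).length = (b t).length
  realize : ∀ {ι : Type u} [Finite ι] (s : ι → J) (φ : L.Formula (ι × ℕ)),
    (∀ t : ι → J, SameQf s t → φ.Realize fun x => entry b hb (t x.1, x.2)) →
      (e.onFormula φ).Realize fun x => entry a ha (s x.1, x.2)

theorem Reflects.realize_sentence {L L' : FirstOrder.Language.{u, u}} {e : L →ᴸ L'}
    {J : IndexModel τ} {N N' : Type u} [L.Structure N] [L'.Structure N'] {b : J → List N}
    {hb : ∀ t, b t ≠ []} {a : J → List N'} {ha : ∀ t, a t ≠ []} (h : Reflects e J b hb a ha)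
    {φ : L.Sentence} (hφ : N ⊨ φ) : N' ⊨ e.onSentence φ := by
  have := h.realize (ι := PEmpty) PEmpty.elim (φ.relabel Empty.elim) fun t _ => by
    rw [Formula.realize_relabel]
    exact (iff_of_eq (congrArg _ (Subsingleton.elim _ _))).1 hφ
  rw [realize_onFormula_reduct] at this
  rw [realize_onSentence_reduct]
  let _ := e.reduct N'
  replace this := Formula.realize_relabel.1 this
  exact (iff_of_eq (congrArg (Formula.Realize φ) (Subsingleton.elim _ _))).1 this

/-- The Ramsey property, for sequences of tuples as families of entries: lengths of tuples are
preserved, as they are determined by quantifier-free types. -/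
theorem exists_ramsey_extension {lt : τ.Relations 2} (hK : IsIndexModelClass lt K)
    {J : IndexModel τ} (hJ : IsAlephZeroSaturated K J)
    {L : FirstOrder.Language.{u, u}} {N : Type u} [L.Structure N] (b : J → List N)
    (hlen : ∀ s t : J, J.qfType [s] = J.qfType [t] → (b s).length = (b t).length)
    (hb : ∀ t, b t ≠ []) (hinj : Function.Injective b) :
    ∃ (Ψ : Template τ) (e : L →ᴸ Ψ.L), e.Injective ∧ InUpsilon K Ψ ∧
      ∀ (N' : Type u) [Ψ.L.Structure N'] (a : J → List N'), IsGEM J Ψ N' a →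
        ∃ ha : ∀ t, a t ≠ [], Reflects e J b hb a ha := by
  classical
  obtain ⟨Ψ, e, he, hΨ, H⟩ := hK.ramsey J hJ L N b hlen hb hinj
  refine ⟨Ψ, e, he, hΨ, fun N' _ a hGEM => ?_⟩
  have H' := H N' a hGEM
  have ha := (hΨ.nontrivial J N' a hJ.mem hGEM).1
  have hlen' : ∀ t, (a t).length = (b t).length := fun t => by
    obtain ⟨h, -⟩ := H' [t] (b t).length ⊤ fun l hl => by
      obtain ⟨r, rfl⟩ := List.length_eq_one_iff.1 (length_eq_of_qfType_eq hl)
      exact ⟨by simpa using hlen r t hl, by simp⟩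
    simpa using h
  refine ⟨ha, hlen', fun {ι} _ s φ hφ => ?_⟩
  have := Fintype.ofFinite ι
  let l : List ι := Finset.univ.toList
  have hl : ∀ k, k ∈ l := fun k => by simp [l]
  have hl0 : l ≠ [] ∨ IsEmpty ι := by
    by_cases h : IsEmpty ι
    · exact Or.inr h
    · rw [not_isEmpty_iff] at h
      exact Or.inl (List.ne_nil_of_mem (hl h.some))
  obtain ⟨idx, hidx⟩ := exists_index (fun k => (b (s k)).length)
    (fun k => List.length_pos_of_ne_nil (hb _)) l hl0
  have key := H' (l.map s) _ (φ.relabel idx) fun t ht => by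
    have hlt : t.length = l.length := by simpa using length_eq_of_qfType_eq ht
    let t' : ι → J := fun k => t[l.idxOf k]'(by
      rw [hlt]; exact List.idxOf_lt_length_of_mem (hl k))
    have htt : l.map t' = t := by
      refine List.ext_getElem (by simp [hlt]) fun i h1 h2 => ?_
      have h3 : i < l.length := by rwa [List.length_map] at h1
      have : l.idxOf l[i] = i := (Finset.nodup_toList _).idxOf_getElem i h3
      simp [t', this]
    have hst : SameQf s t' := SameQf.of_list l hl (by rw [htt, ht])
    rw [← htt]
    refine (mem_tp_flatMap_iff hidx b hb t' (fun k => ?_) φ fun x _ => hl _).2 (hφ t' hst)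
    exact hlen _ _ (hst.symm [k])
  have key' : (⟨_, φ.relabel idx⟩ : Σ m : ℕ, L.Formula (Fin m)) ∈
      @tp L N' (e.reduct N') ((l.map s).flatMap a) := by
    simpa only [tp, Set.mem_ofPred_eq, realize_onFormula_reduct] using key
  rw [realize_onFormula_reduct]
  let _ := e.reduct N'
  exact (mem_tp_flatMap_iff hidx a ha s (fun k => hlen' _) φ fun x _ => hl _).1 key'

/-- The Ramsey property relative to a template `Φ`: an expansion of an elementary extension of
`GEM(J, Φ)` is reflected in a template `Ψ ≥ Φ`. -/
theorem exists_le_reflects {lt : τ.Relations 2} (hK : IsIndexModelClass lt K)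
    {J : IndexModel τ} (hJ : IsAlephZeroSaturated K J) {Φ : Template τ} (hΦ : Φ.InUpsilon K)
    {N₀ : Type u} [Φ.L.Structure N₀] {A : J → List N₀} (hA : IsGEM J Φ N₀ A)
    {L : FirstOrder.Language.{u, u}} {e : Φ.L →ᴸ L} (he : e.Injective)
    {N : Type u} [L.Structure N] (h : N₀ → N)
    (hh : ∀ (m : ℕ) (φ : Φ.L.Formula (Fin m)) (x : Fin m → N₀),
      (e.onFormula φ).Realize (h ∘ x) ↔ φ.Realize x) (hne : ∀ t, (A t).map h ≠ []) :
    ∃ (Ψ : Template τ) (i : L →ᴸ Ψ.L), i.Injective ∧ InUpsilon K Ψ ∧ Le K Φ Ψ (i.comp e) ∧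
      ∀ (N' : Type u) [Ψ.L.Structure N'] (a : J → List N'), IsGEM J Ψ N' a →
        ∃ ha : ∀ t, a t ≠ [], Reflects i J (fun t => (A t).map h) hne a ha := by
  have hnt := hΦ.nontrivial J N₀ A hJ.mem hA
  let _ : Φ.L.Structure N := e.reduct N
  let h' : N₀ ↪ₑ[Φ.L] N := ⟨h, fun m (φ : Φ.L.Formula (Fin m)) x =>
    (realize_onFormula_reduct (N := N) e φ (h ∘ x)).symm.trans (hh m φ x)⟩
  obtain ⟨Ψ, i, hi, hΨ, H⟩ := exists_ramsey_extension (L := L) hK hJ (fun t => (A t).map h)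
    (fun s t hst => by
      have := length_eq_of_tp_eq (hΦ.indiscernible J N₀ A hJ.mem hA [s] [t] hst)
      simpa using this) hne
    (fun s t hst => hnt.2 (List.map_injective_iff.2 h'.injective hst))
  refine ⟨Ψ, i, hi, hΨ, ?_, H⟩
  obtain ⟨N', _, a, hGEM⟩ := hΨ.proper J hJ.mem
  obtain ⟨ha, hR⟩ := H N' a hGEM
  refine Le.of_tp_eq hK hΦ hΨ hJ (hi.comp he) hA hGEM fun l => ?_
  let _ : Φ.L.Structure N' := (i.comp e).reduct N'
  have key : ∀ φ : Φ.L.Formula (ULift.{u} (Fin l.length) × ℕ),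
      (φ.Realize fun x => entry A hnt.1 (l.get x.1.down, x.2)) →
        φ.Realize fun x => entry a ha (l.get x.1.down, x.2) := by
    intro φ hφ
    have := hR.realize (fun k : ULift.{u} (Fin l.length) => l.get k.down) (e.onFormula φ) (by
      intro t ht
      rw [realize_onFormula_reduct]
      have h1 : φ.Realize fun x => entry A hnt.1 (t x.1, x.2) := by
        refine (realize_entry_iff_of_tp A hnt.1 A hnt.1
          (fun k : ULift.{u} (Fin l.length) => l.get k.down) t (fun _ => True) (fun _ => trivial)
          (fun l m φ _ => ?_) φ fun _ _ => trivial).1 hφ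
        rw [hΦ.indiscernible J N₀ A hJ.mem hA _ _ (ht l)]
      have h2 := (h'.map_formula φ _).2 h1
      refine (iff_of_eq (congrArg _ (funext fun x => ?_))).1 h2
      exact (entry_map h A hnt.1 hne _).symm)
    rw [realize_onFormula_reduct, realize_onFormula_reduct] at this
    exact this
  have key' : ∀ φ : Φ.L.Formula (ULift.{u} (Fin l.length) × ℕ),
      (φ.Realize fun x => entry A hnt.1 (l.get x.1.down, x.2)) ↔
        φ.Realize fun x => entry a ha (l.get x.1.down, x.2) := fun φ =>
    ⟨key φ, fun h => by_contra fun hc =>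
      Formula.realize_not.1 (key φ.not (Formula.realize_not.2 hc)) h⟩
  have hl : l = ((List.finRange _).map ULift.up).map
      fun k : ULift.{u} (Fin l.length) => l.get k.down := by
    rw [List.map_map]
    exact (List.ofFn_get l).symm.trans (List.ofFn_eq_map ..)
  have h3 : (fun k : ULift.{u} (Fin l.length) => (A (l.get k.down)).length) =
      fun k => (a (l.get k.down)).length := by
    funext k
    rw [hR.length_eq, List.length_map]
  rw [hl, flatMap_eq_varList_map A hnt.1, flatMap_eq_varList_map a ha, h3]
  exact tp_map_eq_of_realize_iff _ _ key' _

end GEM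

/-! ### Adding a theory in a disjoint signature -/

section AddTheory

variable {τ : FirstOrder.Language.{u, u}} {K : IndexModel τ → Prop}

theorem IndexModel.IsEmbedding.mem_cl_of_map {I J : IndexModel τ} {f : I → J}
    (hf : IsEmbedding I J f) {A : Set I} {x : I} (h : f x ∈ J.cl (f '' A)) : x ∈ I.cl A := by
  obtain ⟨x', hx', h'⟩ := h (f '' I.cl A) (Set.image_mono (subset_cl A)) (by
    intro n F ys hys y hy
    choose xs hxs hxy using hys
    obtain rfl : (fun k => f (xs k)) = ys := funext hxy
    rw [hf.map_fn, Part.mem_map_iff] at hy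
    obtain ⟨x, hx, rfl⟩ := hy
    exact ⟨x, fn_mem_cl F xs hxs hx, rfl⟩)
  exact hf.injective h' ▸ hx'

/-- An `ℵ₀`-saturated extension of a context has infinitely many elements of the same
quantifier-free type, so the models over it are infinite. -/
theorem IsCountableContext.infinite_gem {lt : τ.Relations 2} {I : IndexModel τ}
    (hc : IsCountableContext lt K I) {J : IndexModel τ} (hJ : IsAlephZeroSaturated K J)
    {f : I → J} (hf : IsEmbedding I J f) {Φ : Template τ} (hΦ : Φ.InUpsilon K) {N : Type u}
    [Φ.L.Structure N] {a : J → List N} (ha : IsGEM J Φ N a) : Infinite N := by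
  obtain ⟨x, hx⟩ : ∃ x, x ∉ I.cl ∅ := by
    by_contra! h
    exact hc.nontrivial ∅ Set.finite_empty (Set.eq_univ_of_forall h)
  have hfx : f x ∉ J.cl {y | y ∈ ([] : List I).map f} := by
    intro h
    refine hx (hf.mem_cl_of_map ?_)
    simpa using h
  have hinf := hc.non_one_trivial J f hJ hf [] (f x) hfx
  by_contra hN
  rw [not_infinite_iff_finite] at hN
  refine hinf (Set.Finite.of_finite_image ((List.finite_length_eq N (a (f x)).length).subset ?_)
    (hΦ.nontrivial J N a hJ.mem ha).2.injOn)
  rintro _ ⟨r, hr, rfl⟩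
  have := length_eq_of_tp_eq (hΦ.indiscernible J N a hJ.mem ha _ _ hr)
  simpa using this

/-- A theory with infinite models, in a signature disjoint from that of `Φ`, can be added to
`Φ`. -/
theorem IsCountableContext.exists_le_of_theory {lt : τ.Relations 2} {I : IndexModel τ}
    (hc : IsCountableContext lt K I) {Φ : Template τ} (hΦ : Φ.InUpsilon K)
    {L : FirstOrder.Language.{u, u}} (T : L.Theory)
    (hT : ∃ (M : Type u) (_ : L.Structure M), Infinite M ∧ M ⊨ T) :
    ∃ (Ψ : Template τ) (e : Φ.L →ᴸ Ψ.L) (i : L →ᴸ Ψ.L), Le K Φ Ψ e ∧ Ψ.InUpsilonOver K T i ∧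
      DisjointIn e i := by
  have hK := hc.isIndexModelClass
  obtain ⟨J, f, hJ, hf⟩ := hK.saturated_extension I hc.mem
  obtain ⟨N₀, _, A, hA⟩ := hΦ.proper J hJ.mem
  have := hc.infinite_gem hJ hf hΦ hA
  obtain ⟨M, _, _, hM⟩ := hT
  let κ : Cardinal.{u} := max (max Φ.L.card L.card) (max (Cardinal.mk N₀) (Cardinal.mk M))
  have k₁ : Φ.L.card ≤ κ := (le_max_left _ _).trans (le_max_left _ _)
  have k₂ : L.card ≤ κ := (le_max_right _ _).trans (le_max_left _ _)
  have k₃ : Cardinal.mk N₀ ≤ κ := (le_max_left _ _).trans (le_max_right _ _)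
  have k₄ : Cardinal.mk M ≤ κ := (le_max_right _ _).trans (le_max_right _ _)
  obtain ⟨N₁, ⟨g₁⟩, h₁⟩ := exists_elementaryEmbedding_card_eq_of_ge Φ.L N₀ κ
    (by simpa using k₁) (by simpa using k₃)
  obtain ⟨N₂, ⟨g₂⟩, h₂⟩ := exists_elementaryEmbedding_card_eq_of_ge L M κ
    (by simpa using k₂) (by simpa using k₄)
  obtain ⟨ε⟩ := Cardinal.eq.1 (h₂.trans h₁.symm)
  let _ : L.Structure N₁ := ε.inducedStructure
  have hN₁ : N₁ ⊨ T := by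
    have h2 : N₂ ⊨ T := (g₂.theory_model_iff T).1 hM
    exact (StrongHomClass.theory_model (F := N₂ ≃[L] N₁) ε.inducedStructureEquiv)
  have hne : ∀ t, (A t).map g₁ ≠ [] := fun t h =>
    (hΦ.nontrivial J N₀ A hJ.mem hA).1 t (List.map_eq_nil_iff.1 h)
  obtain ⟨Ψ, i, hi, hΨ, hle, H⟩ := exists_le_reflects hK hJ hΦ hA (L := Φ.L.sum L)
    (e := LHom.sumInl) LHom.sumInl_injective (N := N₁) g₁ (fun m φ x => by
      rw [LHom.realize_onFormula]
      exact g₁.map_formula φ x) hne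
  refine ⟨Ψ, i.comp LHom.sumInl, i.comp LHom.sumInr, hle,
    .of_subset hΨ (hi.comp LHom.sumInr_injective) fun φ hφ => ?_, ?_, ?_⟩
  · obtain ⟨N', _, a, hGEM⟩ := hΨ.proper J hJ.mem
    obtain ⟨ha, hR⟩ := H N' a hGEM
    refine mem_theory_of_realize hΨ hJ.mem hGEM ?_
    have h1 : N₁ ⊨ (LHom.sumInr : L →ᴸ Φ.L.sum L).onSentence φ := by
      rw [LHom.realize_onSentence]
      exact hN₁.realize_of_mem φ hφ
    have h2 := hR.realize_sentence h1
    rw [realize_onSentence_reduct, realize_onSentence_reduct] at h2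
    rw [realize_onSentence_reduct]
    exact h2
  · exact fun n F G h => Sum.inl_ne_inr (hi.onFunction h)
  · exact fun n F G h => Sum.inl_ne_inr (hi.onRelation h)

end AddTheory

/-! ### Coding finite functions by elements -/

section Coding

/-- The binary operation `app` can be updated at a single argument; in consequence its sections
`app c` realize all finite partial functions. -/
def HasUpdates {N : Type v} (app : N → N → N) : Prop :=
  ∀ c x y, ∃ c', app c' x = y ∧ ∀ x', x' = x ∨ app c' x' = app c x'

theorem HasUpdates.exists_finset {N : Type v} [Nonempty N] {app : N → N → N} (h : HasUpdates app)
    (k : N → N) (H : Finset N) : ∃ c, ∀ x ∈ H, app c x = k x := by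
  classical
  induction H using Finset.induction_on with
  | empty => exact ⟨Classical.arbitrary N, by simp⟩
  | insert x H hx ih =>
    obtain ⟨c, hc⟩ := ih
    obtain ⟨c', h1, h2⟩ := h c x (k x)
    refine ⟨c', fun x' hx' => ?_⟩
    rcases h2 x' with rfl | h3
    · exact h1
    · rcases Finset.mem_insert.1 hx' with rfl | hx'
      · exact h1
      · rw [h3, hc x' hx']

/-- Finite functions of several variables are coded by currying. -/
theorem HasUpdates.exists_foldl {N : Type v} [Nonempty N] {app : N → N → N} (h : HasUpdates app)
    (n : ℕ) (g : List N → N) (S : Set (List N)) (hS : S.Finite) (hn : ∀ l ∈ S, l.length = n) :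
    ∃ c, ∀ l ∈ S, l.foldl app c = g l := by
  classical
  induction n generalizing g S with
  | zero =>
    refine ⟨g [], fun l hl => ?_⟩
    rw [List.length_eq_zero_iff.1 (hn l hl)]
    rfl
  | succ n ih =>
    have := fun x => ih (fun l => g (x :: l)) {l | x :: l ∈ S}
      (hS.preimage (List.cons_injective.injOn)) (fun l hl => by simpa using hn _ hl)
    choose k hk using this
    obtain ⟨c, hc⟩ := h.exists_finset k (hS.toFinset.image fun l => l.headD (Classical.arbitrary N))
    refine ⟨c, fun l hl => ?_⟩
    cases l with
    | nil => simpa using hn _ hl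
    | cons x l =>
      rw [List.foldl_cons, hc x (Finset.mem_image.2 ⟨x :: l, hS.mem_toFinset.2 hl, rfl⟩)]
      exact hk x l hl

/-- An infinite set has as many finitely supported functions as elements, which thus code them. -/
theorem exists_hasUpdates (N : Type v) [Infinite N] : ∃ app : N → N → N, HasUpdates app := by
  classical
  let _ : Zero N := ⟨Classical.arbitrary N⟩
  have : Cardinal.mk (N →₀ N) = Cardinal.mk N := by
    rw [Cardinal.mk_finsupp_of_infinite, max_self]
  obtain ⟨ε⟩ := Cardinal.eq.1 this
  refine ⟨fun c x => ε.symm c x, fun c x y => ⟨ε ((ε.symm c).update x y), ?_, fun x' => ?_⟩⟩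
  · simp
  · by_cases h : x' = x
    · exact Or.inl h
    · right
      simp [h]

/-- The function symbols of `appLang`. -/
inductive AppFunctions : ℕ → Type u
  | app : AppFunctions 2

/-- The signature of a single binary function. -/
def appLang : FirstOrder.Language.{u, u} := ⟨AppFunctions, fun _ => PEmpty⟩

/-- The operation `app`, as a symbol. -/
def appSymb : appLang.{u}.Functions 2 := AppFunctions.app

/-- The binary operation of a structure named by a function symbol. -/
def appFun {L : FirstOrder.Language.{u, u}} (α : L.Functions 2) (N : Type v) [L.Structure N]
    (c x : N) : N := Structure.funMap α ![c, x]

/-- The axiom saying that `app` has updates. -/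
def appAxiom : appLang.{u}.Sentence :=
  ((((appSymb.apply₂ (&3) (&1)) =' (&2 : appLang.Term (Empty ⊕ Fin 4))) ⊓
    (((&4 : appLang.Term (Empty ⊕ Fin 5)) =' &1) ⊔
      ((appSymb.apply₂ (&3) (&4)) =' (appSymb.apply₂ (&0) (&4)))).all).ex).all.all.all

theorem realize_appAxiom (N : Type v) [appLang.{u}.Structure N] :
    N ⊨ appAxiom.{u} ↔ HasUpdates (appFun appSymb.{u} N) := by
  unfold appAxiom HasUpdates
  simp only [Sentence.Realize, Formula.Realize, BoundedFormula.realize_all,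
    BoundedFormula.realize_ex, BoundedFormula.realize_inf, BoundedFormula.realize_sup,
    BoundedFormula.realize_bdEqual, Term.realize_functions_apply₂]
  rfl

/-- Iterated application of the binary function symbol `α` to a list of arguments. -/
def appTerm {L : FirstOrder.Language.{u, u}} (α : L.Functions 2) {β : Type v} (c : L.Term β)
    (l : List (L.Term β)) : L.Term β := l.foldl (fun s t => α.apply₂ s t) c

theorem realize_appTerm {L : FirstOrder.Language.{u, u}} (α : L.Functions 2) {β : Type v}
    (c : L.Term β) (l : List (L.Term β)) {N : Type w} [L.Structure N] (v : β → N) :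
    (appTerm α c l).realize v = (l.map fun t => t.realize v).foldl (appFun α N) (c.realize v) := by
  unfold appTerm
  induction l generalizing c with
  | nil => rfl
  | cons t l ih =>
    rw [List.foldl_cons, ih, List.map_cons, List.foldl_cons, Term.realize_functions_apply₂]
    rfl

/-- In an elementary extension, arbitrary functions on sets of tuples of a fixed length are coded
by elements. -/
theorem exists_coding {L : FirstOrder.Language.{u, u}} (α : L.Functions 2) {N : Type u}
    [L.Structure N] [Nonempty N] (h : HasUpdates (appFun α N)) {Γ : Type u}
    (D : Γ → Set (List N)) (n : Γ → ℕ) (hD : ∀ γ, ∀ l ∈ D γ, l.length = n γ)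
    (g : Γ → List N → N) :
    ∃ (N' : Type u) (_ : L.Structure N') (_ : Nonempty N') (e : N ↪ₑ[L] N') (c : Γ → N'),
      ∀ γ, ∀ l ∈ D γ, (l.map e).foldl (appFun α N') (c γ) = e (g γ l) := by
  let φ : (Σ γ, D γ) → L.Formula (N ⊕ Γ) := fun x =>
    (appTerm α (Term.var (Sum.inr x.1)) (x.2.1.map fun y => Term.var (Sum.inl y))).equal
      (Term.var (Sum.inl (g x.1 x.2)))
  have hφ : ∀ (x : Σ γ, D γ) (N' : Type u) [L.Structure N'] (e : N → N') (c : Γ → N'),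
      (φ x).Realize (Sum.elim e c) ↔
        (x.2.1.map e).foldl (appFun α N') (c x.1) = e (g x.1 x.2) := by
    intro x N' _ e c
    simp only [φ, Formula.realize_equal, realize_appTerm, Term.realize_var, List.map_map]
    rfl
  obtain ⟨N', _, _, e, c, hc⟩ := exists_elementary_extension (Set.range φ) (by
    intro F hF hfin
    choose x hx using fun ψ : F => hF ψ.2
    have : Finite F := hfin.to_subtype
    have h' := fun γ => h.exists_foldl (n γ) (g γ) {l | ∃ (hl : l ∈ D γ), ⟨γ, l, hl⟩ ∈ Set.range x}
      (by
        refine ((Set.finite_range x).image fun y => y.2.1).subset ?_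
        rintro l ⟨hl, hl'⟩
        exact ⟨_, hl', rfl⟩)
      (fun l hl => hD γ l hl.1)
    choose c hc using h'
    refine ⟨c, fun ψ hψ => ?_⟩
    have := hc (x ⟨ψ, hψ⟩).1 (x ⟨ψ, hψ⟩).2.1 ⟨(x ⟨ψ, hψ⟩).2.2, ⟨ψ, hψ⟩, rfl⟩
    have h2 := (hφ (x ⟨ψ, hψ⟩) N id c).2 (by simpa using this)
    rwa [hx] at h2)
  exact ⟨N', inferInstance, inferInstance, e, c, fun γ l hl =>
    (hφ ⟨γ, l, hl⟩ N' e c).1 (hc _ ⟨_, rfl⟩)⟩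

end Coding

/-! ### Shearing in terms of indexed families -/

section ShearFamilies

variable {τ : FirstOrder.Language.{u, u}} {K : IndexModel τ → Prop} {I : IndexModel τ}

/-- `u : I₁ → J` is a conjugate over `I₀` of the inclusion of `I₁` in `J`, along `f : I → J`. -/
structure IsConjugate {J : IndexModel τ} (f : I → J) {I₀ I₁ : Finset I} (h : I₀ ⊆ I₁)
    (u : I₁ → J) : Prop where
  sameQf : SameQf (Subtype.val : I₁ → I) u
  eq_base : ∀ x : I₀, u ⟨x, h x.2⟩ = f x

theorem IsConjugate.base {J : IndexModel τ} {f : I → J} (hf : IsEmbedding I J f)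
    {I₀ I₁ : Finset I} (h : I₀ ⊆ I₁) : IsConjugate f h (fun x => f x.1) :=
  ⟨SameQf.of_embedding hf _, fun _ => rfl⟩

/-- The formula `ψ(x̄, c̄)` shears over `B` for `(I₀, I₁)`: the definition restated with families
indexed by `I₁` instead of enumerations. -/
structure ShearData (K : IndexModel τ → Prop) {L : FirstOrder.Language.{u, u}} {M : Type u}
    [L.Structure M] (B : Set M) {I₀ I₁ : Finset I} (h : I₀ ⊆ I₁) {k r : ℕ}
    (ψ : L.Formula (Fin k ⊕ Fin r)) (c : Fin r → M) where
  N : Type u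
  [str : L.Structure N]
  ι : M ↪ₑ[L] N
  J : IndexModel τ
  f : I → J
  b : (I₁ → J) → Fin r → N
  saturated : IsAlephZeroSaturated K J
  embedding : IsEmbedding I J f
  base : b (fun x => f x.1) = ι ∘ c
  indiscernible : ∀ {κ : Type u} [Finite κ] (w w' : κ → I₁ → J), (∀ j, IsConjugate f h (w j)) →
    (∀ j, IsConjugate f h (w' j)) →
    SameQf (fun x : κ × I₁ => w x.1 x.2) (fun x : κ × I₁ => w' x.1 x.2) →
    ∀ χ : L.Formula (B ⊕ (κ × Fin r)), χ.Realize (Sum.elim (fun x => ι x) fun y => b (w y.1) y.2) →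
      χ.Realize (Sum.elim (fun x => ι x) fun y => b (w' y.1) y.2)
  inconsistent : ∃ (κ : Type u) (_ : Finite κ) (w : κ → I₁ → J), (∀ j, IsConjugate f h (w j)) ∧
    ¬ ∃ x : Fin k → N, ∀ j, ψ.Realize (Sum.elim x (b (w j)))

attribute [instance] ShearData.str

/-- An enumeration of a finite set, as an enumeration of the subtype. -/
theorem Enumerates.exists_list {X : Type u} {s : List X} {A : Finset X} (h : Enumerates s A) :
    ∃ l : List A, l.map Subtype.val = s ∧ l.Nodup ∧ ∀ x, x ∈ l := by
  have h' : ∀ x ∈ s, x ∈ A := fun x => (h.2 x).1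
  refine ⟨s.pmap Subtype.mk h', ?_, ?_, ?_⟩
  · rw [List.map_pmap]
    simp
  · exact h.1.pmap fun a _ b _ hab => congrArg Subtype.val hab
  · rintro ⟨x, hx⟩
    rw [List.mem_pmap]
    exact ⟨x, (h.2 x).2 hx, rfl⟩

theorem exists_map_eq_of_length_eq {X : Type v} {Y : Type w} {l : List X} (hl : l.Nodup)
    (hmem : ∀ x, x ∈ l) {t : List Y} (ht : t.length = l.length) : ∃ u : X → Y, l.map u = t := by
  classical
  refine ⟨fun x => t[l.idxOf x]'(by rw [ht]; exact List.idxOf_lt_length_of_mem (hmem x)), ?_⟩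
  refine List.ext_getElem (by simp [ht]) fun i h1 h2 => ?_
  have h3 : i < l.length := by rwa [List.length_map] at h1
  have : l.idxOf l[i] = i := hl.idxOf_getElem i h3
  simp [this]

theorem Shears.nonempty_shearData {L : FirstOrder.Language.{u, u}} {M : Type u} [L.Structure M]
    {B : Set M} {k : ℕ} {ψ : ParamFormula L M k} {I₀ I₁ : Finset I}
    (hS : Shears K I B ψ I₀ I₁) :
    ∃ h : I₀ ⊆ I₁, Nonempty (ShearData K B h ψ.formula ψ.params) := by
  classical
  obtain ⟨h, N, _, ι, J, f, s₀, t, b, hJ, hf, hs₀, ht, hind, hbase, hinc⟩ := hS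
  refine ⟨h, ?_⟩
  obtain ⟨l₀, rfl, hl₀, hl₀'⟩ := hs₀.exists_list
  obtain ⟨l, rfl, hl, hl'⟩ := ht.exists_list
  have hl₁ : (l.map Subtype.val).map f = l.map fun x : I₁ => f x.1 := by rw [List.map_map]; rfl
  have hl₂ : (l₀.map Subtype.val).map f = l₀.map fun x : I₀ => f x.1 := by rw [List.map_map]; rfl
  rw [hl₂] at hind hinc
  rw [hl₁] at hbase
  -- the quantifier-free type over `I₀` determines conjugacy, as `I₀` is contained in `I₁`
  have hconj : ∀ u : I₁ → J, IsConjugate f h u ↔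
      J.qfType (l₀.map (fun x : I₀ => f x.1) ++ l.map u) =
        I.qfType (l₀.map Subtype.val ++ l.map Subtype.val) := by
    intro u
    have h1 : J.qfType (l₀.map (fun x : I₀ => f x.1) ++ l.map u) =
        I.qfType (l₀.map Subtype.val ++ l.map Subtype.val) ↔
        SameQf (Sum.elim (fun x : I₀ => x.1) (fun x : I₁ => x.1))
          (Sum.elim (fun x : I₀ => f x.1) u) := by
      have h2 : ∀ {H : IndexModel τ} (v : I₀ → H) (v' : I₁ → H),
          l₀.map v ++ l.map v' = (l₀.map Sum.inl ++ l.map Sum.inr).map (Sum.elim v v') := by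
        intro H v v'
        simp [Function.comp_def]
      rw [h2, h2]
      constructor
      · intro h3
        refine SameQf.of_list _ ?_ h3.symm
        rintro (x | x) <;> simp [hl', hl₀']
      · exact fun h3 => (h3 _).symm
    rw [h1]
    constructor
    · intro hu
      have := (hu.sameQf.comp (Sum.elim (fun x : I₀ => (⟨x.1, h x.2⟩ : I₁)) id))
      convert this using 1
      · funext x
        rcases x with x | x <;> rfl
      · funext x
        rcases x with x | x
        · exact (hu.eq_base x).symm
        · rfl
    · intro hu
      refine ⟨hu.comp Sum.inr, fun x => ?_⟩
      exact ((hu.eq_iff (Sum.inr ⟨x.1, h x.2⟩) (Sum.inl x)).1 rfl)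
  have hcbase := (hconj _).1 (IsConjugate.base hf h)
  -- the tuple attached to a conjugate has the right length
  have hblen : ∀ u : I₁ → J, IsConjugate f h u → (b (l.map u)).length = ψ.arity := by
    intro u hu
    have h1 := hind [l.map u] [l.map fun x : I₁ => f x.1] (by simp) (by
      rw [List.flatten_singleton, List.flatten_singleton, (hconj u).1 hu, hcbase])
    have h2 : (⟨ψ.arity, ⊤⟩ : Σ m : ℕ, L.Formula ((ι '' B : Set N) ⊕ Fin m)) ∈
        tpOver L (ι '' B) ([l.map fun x : I₁ => f x.1].flatMap b) :=
      ⟨by rw [List.flatMap_singleton, ← hbase]; simp, by simp⟩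
    rw [← h1] at h2
    obtain ⟨h3, -⟩ := h2
    simpa using h3
  let b' : (I₁ → J) → Fin ψ.arity → N := fun u i =>
    (b (l.map u)).getD i (ι (ψ.params i))
  have hb' : ∀ u : I₁ → J, IsConjugate f h u → List.ofFn (b' u) = b (l.map u) := by
    intro u hu
    refine List.ext_getElem (by simp [hblen u hu]) fun i h1 h2 => ?_
    simp [b', h2]
  refine ⟨⟨N, ι, J, f, b', hJ, hf, ?_, ?_, ?_⟩⟩
  · refine List.ofFn_injective ?_
    rw [hb' _ (IsConjugate.base hf h), ← hbase, List.map_ofFn]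
  · intro κ _ w w' hw hw' hww χ hχ
    have := Fintype.ofFinite κ
    let lk : List κ := Finset.univ.toList
    have hlk : ∀ j, j ∈ lk := fun j => by simp [lk]
    have hflat : ∀ w : κ → I₁ → J, (lk.map fun j => l.map (w j)).flatten =
        (lk.flatMap fun j => l.map fun x => (j, x)).map fun x : κ × I₁ => w x.1 x.2 := by
      intro w
      rw [List.map_flatMap, List.flatMap_def]
      simp [Function.comp_def]
    have h1 := hind (lk.map fun j => l.map (w j)) (lk.map fun j => l.map (w' j))
      (by simp [Function.comp_def]) (by
        rw [hflat, hflat]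
        by_cases hκ : Nonempty κ
        · obtain ⟨j₀⟩ := hκ
          have h2 : ∀ w : κ → I₁ → J, (∀ j, IsConjugate f h (w j)) →
              l₀.map (fun x : I₀ => f x.1) ++
                (lk.flatMap fun j => l.map fun x => (j, x)).map (fun x : κ × I₁ => w x.1 x.2) =
              (l₀.map (fun x : I₀ => (j₀, (⟨x.1, h x.2⟩ : I₁))) ++
                (lk.flatMap fun j => l.map fun x => (j, x))).map
                  (fun x : κ × I₁ => w x.1 x.2) := by
            intro w hw
            rw [List.map_append, List.map_map]
            congr 1
            exact List.map_congr_left fun x _ => ((hw j₀).eq_base x).symm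
          rw [h2 w hw, h2 w' hw']
          exact hww _
        · have : lk = [] := List.eq_nil_iff_forall_not_mem.2 fun j _ => hκ ⟨j⟩
          rw [this]
          rfl)
    let vl : List (κ × Fin ψ.arity) := lk.flatMap fun j => (List.finRange _).map fun i => (j, i)
    have hvl : ∀ y, y ∈ vl := fun y => by simp [vl, hlk]
    have hfl : ∀ w : κ → I₁ → J, (∀ j, IsConjugate f h (w j)) →
        (lk.map fun j => l.map (w j)).flatMap b = vl.map fun y => b' (w y.1) y.2 := by
      intro w hw
      rw [List.map_flatMap, List.flatMap_map]
      congr 1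
      funext j
      rw [← hb' _ (hw j), List.map_map, List.ofFn_eq_map]
      rfl
    rw [hfl w hw, hfl w' hw'] at h1
    let χ' : L.Formula ((ι '' B : Set N) ⊕ Fin vl.length) :=
      χ.relabel (Sum.map (fun x : B => ⟨ι x, x, x.2, rfl⟩)
        fun y => ⟨vl.idxOf y, List.idxOf_lt_length_of_mem (hvl y)⟩)
    have hχ' : ∀ v : κ × Fin ψ.arity → N,
        (⟨_, χ'⟩ : Σ m : ℕ, L.Formula ((ι '' B : Set N) ⊕ Fin m)) ∈
          tpOver L (ι '' B) (vl.map v) ↔ χ.Realize (Sum.elim (fun x => ι x) v) := by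
      intro v
      have h3 : ∀ hm : (vl.map v).length = vl.length,
          (Sum.elim Subtype.val (tuple (vl.map v) hm)) ∘
            (Sum.map (fun x : B => (⟨ι x, x, x.2, rfl⟩ : (ι '' B : Set N)))
            fun y => (⟨vl.idxOf y, List.idxOf_lt_length_of_mem (hvl y)⟩ : Fin vl.length)) =
          Sum.elim (fun x : B => ι x) v := by
        intro hm
        funext y
        rcases y with x | y
        · rfl
        · simp [tuple]
      simp only [tpOver, Set.mem_ofPred_eq, χ', Formula.realize_relabel, h3]
      simp
    rw [← hχ', ← h1, hχ']
    exact hχ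
  · unfold FinSat at hinc
    push Not at hinc
    obtain ⟨F, hF, hfin, hno⟩ := hinc
    choose t' c' ht' hc' hχ using fun χ : F => hF χ.2
    have := hfin.to_subtype
    have hu : ∀ χ : F, ∃ u : I₁ → J, l.map u = t' χ := fun χ =>
      exists_map_eq_of_length_eq hl hl' (by
        have := length_eq_of_qfType_eq (ht' χ)
        simpa using this)
    choose u hu using hu
    have huc : ∀ χ, IsConjugate f h (u χ) := fun χ => (hconj _).2 (by rw [hu, ht'])
    refine ⟨F, inferInstance, u, huc, ?_⟩
    rintro ⟨x, hx⟩
    obtain ⟨χ, hχF, hχx⟩ := hno x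
    refine hχx ?_
    have h1 := hx ⟨χ, hχF⟩
    have h2 : b' (u ⟨χ, hχF⟩) = c' ⟨χ, hχF⟩ := by
      refine List.ofFn_injective ?_
      rw [hb' _ (huc _), hu, hc']
    rw [h2] at h1
    have h3 := hχ ⟨χ, hχF⟩
    dsimp only at h3
    rw [h3]
    exact h1

end ShearFamilies

/-! ### Trees of parameters witnessing unsuperstability -/

/-- The witnesses of unsuperstability: formulas `ψₙ(x̄, c̄ₙ)`, jointly consistent, such that `ψₙ`
shears over `Bₙ ∋ c̄₀, …, c̄ₙ₋₁` for `(Iₙ, Iₙ₊₁)`. -/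
structure UnsuperstableData {τ : FirstOrder.Language.{u, u}} (K : IndexModel τ → Prop)
    (I : IndexModel τ) {L : FirstOrder.Language.{u, u}} (T : L.Theory) where
  M : Type u
  [str : L.Structure M]
  [nonempty : Nonempty M]
  models : M ⊨ T
  k : ℕ
  In : ℕ → Finset I
  mono : Monotone In
  cover : ∀ x : I, ∃ n, x ∈ In n
  B : ℕ → Set M
  B_mono : Monotone B
  r : ℕ → ℕ
  ψ : ∀ n, L.Formula (Fin k ⊕ Fin (r n))
  c : ∀ n, Fin (r n) → M
  c_mem : ∀ n i, c n i ∈ B (n + 1)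
  consistent : ∀ n, ∃ x : Fin k → M, ∀ i < n, (ψ i).Realize (Sum.elim x (c i))
  data : ∀ n, ShearData K (B n) (mono n.le_succ) (ψ n) (c n)

attribute [instance] UnsuperstableData.str UnsuperstableData.nonempty

theorem IsUnsuperstable.nonempty_data {τ : FirstOrder.Language.{u, u}} {K : IndexModel τ → Prop}
    {I : IndexModel τ} {L : FirstOrder.Language.{u, u}} {T : L.Theory}
    (h : IsUnsuperstable K I T) : Nonempty (UnsuperstableData K I T) := by
  obtain ⟨M, _, _, k, In, s, B, p, hM, hmono, -, hcov, -, hB, -, hfin, -, H⟩ := h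
  choose ψ hψ hpar hsh using H
  have hsh' := fun n => (hsh n).nonempty_shearData
  choose h1 h2 using hsh'
  exact ⟨{
    M := M
    models := hM
    k := k
    In := In
    mono := hmono
    cover := hcov
    B := B
    B_mono := hB
    r := fun n => (ψ n).arity
    ψ := fun n => (ψ n).formula
    c := fun n => (ψ n).params
    c_mem := hpar
    consistent := fun n => by
      obtain ⟨x, hx⟩ := hfin (ψ '' {i | i < n}) (by rintro _ ⟨i, -, rfl⟩; exact hψ i)
        ((Set.finite_lt_nat n).image ψ)
      exact ⟨x, fun i hi => hx _ ⟨i, hi, rfl⟩⟩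
    data := fun n => (h2 n).some }⟩

namespace UnsuperstableData

variable {τ : FirstOrder.Language.{u, u}} {K : IndexModel τ → Prop} {I : IndexModel τ}
  {L : FirstOrder.Language.{u, u}} {T : L.Theory} (D : UnsuperstableData K I T)

/-- A theory with witnesses of unsuperstability has infinite models: in a finite model the sets
`Bₙ` are eventually constant, and a formula over `Bₙ` does not shear over `Bₙ`. -/
theorem infinite : Infinite D.M := by
  by_contra hfin
  rw [not_infinite_iff_finite] at hfin
  obtain ⟨n, hn⟩ : ∃ n, D.B (n + 1) ⊆ D.B n := by
    by_contra! h
    have hss : StrictMono D.B := strictMono_nat_of_lt_succ fun n =>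
      ⟨D.B_mono n.le_succ, h n⟩
    exact not_injective_infinite_finite D.B hss.injective
  obtain ⟨κ, _, w, hw, hno⟩ := (D.data n).inconsistent
  refine hno ?_
  obtain ⟨x, hx⟩ := D.consistent (n + 1)
  refine ⟨(D.data n).ι ∘ x, fun j => ?_⟩
  have hb : (D.data n).b (w j) = (D.data n).ι ∘ D.c n := by
    funext i
    have := (D.data n).indiscernible (κ := PUnit) (fun _ x => (D.data n).f x.1) (fun _ => w j)
      (fun _ => IsConjugate.base (D.data n).embedding _) (fun _ => hw j)
      (((SameQf.of_embedding (D.data n).embedding _).symm.trans (hw j).sameQf).comp Prod.snd)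
      ((Term.var (Sum.inl ⟨D.c n i, hn (D.c_mem n i)⟩)).equal
        (Term.var (Sum.inr (PUnit.unit, i))))
    simp only [Formula.realize_equal, Term.realize_var, Sum.elim_inl, Sum.elim_inr,
      (D.data n).base] at this
    exact (this rfl).symm
  rw [hb, ← Sum.comp_elim]
  exact ((D.data n).ι.map_formula _ _).2 (hx n n.lt_succ_self)

variable (J : IndexModel τ)

/-- The restriction of a family indexed by `Iₙ₊₁` to `Iₙ`. -/
def restrict {n : ℕ} (u : D.In (n + 1) → J) (y : D.In n) : J := u ⟨y, D.mono n.le_succ y.2⟩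

/-- The extensions of `u : Iₙ → J` to families on `Iₙ₊₁` of the right type. -/
def Ext {n : ℕ} (u : D.In n → J) : Type u :=
  {u' : D.In (n + 1) → J // SameQf (Subtype.val : D.In (n + 1) → I) u' ∧ D.restrict J u' = u}

/-- The parameters attached to the restrictions of `u : Iₙ → J` to `Iᵢ₊₁`, `i < n`. -/
def below {N : Type v} (d : ∀ i, (D.In (i + 1) → J) → Fin (D.r i) → N) {n : ℕ} (u : D.In n → J)
    (x : Σ i : Fin n, Fin (D.r i)) : N :=
  d x.1 (fun y => u ⟨y, D.mono x.1.2 y.2⟩) x.2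

/-- The formulas which the parameters attached to the extensions of `u : Iₙ → J` should satisfy:
those satisfied by the parameters in the witness of shearing, whenever a sufficiently large finite
part of `J` is embedded in its index model, over `Iₙ`. -/
def treeType {n : ℕ} (u : D.In n → J) :
    Set (L.Formula ((Σ i : Fin n, Fin (D.r i)) ⊕ (D.Ext J u × Fin (D.r n)))) :=
  {χ | ∃ E : Set J, E.Finite ∧ ∀ h : J → (D.data n).J,
    SameQf (Subtype.val : E → J) (fun x : E => h x) → (∀ x : D.In n, h (u x) = (D.data n).f x) →
    χ.Realize (Sum.elim (fun x => (D.data n).ι (D.c x.1 x.2))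
      fun y => (D.data n).b (fun x => h (y.1.1 x)) y.2)}

variable {J}

theorem conj_mem_treeType {n : ℕ} {u : D.In n → J}
    {F : Set (L.Formula ((Σ i : Fin n, Fin (D.r i)) ⊕ (D.Ext J u × Fin (D.r n))))}
    (hF : F.Finite) (h : F ⊆ D.treeType J u) : conj F hF ∈ D.treeType J u := by
  choose E hE hE' using fun χ : F => h χ.2
  have := hF.to_subtype
  refine ⟨⋃ χ, E χ, Set.finite_iUnion hE, fun g hg hgu => ?_⟩
  rw [realize_conj]
  intro χ hχ
  exact hE' ⟨χ, hχ⟩ g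
    (hg.comp fun x : E ⟨χ, hχ⟩ => (⟨x.1, Set.mem_iUnion.2 ⟨_, x.2⟩⟩ : ⋃ χ, E χ)) hgu

theorem exists_local_embedding {lt : τ.Relations 2} (hK : IsIndexModelClass lt K) (hJ : K J)
    {n : ℕ} {u : D.In n → J} (hu : SameQf (Subtype.val : D.In n → I) u) {E : Set J}
    (hE : E.Finite) : ∃ h : J → (D.data n).J,
      SameQf (Subtype.val : E → J) (fun x : E => h x) ∧
        ∀ x : D.In n, h (u x) = (D.data n).f x := by
  classical
  let E' : Set J := E ∪ Set.range u
  have : Finite E' := hE.union (Set.finite_range u)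
  have h0 : SameQf u (fun x : D.In n => (D.data n).f x) :=
    hu.symm.trans (SameQf.of_embedding (D.data n).embedding _)
  obtain ⟨t, ht⟩ := exists_sameQf_extend hK hJ (D.data n).saturated h0 (Subtype.val : E' → J)
  obtain ⟨z⟩ := (D.data n).J.nonempty
  refine ⟨fun x => if hx : x ∈ E' then t ⟨x, hx⟩ else z, ?_, fun x => ?_⟩
  · have := ht.comp fun x : E => (Sum.inr ⟨x.1, Or.inl x.2⟩ : D.In n ⊕ E')
    convert this using 1
    all_goals
      funext x
      have hx : x.1 ∈ E' := Or.inl x.2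
      simp [hx]
  · have hx : u x ∈ E' := Or.inr ⟨x, rfl⟩
    have := (ht.eq_iff (Sum.inr ⟨u x, hx⟩) (Sum.inl x)).1 rfl
    simpa [hx] using this

theorem isConjugate_local {n : ℕ} {u : D.In n → J} (e : D.Ext J u) {h : J → (D.data n).J}
    (hs : SameQf e.1 (fun x => h (e.1 x))) (hu : ∀ x : D.In n, h (u x) = (D.data n).f x) :
    IsConjugate (D.data n).f (D.mono n.le_succ) (fun x => h (e.1 x)) :=
  ⟨e.2.1.trans hs, fun x => (congrArg h (congrFun e.2.2 x)).trans (hu x)⟩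

/-- The variables for the parameters of levels `≤ n`, split into those of levels `< n` and those
of level `n`. -/
def splitLast (r : ℕ → ℕ) (n : ℕ) (y : Σ i : Fin (n + 1), Fin (r i)) :
    (Σ i : Fin n, Fin (r i)) ⊕ Fin (r n) :=
  Fin.lastCases (motive := fun i : Fin (n + 1) => Fin (r i) → (Σ i : Fin n, Fin (r i)) ⊕ Fin (r n))
    (fun j => Sum.inr j) (fun i j => Sum.inl ⟨i, j⟩) y.1 y.2

theorem sumElim_splitLast {r : ℕ → ℕ} {n : ℕ} {N : Type v} (v : (Σ i : Fin (n + 1), Fin (r i)) → N)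
    (v₁ : (Σ i : Fin n, Fin (r i)) → N) (v₂ : Fin (r n) → N)
    (h₁ : ∀ (i : Fin n) (j : Fin (r i)), v₁ ⟨i, j⟩ = v ⟨i.castSucc, j⟩)
    (h₂ : ∀ j : Fin (r n), v₂ j = v ⟨Fin.last n, j⟩) :
    Sum.elim v₁ v₂ ∘ splitLast r n = v := by
  funext ⟨i, j⟩
  induction i using Fin.lastCases with
  | last => simp [splitLast, h₂]
  | cast i => simp [splitLast, h₁]

/-- A formula about the parameters of levels `≤ n` below `u' : Iₙ₊₁ → J`, as a formula about the
extensions of the restriction of `u'`. -/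
def liftFormula {n : ℕ} {u : D.In n → J} (e : D.Ext J u)
    (θ : L.Formula (Σ i : Fin (n + 1), Fin (D.r i))) :
    L.Formula ((Σ i : Fin n, Fin (D.r i)) ⊕ (D.Ext J u × Fin (D.r n))) :=
  θ.relabel (Sum.map id (fun j => (e, j)) ∘ splitLast D.r n)

theorem realize_liftFormula {n : ℕ} {u : D.In n → J} (e : D.Ext J u)
    (θ : L.Formula (Σ i : Fin (n + 1), Fin (D.r i))) {N : Type v} [L.Structure N]
    (d : ∀ i, (D.In (i + 1) → J) → Fin (D.r i) → N) :
    (D.liftFormula e θ).Realize (Sum.elim (D.below J d u) fun y => d n y.1.1 y.2) ↔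
      θ.Realize (D.below J d e.1) := by
  unfold liftFormula
  rw [Formula.realize_relabel, ← Function.comp_assoc, Sum.elim_comp_map, Function.comp_id,
    sumElim_splitLast (D.below J d e.1)]
  · intro i j
    obtain ⟨u', h1, rfl⟩ := e
    rfl
  · intro j
    rfl

theorem liftFormula_mem_treeType {n : ℕ} {u : D.In n → J} (e : D.Ext J u)
    (θ : L.Formula (Σ i : Fin (n + 1), Fin (D.r i)))
    (hθ : θ.Realize fun x => D.c x.1 x.2) : D.liftFormula e θ ∈ D.treeType J u := by
  refine ⟨Set.range e.1, Set.finite_range _, fun h hs hu => ?_⟩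
  have hs' : SameQf e.1 (fun x => h (e.1 x)) := hs.comp (Set.rangeFactorization e.1)
  have hB : ∀ (i : Fin n) (j), D.c i j ∈ D.B n := fun i j => D.B_mono i.2 (D.c_mem i j)
  have key := (D.data n).indiscernible (κ := PUnit) (fun _ x => (D.data n).f x.1)
    (fun _ x => h (e.1 x)) (fun _ => IsConjugate.base (D.data n).embedding _)
    (fun _ => D.isConjugate_local e hs' hu)
    (((SameQf.of_embedding (D.data n).embedding _).symm.trans
      (D.isConjugate_local e hs' hu).sameQf).comp Prod.snd)
    (θ.relabel (Sum.map (fun x => ⟨D.c x.1 x.2, hB x.1 x.2⟩) (fun j => (PUnit.unit, j)) ∘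
      splitLast D.r n)) ?_
  · rw [Formula.realize_relabel, ← Function.comp_assoc, Sum.elim_comp_map] at key
    unfold liftFormula
    rw [Formula.realize_relabel, ← Function.comp_assoc, Sum.elim_comp_map]
    exact key
  · rw [Formula.realize_relabel, ← Function.comp_assoc, Sum.elim_comp_map, sumElim_splitLast
      ((D.data n).ι ∘ fun x : (Σ i : Fin (n + 1), Fin (D.r i)) => D.c x.1 x.2)]
    · exact ((D.data n).ι.map_formula _ _).2 hθ
    · intro i j
      rfl
    · intro j
      exact congrFun (D.data n).base j

theorem realize_of_mem_treeType {lt : τ.Relations 2} (hK : IsIndexModelClass lt K) (hJ : K J)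
    {n : ℕ} {u : D.In n → J} (hu : SameQf (Subtype.val : D.In n → I) u)
    {χ : L.Formula ((Σ i : Fin n, Fin (D.r i)) ⊕ (D.Ext J u × Fin (D.r n)))}
    (hχ : χ ∈ D.treeType J u) {θ : L.Formula (Σ i : Fin n, Fin (D.r i))}
    (hθ : ∀ (N : Type u) [L.Structure N] [Nonempty N] (v : (Σ i : Fin n, Fin (D.r i)) → N),
      θ.Realize v ↔ ∃ y : D.Ext J u × Fin (D.r n) → N, χ.Realize (Sum.elim v y)) :
    θ.Realize fun x => D.c x.1 x.2 := by
  obtain ⟨E, hE, h⟩ := hχ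
  obtain ⟨g, hg, hgu⟩ := D.exists_local_embedding hK hJ hu hE
  have : Nonempty (D.data n).N := D.nonempty.map (D.data n).ι
  exact ((D.data n).ι.map_formula θ _).1 ((hθ _ _).2 ⟨_, h g hg hgu⟩)

/-- Any finite part of the requirements on the tree of parameters is satisfied in every model of
`T`, by induction on the number of levels involved. -/
theorem exists_tree_of_finite {lt : τ.Relations 2} (hK : IsIndexModelClass lt K) (hJ : K J)
    (hT : T.IsComplete) {N : Type u} [L.Structure N] [Nonempty N] (hN : N ⊨ T) (n : ℕ)
    (Δ : Set (Σ (n : ℕ) (u : D.In n → J),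
      L.Formula ((Σ i : Fin n, Fin (D.r i)) ⊕ (D.Ext J u × Fin (D.r n)))))
    (Θ : Set (Σ _ : D.In n → J, L.Formula (Σ i : Fin n, Fin (D.r i)))) (hΔ : Δ.Finite)
    (hΘ : Θ.Finite) (hΔ' : ∀ x ∈ Δ, x.1 < n ∧ SameQf (Subtype.val : D.In x.1 → I) x.2.1 ∧
      x.2.2 ∈ D.treeType J x.2.1)
    (hΘ' : ∀ x ∈ Θ, SameQf (Subtype.val : D.In n → I) x.1 ∧ x.2.Realize fun y => D.c y.1 y.2) :
    ∃ d : ∀ i, (D.In (i + 1) → J) → Fin (D.r i) → N,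
      (∀ x ∈ Δ, x.2.2.Realize (Sum.elim (D.below J d x.2.1) fun y => d x.1 y.1.1 y.2)) ∧
      ∀ x ∈ Θ, x.2.Realize (D.below J d x.1) := by
  classical
  induction n generalizing Δ with
  | zero =>
    refine ⟨fun _ _ _ => Classical.arbitrary N, fun x hx => absurd (hΔ' x hx).1 (by omega),
      fun x hx => ?_⟩
    have h1 := (hΘ' x hx).2
    have hM := D.models
    let θ : L.Sentence := x.2.relabel fun y => y.1.elim0
    have hθ : ∀ (P : Type u) [L.Structure P] (v : (Σ i : Fin 0, Fin (D.r i)) → P),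
        P ⊨ θ ↔ x.2.Realize v := by
      intro P _ v
      refine Formula.realize_relabel.trans (iff_of_eq (congrArg _ (funext fun y => y.1.elim0)))
    rw [← hθ] at h1 ⊢
    rcases hT.2 θ with h | h
    · exact h.realize_sentence N
    · exact absurd h1 ((Sentence.realize_not _).1 (h.realize_sentence D.M))
  | succ n ih =>
    let F : ∀ u : D.In n → J,
        Set (L.Formula ((Σ i : Fin n, Fin (D.r i)) ⊕ (D.Ext J u × Fin (D.r n)))) := fun u =>
      {χ | (⟨n, u, χ⟩ : Σ (n : ℕ) (u : D.In n → J), L.Formula ((Σ i : Fin n, Fin (D.r i)) ⊕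
        (D.Ext J u × Fin (D.r n)))) ∈ Δ} ∪
      {χ | ∃ x ∈ Θ, ∃ e : D.Ext J u, e.1 = x.1 ∧ χ = D.liftFormula e x.2}
    have hF : ∀ u, (F u).Finite := by
      intro u
      refine Set.Finite.union (hΔ.preimage ?_) ?_
      · intro χ _ χ' _ h
        simpa using h
      · refine (Set.Finite.biUnion hΘ (t := fun x =>
          {χ | ∃ e : D.Ext J u, e.1 = x.1 ∧ χ = D.liftFormula e x.2}) fun x _ =>
            Set.Subsingleton.finite ?_).subset ?_
        · rintro _ ⟨e, he, rfl⟩ _ ⟨e', he', rfl⟩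
          rw [Subtype.ext (he.trans he'.symm)]
        · rintro χ ⟨x, hx, h⟩
          exact Set.mem_biUnion hx h
    have hFT : ∀ u, F u ⊆ D.treeType J u := by
      rintro u χ (h | ⟨x, hx, e, he, rfl⟩)
      · exact (hΔ' _ h).2.2
      · exact D.liftFormula_mem_treeType e x.2 (hΘ' x hx).2
    choose θ hθ using fun u => exists_formula_ex (conj (F u) (hF u))
    let U : Set (D.In n → J) := {u | ∃ x ∈ Δ, ∃ h : x.1 = n, h ▸ x.2.1 = u} ∪
      (fun x : (Σ _ : D.In (n + 1) → J, L.Formula (Σ i : Fin (n + 1), Fin (D.r i))) =>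
        D.restrict J x.1) '' Θ
    have hU : U.Finite := by
      refine Set.Finite.union ?_ (hΘ.image _)
      refine (Set.Finite.biUnion hΔ (t := fun x => {u | ∃ h : x.1 = n, h ▸ x.2.1 = u}) fun x _ =>
        Set.Subsingleton.finite ?_).subset ?_
      · rintro _ ⟨h, rfl⟩ _ ⟨h', rfl⟩
        rfl
      · rintro u ⟨x, hx, h⟩
        exact Set.mem_biUnion hx h
    have hUs : ∀ u ∈ U, SameQf (Subtype.val : D.In n → I) u := by
      rintro u (⟨⟨m, u', χ⟩, hx, h, rfl⟩ | ⟨x, hx, rfl⟩)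
      · obtain rfl : m = n := h
        exact (hΔ' _ hx).2.1
      · exact (hΘ' x hx).1.comp fun y : D.In n => (⟨y, D.mono n.le_succ y.2⟩ : D.In (n + 1))
    obtain ⟨d, hd₁, hd₂⟩ := ih {x ∈ Δ | x.1 < n} ((fun u => ⟨u, θ u⟩) '' U)
      (hΔ.subset fun x hx => hx.1) (hU.image _)
      (fun x hx => ⟨hx.2, (hΔ' x hx.1).2⟩) (by
        rintro _ ⟨u, hu, rfl⟩
        exact ⟨hUs u hu, D.realize_of_mem_treeType hK hJ (hUs u hu)
          (D.conj_mem_treeType (hF u) (hFT u)) (hθ u)⟩)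
    have hy : ∀ u ∈ U, ∃ y : D.Ext J u × Fin (D.r n) → N,
        (conj (F u) (hF u)).Realize (Sum.elim (D.below J d u) y) := fun u hu =>
      (hθ u N _).1 (hd₂ _ ⟨u, hu, rfl⟩)
    choose y hy using hy
    let d' := Function.update d n fun u' j =>
      if h : SameQf (Subtype.val : D.In (n + 1) → I) u' ∧ D.restrict J u' ∈ U then
        y (D.restrict J u') h.2 (⟨u', h.1, rfl⟩, j) else d n u' j
    have hd'lt : ∀ i, i ≠ n → d' i = d i := fun i hi => Function.update_of_ne hi _ _
    have hbelow : ∀ m ≤ n, ∀ u : D.In m → J, D.below J d' u = D.below J d u := by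
      intro m hm u
      funext x
      unfold below
      rw [hd'lt _ (by have := x.1.2; omega)]
    have hd'n : ∀ (u : D.In n → J) (hu : u ∈ U),
        (fun z : D.Ext J u × Fin (D.r n) => d' n z.1.1 z.2) = y u hu := by
      intro u hu
      funext ⟨⟨u', h1, h2⟩, j⟩
      subst h2
      simp only [d', Function.update_self]
      rw [dif_pos ⟨h1, hu⟩]
    have hconj : ∀ u ∈ U, ∀ χ ∈ F u,
        χ.Realize (Sum.elim (D.below J d' u) fun z => d' n z.1.1 z.2) := by
      intro u hu χ hχ
      rw [hbelow n le_rfl, hd'n u hu]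
      exact (realize_conj (hF u) _).1 (hy u hu) χ hχ
    refine ⟨d', ?_, ?_⟩
    · rintro ⟨m, u, χ⟩ hx
      rcases (Nat.lt_succ_iff.1 (hΔ' _ hx).1).lt_or_eq with hm | hm
      · have := hd₁ _ ⟨hx, hm⟩
        dsimp only at hm this ⊢
        rw [hbelow m hm.le, hd'lt m hm.ne]
        exact this
      · dsimp only at hm
        subst hm
        exact hconj u (Or.inl ⟨_, hx, rfl, rfl⟩) χ (Or.inl hx)
    · intro x hx
      have he : D.restrict J x.1 ∈ U := Or.inr ⟨x, hx, rfl⟩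
      have := hconj _ he _ (Or.inr ⟨x, hx, ⟨x.1, (hΘ' x hx).1, rfl⟩, rfl, rfl⟩)
      exact (D.realize_liftFormula
        (⟨x.1, (hΘ' x hx).1, rfl⟩ : D.Ext J (D.restrict J x.1)) x.2 d').1 this

end UnsuperstableData

/-! ### Partial maps of index models preserving quantifier-free types -/

namespace IndexModel

variable {τ : FirstOrder.Language.{u, u}} {I J H : IndexModel τ}

/-- The restriction of `h` to `E` preserves the quantifier-free types of finite tuples.  The values
of `h` outside of `E` do not matter. -/
def IsLocal (E : Set I) (h : I → J) : Prop :=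
  SameQf (Subtype.val : E → I) fun x : E => h x

namespace IsLocal

variable {E E' : Set I} {h : I → J}

theorem mono (hh : IsLocal E h) (hE : E' ⊆ E) : IsLocal E' h :=
  SameQf.comp hh (Set.inclusion hE)

theorem sameQf (hh : IsLocal E h) {ι : Type v} (s : ι → I) (hs : ∀ k, s k ∈ E) :
    SameQf s (h ∘ s) :=
  SameQf.comp hh fun k => (⟨s k, hs k⟩ : E)

theorem comp {g : J → H} (hh : IsLocal E h) (hg : IsLocal (h '' E) g) : IsLocal E (g ∘ h) :=
  SameQf.trans hh (hg.sameQf (fun x : E => h x) fun x => ⟨x, x.2, rfl⟩)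

theorem exists_of_sameQf {ι : Type v} {s : ι → I} {t : ι → J} (hst : SameQf s t) :
    ∃ h : I → J, IsLocal (Set.range s) h ∧ ∀ k, h (s k) = t k := by
  classical
  obtain ⟨z⟩ := J.nonempty
  let h : I → J := fun x => if hx : ∃ k, s k = x then t hx.choose else z
  have hh : ∀ k, h (s k) = t k := fun k => by
    have hx : ∃ k', s k' = s k := ⟨k, rfl⟩
    simp only [h, dif_pos hx]
    exact (hst.eq_iff _ _).1 hx.choose_spec
  refine ⟨h, ?_, hh⟩
  choose k hk using fun x : Set.range s => x.2
  have h1 := hst.comp k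
  have h2 : s ∘ k = Subtype.val := funext hk
  have h3 : t ∘ k = fun x : Set.range s => h x := funext fun x => by
    rw [← hk x, hh]
    rfl
  rwa [h2, h3] at h1

theorem exists_extend {lt : τ.Relations 2} {K : IndexModel τ → Prop}
    (hK : IsIndexModelClass lt K) (hI : K I) (hJ : IsAlephZeroSaturated K J) (hE : E.Finite)
    (hE' : E'.Finite) (hh : IsLocal E h) :
    ∃ h' : I → J, IsLocal (E ∪ E') h' ∧ ∀ x ∈ E, h' x = h x := by
  have := hE.to_subtype
  have := hE'.to_subtype
  obtain ⟨t, ht⟩ := exists_sameQf_extend hK hI hJ hh (Subtype.val : E' → I)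
  obtain ⟨h', h1, h2⟩ := exists_of_sameQf ht
  refine ⟨h', ?_, fun x hx => h2 (Sum.inl ⟨x, hx⟩)⟩
  rwa [Set.Sum.elim_range, Subtype.range_coe, Subtype.range_coe] at h1

end IsLocal

end IndexModel

/-! ### The variables on which a formula depends -/

section DependsOn

variable {L : FirstOrder.Language.{u, u}} {α : Type v} {β : Type w}

/-- The truth of `φ` depends only on the values of the variables in `X`. -/
def DependsOn (φ : L.Formula α) (X : Set α) : Prop :=
  ∀ (N : Type u) [L.Structure N] (v v' : α → N), (∀ x ∈ X, v x = v' x) →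
    (φ.Realize v ↔ φ.Realize v')

theorem exists_dependsOn (φ : L.Formula α) : ∃ X : Set α, X.Finite ∧ DependsOn φ X := by
  classical
  exact ⟨φ.freeVarFinset, Finset.finite_toSet _, fun N _ v v' h => realize_congr_of_support φ h⟩

theorem DependsOn.mono {φ : L.Formula α} {X Y : Set α} (h : DependsOn φ X) (hXY : X ⊆ Y) :
    DependsOn φ Y := fun N _ v v' hv => h N v v' fun x hx => hv x (hXY hx)

theorem DependsOn.relabel {φ : L.Formula α} {X : Set α} (h : DependsOn φ X) (g : α → β) :
    DependsOn (φ.relabel g) (g '' X) := fun N _ v v' hv => by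
  rw [Formula.realize_relabel, Formula.realize_relabel]
  exact h N _ _ fun x hx => hv _ ⟨x, hx, rfl⟩

theorem DependsOn.inter {φ : L.Formula α} {X Y : Set α} (h : DependsOn φ X) (h' : DependsOn φ Y) :
    DependsOn φ (X ∩ Y) := fun N _ v v' hv => by
  classical
  refine (h N v (fun x => if x ∈ X then v x else v' x) fun x hx => ?_).trans
    (h' N _ v' fun x hx => ?_)
  · simp [hx]
  · by_cases hX : x ∈ X
    · simpa [hX] using hv x ⟨hX, hx⟩
    · simp [hX]

theorem DependsOn.not {φ : L.Formula α} {X : Set α} (h : DependsOn φ X) : DependsOn φ.not X :=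
  fun N _ v v' hv => by rw [Formula.realize_not, Formula.realize_not, h N v v' hv]

theorem dependsOn_not_iff {φ : L.Formula α} {X : Set α} : DependsOn φ.not X ↔ DependsOn φ X :=
  ⟨fun h N _ v v' hv => not_iff_not.1 (by
    simpa only [Formula.realize_not] using h N v v' hv), DependsOn.not⟩

end DependsOn

/-! ### Naming the values of terms with parameters -/

section ParamLang

variable {L : FirstOrder.Language.{u, u}} {Γ : Type u}

/-- The signature with a function symbol for each term of `L` with parameters from `Γ`. -/
def paramLang (L : FirstOrder.Language.{u, u}) (Γ : Type u) : FirstOrder.Language.{u, u} :=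
  ⟨fun n => L.Term (Γ ⊕ Fin n), L.Relations⟩

/-- The inclusion of `L` in `paramLang L Γ`. -/
def paramIncl (L : FirstOrder.Language.{u, u}) (Γ : Type u) : L →ᴸ paramLang L Γ where
  onFunction := fun {n} F => (Term.func F fun i => Term.var (Sum.inr i) : L.Term (Γ ⊕ Fin n))
  onRelation := fun {n} (R : L.Relations n) => R

theorem paramIncl_injective : (paramIncl L Γ).Injective where
  onFunction := fun {n} F G h => by
    have h' : (Term.func F fun i => Term.var (Sum.inr i) : L.Term (Γ ⊕ Fin n)) =
      Term.func G fun i => Term.var (Sum.inr i) := h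
    simpa using h'
  onRelation := fun {n} R S h => h

/-- The symbol of `paramLang L Γ` for a term. -/
def termSymb {n : ℕ} (t : L.Term (Γ ⊕ Fin n)) : (paramLang L Γ).Functions n := t

/-- The interpretation of `paramLang L Γ` given by the values of the parameters. -/
abbrev paramStructure {N : Type v} [L.Structure N] (c : Γ → N) : (paramLang L Γ).Structure N where
  funMap {_} (t : L.Term (Γ ⊕ Fin _)) x := t.realize (Sum.elim c x)
  RelMap {_} (R : L.Relations _) x := Structure.RelMap R x

/-- The values of the parameters in a structure for a signature containing `paramLang L Γ`. -/
def paramVal {L' : FirstOrder.Language.{u, u}} (i : paramLang L Γ →ᴸ L') (N : Type v)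
    [L'.Structure N] (γ : Γ) : N :=
  Structure.funMap (i.onFunction (termSymb (Term.var (Sum.inl γ)) : (paramLang L Γ).Functions 0))
    Fin.elim0

/-- The interpretation of the symbols of `paramLang L Γ` is the one determined by that of `L` and
the parameters. -/
def IsCoherent {L' : FirstOrder.Language.{u, u}} (i : paramLang L Γ →ᴸ L') (N : Type v)
    [L'.Structure N] : Prop :=
  ∀ (n : ℕ) (t : L.Term (Γ ⊕ Fin n)) (x : Fin n → N),
    Structure.funMap (i.onFunction (termSymb t)) x =
      @Term.realize L N ((i.comp (paramIncl L Γ)).reduct N) _ (Sum.elim (paramVal i N) x) t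

/-- The term of `paramLang L Γ` naming a parameter. -/
def paramConst {α : Type v} (γ : Γ) : (paramLang L Γ).Term α :=
  Term.func (termSymb (Term.var (Sum.inl γ)) : (paramLang L Γ).Functions 0) Fin.elim0

theorem realize_paramConst {α : Type v} (γ : Γ) {N : Type w} [(paramLang L Γ).Structure N]
    (v : α → N) : (paramConst γ : (paramLang L Γ).Term α).realize v =
      paramVal (LHom.id (paramLang L Γ)) N γ := by
  unfold paramConst paramVal
  rw [Term.realize_func]
  exact congrArg _ (Subsingleton.elim _ _)

/-- A formula of `L` with parameters from `Γ`, as a formula of `paramLang L Γ`. -/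
def paramFormula {α : Type v} (φ : L.Formula (α ⊕ Γ)) : (paramLang L Γ).Formula α :=
  BoundedFormula.subst ((paramIncl L Γ).onFormula φ) (Sum.elim Term.var paramConst)

theorem realize_onFormula_paramFormula {L' : FirstOrder.Language.{u, u}}
    (i : paramLang L Γ →ᴸ L') {α : Type v} (φ : L.Formula (α ⊕ Γ)) {N : Type w} [L'.Structure N]
    (v : α → N) : (i.onFormula (paramFormula φ)).Realize v ↔
      @Formula.Realize L N ((i.comp (paramIncl L Γ)).reduct N) _ φ
        (Sum.elim v (paramVal i N)) := by
  rw [realize_onFormula_reduct]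
  let _ : (paramLang L Γ).Structure N := i.reduct N
  unfold paramFormula
  rw [realize_subst_formula, realize_onFormula_reduct]
  refine iff_of_eq (congrArg (@Formula.Realize L N ((i.comp (paramIncl L Γ)).reduct N) _ φ) ?_)
  funext x
  rcases x with x | γ
  · rfl
  · exact realize_paramConst γ v

theorem realize_paramFormula {α : Type v} (φ : L.Formula (α ⊕ Γ)) {N : Type w} [L.Structure N]
    (c : Γ → N) (v : α → N) :
    @Formula.Realize (paramLang L Γ) N (paramStructure c) _ (paramFormula φ) v ↔
      φ.Realize (Sum.elim v c) := by
  let _ : (paramLang L Γ).Structure N := paramStructure c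
  have h := realize_onFormula_paramFormula (LHom.id _) φ v
  rw [realize_onFormula_reduct] at h
  exact h

/-- Coherence for a single term, as a sentence. -/
noncomputable def coherenceAxiom {n : ℕ} (t : L.Term (Γ ⊕ Fin n)) : (paramLang L Γ).Sentence :=
  Formula.iAlls (α := Empty) (Fin n) (((Term.func (termSymb t) fun i => Term.var (Sum.inr i)) :
      (paramLang L Γ).Term (Empty ⊕ Fin n)).equal
    (((paramIncl L Γ).onTerm t).subst (Sum.elim paramConst fun i => Term.var (Sum.inr i))))

theorem realize_coherenceAxiom {L' : FirstOrder.Language.{u, u}} (i : paramLang L Γ →ᴸ L') {n : ℕ}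
    (t : L.Term (Γ ⊕ Fin n)) {N : Type w} [L'.Structure N] :
    N ⊨ i.onSentence (coherenceAxiom t) ↔ ∀ x : Fin n → N,
      Structure.funMap (i.onFunction (termSymb t)) x =
        @Term.realize L N ((i.comp (paramIncl L Γ)).reduct N) _
          (Sum.elim (paramVal i N) x) t := by
  rw [realize_onSentence_reduct]
  let _ : (paramLang L Γ).Structure N := i.reduct N
  let _ : L.Structure N := (paramIncl L Γ).reduct N
  unfold coherenceAxiom Sentence.Realize
  rw [Formula.realize_iAlls]
  refine forall_congr' fun x => ?_
  rw [Formula.realize_equal, Term.realize_func, Term.realize_subst, LHom.realize_onTerm]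
  have : (fun a => Term.realize (fun a => Sum.elim (default : Empty → N) x a)
      (Sum.elim paramConst (fun i => Term.var (Sum.inr i) :
        Fin n → (paramLang L Γ).Term (Empty ⊕ Fin n)) a)) = Sum.elim (paramVal i N) x := by
    funext y
    rcases y with γ | i
    · exact realize_paramConst γ _
    · rfl
  rw [this]
  rfl

theorem models_coherenceAxiom {N : Type w} [L.Structure N] (c : Γ → N) {n : ℕ}
    (t : L.Term (Γ ⊕ Fin n)) :
    @Sentence.Realize (paramLang L Γ) N (paramStructure c) (coherenceAxiom t) := by
  let _ : (paramLang L Γ).Structure N := paramStructure c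
  have h := realize_coherenceAxiom (LHom.id _) (N := N) t
  rw [realize_onSentence_reduct] at h
  exact h.2 fun x => rfl

end ParamLang

/-! ### The Ramsey property with parameters -/

section RamseyParams

variable {τ : FirstOrder.Language.{u, u}} {K : IndexModel τ → Prop}

theorem Reflects.realize_of_isLocal {L L' : FirstOrder.Language.{u, u}} {e : L →ᴸ L'}
    {J : IndexModel τ} {N N' : Type u} [L.Structure N] [L'.Structure N'] {b : J → List N}
    {hb : ∀ t, b t ≠ []} {a : J → List N'} {ha : ∀ t, a t ≠ []} (hR : Reflects e J b hb a ha)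
    (φ : L.Formula (J × ℕ)) {E : Set J} (hE : E.Finite) (hφ : DependsOn φ (Prod.fst ⁻¹' E))
    (H : ∀ h : J → J, IsLocal E h → φ.Realize fun x => entry b hb (h x.1, x.2)) :
    (e.onFormula φ).Realize (entry a ha) := by
  classical
  obtain ⟨z⟩ := J.nonempty
  let E' : Set J := insert z E
  have : Finite E' := hE.insert z
  let r : J × ℕ → E' × ℕ := fun x =>
    (if hx : x.1 ∈ E then ⟨x.1, Or.inr hx⟩ else ⟨z, Or.inl rfl⟩, x.2)
  have hr : ∀ x ∈ Prod.fst ⁻¹' E, (((r x).1.1, (r x).2) : J × ℕ) = x := by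
    intro x hx
    have hx' : x.1 ∈ E := hx
    simp [r, hx']
  have key := hR.realize (Subtype.val : E' → J) (φ.relabel r) fun t ht => by
    obtain ⟨h, h1, h2⟩ := IsLocal.exists_of_sameQf ht
    rw [Subtype.range_coe] at h1
    rw [Formula.realize_relabel]
    refine (hφ N _ _ fun x hx => ?_).1 (H h (h1.mono (Set.subset_insert _ _)))
    have := hr x hx
    dsimp only [Function.comp]
    rw [← h2]
    exact congrArg _ (Prod.ext (congrArg h (Prod.ext_iff.1 this).1.symm) rfl)
  rw [realize_onFormula_reduct] at key ⊢
  let _ := e.reduct N'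
  rw [Formula.realize_relabel] at key
  refine (hφ N' _ _ fun x hx => ?_).1 key
  exact congrArg _ (hr x hx)

/-- The variables for entries of members of the skeleton with index in `E`, and for parameters. -/
def entriesOver {J : Type v} (Γ : Type w) (E : Set J) : Set ((J × ℕ) ⊕ Γ) :=
  {x | ∀ y, x = Sum.inl y → y.1 ∈ E}

/-- The Ramsey property relative to a template `Φ`, for formulas with parameters from an elementary
extension `N` of `GEM(J, Φ)`: they become constants of a template `Ψ ≥ Φ`. -/
theorem exists_le_params {lt : τ.Relations 2} (hK : IsIndexModelClass lt K)
    {J : IndexModel τ} (hJ : IsAlephZeroSaturated K J) {Φ : Template τ} (hΦ : Φ.InUpsilon K)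
    {N₀ : Type u} [Φ.L.Structure N₀] {A : J → List N₀} (hA : IsGEM J Φ N₀ A) (hA0 : ∀ t, A t ≠ [])
    {N : Type u} [Φ.L.Structure N] (g : N₀ ↪ₑ[Φ.L] N) {Γ : Type u} (c : Γ → N) :
    ∃ (Ψ : Template τ) (i : paramLang Φ.L Γ →ᴸ Ψ.L), i.Injective ∧ InUpsilon K Ψ ∧
      Le K Φ Ψ (i.comp (paramIncl Φ.L Γ)) ∧
      ∀ (N' : Type u) [Ψ.L.Structure N'] (a : J → List N'), IsGEM J Ψ N' a →
        IsCoherent i N' ∧ (∀ t, (a t).length = (A t).length) ∧ ∃ ha : ∀ t, a t ≠ [],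
        ∀ (φ : Φ.L.Formula ((J × ℕ) ⊕ Γ)) (E : Set J), E.Finite →
          DependsOn φ (entriesOver Γ E) →
          (∀ h : J → J, IsLocal E h →
            φ.Realize (Sum.elim (fun x => g (entry A hA0 (h x.1, x.2))) c)) →
          @Formula.Realize Φ.L N' ((i.comp (paramIncl Φ.L Γ)).reduct N') _ φ
            (Sum.elim (entry a ha) (paramVal i N')) := by
  have hne : ∀ t, (A t).map g ≠ [] := fun t h => hA0 t (List.map_eq_nil_iff.1 h)
  let _ : (paramLang Φ.L Γ).Structure N := paramStructure c
  obtain ⟨Ψ, i, hi, hΨ, hle, H⟩ := exists_le_reflects hK hJ hΦ hA (L := paramLang Φ.L Γ)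
    (e := paramIncl Φ.L Γ) paramIncl_injective (N := N) g (fun m φ x => by
      rw [realize_onFormula_reduct]
      exact g.map_formula φ x) hne
  refine ⟨Ψ, i, hi, hΨ, hle, fun N' _ a hGEM => ?_⟩
  obtain ⟨ha, hR⟩ := H N' a hGEM
  refine ⟨fun n t =>
      (realize_coherenceAxiom i t).1 (hR.realize_sentence (models_coherenceAxiom c t)),
    fun t => by rw [hR.length_eq, List.length_map], ha, fun φ E hE hφ hφE => ?_⟩
  rw [← realize_onFormula_paramFormula]
  refine hR.realize_of_isLocal (paramFormula φ) hE ?_ fun h hh => ?_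
  · intro P _ v v' hv
    let _ : Φ.L.Structure P := ((LHom.id _).comp (paramIncl Φ.L Γ)).reduct P
    have := realize_onFormula_paramFormula (LHom.id _) φ v
    rw [realize_onFormula_reduct] at this
    have this' := realize_onFormula_paramFormula (LHom.id _) φ v'
    rw [realize_onFormula_reduct] at this'
    refine this.trans ((hφ P _ _ fun x hx => ?_).trans this'.symm)
    rcases x with x | γ
    · exact hv x (hx x rfl)
    · rfl
  · rw [realize_paramFormula]
    refine (iff_of_eq (congrArg (Formula.Realize φ) ?_)).1 (hφE h hh)
    funext x
    rcases x with x | γ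
    · exact (entry_map g A hA0 hne _).symm
    · rfl

end RamseyParams

/-! ### The tree of parameters in a model -/

/-- A formula for the joint satisfiability of finitely many formulas with disjoint parameters. -/
theorem exists_formula_ex_conj {L : FirstOrder.Language.{u, u}} {κ : Type v} [Finite κ]
    {ρ : κ → Type} {β : Type} (ψ : ∀ j, L.Formula (β ⊕ ρ j)) :
    ∃ θ : L.Formula (Σ j, ρ j), ∀ (N : Type u) [L.Structure N] [Nonempty N] (v : (Σ j, ρ j) → N),
      θ.Realize v ↔ ∃ x : β → N, ∀ j, (ψ j).Realize (Sum.elim x fun i => v ⟨j, i⟩) := by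
  obtain ⟨θ, hθ⟩ := exists_formula_ex (Formula.iInf fun j =>
    (ψ j).relabel (Sum.elim Sum.inr fun i => Sum.inl (⟨j, i⟩ : Σ j, ρ j)))
  refine ⟨θ, fun N _ _ v => (hθ N v).trans (exists_congr fun x => ?_)⟩
  rw [Formula.realize_iInf]
  refine forall_congr' fun j => ?_
  rw [Formula.realize_relabel]
  refine iff_of_eq (congrArg _ (funext fun y => ?_))
  rcases y with y | y <;> rfl

namespace UnsuperstableData

variable {τ : FirstOrder.Language.{u, u}} {K : IndexModel τ → Prop} {I : IndexModel τ}
  {L₁ : FirstOrder.Language.{u, u}} {T : L₁.Theory} (D : UnsuperstableData K I T)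
  {J : IndexModel τ}

/-- By compactness, the requirements on the tree of parameters are satisfied simultaneously in an
elementary extension of any model of `T`. -/
theorem exists_realize_treeType {lt : τ.Relations 2} (hK : IsIndexModelClass lt K) (hJ : K J)
    (hT : T.IsComplete) {L : FirstOrder.Language.{u, u}} (i₁ : L₁ →ᴸ L) {N : Type u}
    [L.Structure N] [Nonempty N] (hN : ∀ φ ∈ T, N ⊨ i₁.onSentence φ) :
    ∃ (N' : Type u) (_ : L.Structure N') (_ : Nonempty N') (_ : N ↪ₑ[L] N')
      (d : ∀ n, (D.In (n + 1) → J) → Fin (D.r n) → N'),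
      ∀ (n : ℕ) (u : D.In n → J), SameQf (Subtype.val : D.In n → I) u →
        ∀ χ ∈ D.treeType J u,
          (i₁.onFormula χ).Realize (Sum.elim (D.below J d u) fun z => d n z.1.1 z.2) := by
  let X : Type u := Σ (n : ℕ) (u : D.In n → J),
    L₁.Formula ((Σ i : Fin n, Fin (D.r i)) ⊕ (D.Ext J u × Fin (D.r n)))
  let Γ : Type u := Σ n, (D.In (n + 1) → J) × Fin (D.r n)
  let f : X → L.Formula (N ⊕ Γ) := fun x => (i₁.onFormula x.2.2).relabel (Sum.inr ∘
    Sum.elim (fun y => ⟨y.1, fun z => x.2.1 ⟨z, D.mono y.1.2 z.2⟩, y.2⟩)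
      fun y => ⟨x.1, y.1.1, y.2⟩)
  have hf : ∀ (x : X) (P : Type u) [L.Structure P] (g : N → P)
      (d : ∀ n, (D.In (n + 1) → J) → Fin (D.r n) → P),
      (f x).Realize (Sum.elim g fun y => d y.1 y.2.1 y.2.2) ↔
        (i₁.onFormula x.2.2).Realize
          (Sum.elim (D.below J d x.2.1) fun z => d x.1 z.1.1 z.2) := by
    intro x P _ g d
    refine Formula.realize_relabel.trans (iff_of_eq (congrArg _ (funext fun y => ?_)))
    rcases y with y | y <;> rfl
  obtain ⟨N', _, _, g, c, hc⟩ := exists_elementary_extension (f '' {x |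
      SameQf (Subtype.val : D.In x.1 → I) x.2.1 ∧ x.2.2 ∈ D.treeType J x.2.1}) (by
    intro F hF hfin
    obtain ⟨Δ, hΔ, hΔfin, rfl⟩ := Set.exists_subset_image_finite_and.1 ⟨F, hF, hfin, rfl⟩
    obtain ⟨n, hn⟩ := (hΔfin.image fun x : X => x.1).bddAbove
    let _ : L₁.Structure N := i₁.reduct N
    obtain ⟨d, hd, -⟩ := D.exists_tree_of_finite hK hJ hT (N := N)
      ((Theory.model_iff _).2 fun φ hφ => (realize_onSentence_reduct i₁ φ).1 (hN φ hφ)) (n + 1)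
      Δ ∅ hΔfin Set.finite_empty
      (fun x hx => ⟨Nat.lt_succ_iff.2 (hn ⟨x, hx, rfl⟩), (hΔ hx).1, (hΔ hx).2⟩)
      (fun x hx => hx.elim)
    refine ⟨fun y => d y.1 y.2.1 y.2.2, ?_⟩
    rintro _ ⟨x, hx, rfl⟩
    rw [hf, realize_onFormula_reduct]
    exact hd x hx)
  refine ⟨N', inferInstance, inferInstance, g, fun n u j => c ⟨n, u, j⟩, fun n u hu χ hχ => ?_⟩
  exact (hf ⟨n, u, χ⟩ N' g fun n u j => c ⟨n, u, j⟩).1 (hc _ ⟨_, ⟨hu, hχ⟩, rfl⟩)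

/-- The formula expressing that `ψ₀, …, ψₙ` are jointly satisfied. -/
theorem exists_branch_formula (n : ℕ) : ∃ θ : L₁.Formula (Σ i : Fin (n + 1), Fin (D.r i)),
    (θ.Realize fun x => D.c x.1 x.2) ∧ ∀ (N : Type u) [L₁.Structure N] [Nonempty N]
      (v : ∀ i, Fin (D.r i) → N), (θ.Realize fun x => v x.1 x.2) ↔
        ∃ x : Fin D.k → N, ∀ i < n + 1, (D.ψ i).Realize (Sum.elim x (v i)) := by
  obtain ⟨θ, hθ⟩ := exists_formula_ex_conj fun i : Fin (n + 1) => D.ψ i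
  have h : ∀ (N : Type u) [L₁.Structure N] [Nonempty N]
      (v : ∀ i, Fin (D.r i) → N), (θ.Realize fun x => v x.1 x.2) ↔
        ∃ x : Fin D.k → N, ∀ i < n + 1, (D.ψ i).Realize (Sum.elim x (v i)) := fun N _ _ v =>
    (hθ N _).trans (exists_congr fun x => ⟨fun H i hi => H ⟨i, hi⟩, fun H i => H i i.2⟩)
  exact ⟨θ, (h D.M D.c).2 (D.consistent _), h⟩

/-- Every model of `T` has an elementary extension with a tree of parameters `d n u`, for
`u : Iₙ₊₁ → J`: along each branch the formulas `ψᵢ` are jointly satisfied, but `ψₙ` has finitely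
many conjugates over `Iₙ` which are jointly inconsistent, and remain so under partial maps
preserving quantifier-free types. -/
theorem exists_tree {lt : τ.Relations 2} (hK : IsIndexModelClass lt K)
    (hJ : IsAlephZeroSaturated K J) {f : I → J} (hf : IsEmbedding I J f)
    (hT : T.IsComplete) {L : FirstOrder.Language.{u, u}} (i₁ : L₁ →ᴸ L) {N : Type u}
    [L.Structure N] [Nonempty N] (hN : ∀ φ ∈ T, N ⊨ i₁.onSentence φ) :
    ∃ (N' : Type u) (_ : L.Structure N') (_ : Nonempty N') (_ : N ↪ₑ[L] N')
      (d : ∀ n, (D.In (n + 1) → J) → Fin (D.r n) → N'),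
      (∀ (n : ℕ) (u : D.In (n + 1) → J), SameQf (Subtype.val : D.In (n + 1) → I) u →
        ∃ x : Fin D.k → N', ∀ (i : ℕ) (hi : i < n + 1), (i₁.onFormula (D.ψ i)).Realize
          (Sum.elim x (d i fun y => u ⟨y, D.mono (Nat.succ_le_of_lt hi) y.2⟩))) ∧
      ∀ n, ∃ (κ : Type u) (_ : Finite κ) (w : κ → D.In (n + 1) → J),
        (∀ j, IsConjugate f (D.mono n.le_succ) (w j)) ∧ ∀ h : J → J,
          IsLocal (Set.range (fun x : κ × D.In (n + 1) => w x.1 x.2)) h →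
          ¬ ∃ x : Fin D.k → N', ∀ j, (i₁.onFormula (D.ψ n)).Realize
            (Sum.elim x (d n (h ∘ w j))) := by
  obtain ⟨N', _, _, g, d, hd⟩ := D.exists_realize_treeType hK hJ.mem hT i₁ hN
  let _ : L₁.Structure N' := i₁.reduct N'
  simp only [realize_onFormula_reduct] at hd ⊢
  refine ⟨N', inferInstance, inferInstance, g, d, fun n u hu => ?_, fun n => ?_⟩
  · obtain ⟨θ, hθ, H⟩ := D.exists_branch_formula n
    have hu' : SameQf (Subtype.val : D.In n → I) (D.restrict J u) :=
      hu.comp fun y : D.In n => (⟨y, D.mono n.le_succ y.2⟩ : D.In (n + 1))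
    have h1 := hd n _ hu' _ (D.liftFormula_mem_treeType (⟨u, hu, rfl⟩ : D.Ext J _) θ hθ)
    rw [D.realize_liftFormula (⟨u, hu, rfl⟩ : D.Ext J (D.restrict J u)) θ d] at h1
    let v : ∀ i, Fin (D.r i) → N' := fun i j =>
      if hi : i < n + 1 then d i (fun y => u ⟨y, D.mono (Nat.succ_le_of_lt hi) y.2⟩) j
      else Classical.arbitrary N'
    have hv : D.below J d u = fun x => v x.1 x.2 := by
      funext x
      change _ = dite _ _ _
      rw [dif_pos x.1.2]
      rfl
    dsimp only at h1
    rw [hv, H] at h1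
    obtain ⟨x, hx⟩ := h1
    refine ⟨x, fun i hi => ?_⟩
    have h2 := hx i hi
    have h3 : v i = d i fun y => u ⟨y, D.mono (Nat.succ_le_of_lt hi) y.2⟩ := by
      funext j
      exact dif_pos hi
    rwa [h3] at h2
  · obtain ⟨κ, _, w', hw', hno⟩ := (D.data n).inconsistent
    obtain ⟨t, ht⟩ := exists_sameQf_extend hK (D.data n).saturated.mem hJ
      (((SameQf.of_embedding (D.data n).embedding (Subtype.val : D.In n → I)).symm.trans
        (SameQf.of_embedding hf (Subtype.val : D.In n → I))))
      fun x : κ × D.In (n + 1) => w' x.1 x.2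
    have hw : ∀ j, IsConjugate f (D.mono n.le_succ) fun x : D.In (n + 1) => t (j, x) := by
      intro j
      refine ⟨(hw' j).sameQf.trans (ht.comp fun x : D.In (n + 1) => Sum.inr (j, x)), fun x => ?_⟩
      exact (ht.eq_iff (Sum.inr (j, ⟨x, D.mono n.le_succ x.2⟩)) (Sum.inl x)).1 ((hw' j).eq_base x)
    refine ⟨κ, inferInstance, fun j x => t (j, x), hw, fun h hh => ?_⟩
    have hht : SameQf t (h ∘ t) := hh.sameQf t fun x => ⟨x, rfl⟩
    by_cases hκ : IsEmpty κ
    · have : Nonempty (D.data n).N := D.nonempty.map (D.data n).ι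
      exact absurd ⟨fun _ => Classical.arbitrary _, fun j => (hκ.false j).elim⟩ hno
    obtain ⟨j₀⟩ := not_isEmpty_iff.1 hκ
    let u : D.In n → J := fun x => h (f x)
    have hu : SameQf (Subtype.val : D.In n → I) u := by
      have := ((hw j₀).sameQf.trans (hht.comp fun x => (j₀, x))).comp
        fun y : D.In n => (⟨y, D.mono n.le_succ y.2⟩ : D.In (n + 1))
      have hu0 : u = (fun x => h (t (j₀, x))) ∘
          fun y : D.In n => (⟨y, D.mono n.le_succ y.2⟩ : D.In (n + 1)) :=
        funext fun x => congrArg h ((hw j₀).eq_base x).symm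
      rw [hu0]
      exact this
    let e : κ → D.Ext J u := fun j => ⟨fun x => h (t (j, x)),
      (hw j).sameQf.trans (hht.comp fun x => (j, x)),
      funext fun x => congrArg h ((hw j).eq_base x)⟩
    obtain ⟨θ, hθ⟩ := exists_formula_ex_conj fun _ : κ => D.ψ n
    have key := hd n u hu (θ.not.relabel fun x => Sum.inr (e x.1, x.2)) ?_
    · rw [Formula.realize_relabel, Formula.realize_not, hθ] at key
      exact key
    · refine ⟨Set.range (h ∘ t), Set.finite_range _, fun q hq hqu => ?_⟩
      have : Nonempty (D.data n).N := D.nonempty.map (D.data n).ι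
      rw [Formula.realize_relabel, Formula.realize_not, hθ]
      have hqt : SameQf (h ∘ t) (q ∘ (h ∘ t)) := hq.comp (Set.rangeFactorization (h ∘ t))
      have key := (D.data n).indiscernible w' (fun j x => q (h (t (j, x)))) hw'
        (fun j => ⟨(e j).2.1.trans (hqt.comp fun x => (j, x)), fun x => by
          rw [← hqu]
          exact congrArg q (congrArg h ((hw j).eq_base x))⟩)
        (((ht.comp Sum.inr).trans hht).trans hqt)
        (θ.not.relabel fun x => Sum.inr (x.1, x.2)) (by
          rw [Formula.realize_relabel, Formula.realize_not, hθ]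
          exact hno)
      rw [Formula.realize_relabel, Formula.realize_not, hθ] at key
      exact key

end UnsuperstableData

/-! ### Functions of finite parts of the skeleton, coded by elements -/

section SkeletonCoding

variable {τ : FirstOrder.Language.{u, u}} {K : IndexModel τ → Prop}

theorem flatMap_map_injective {X : Type v} {Y : Type w} {N : Type u} {a : Y → List N}
    (ha : Function.Injective a) {l : List X} {s t : X → Y}
    (hlen : ∀ x, (a (s x)).length = (a (t x)).length)
    (h : (l.map s).flatMap a = (l.map t).flatMap a) : ∀ x ∈ l, s x = t x := by
  induction l with
  | nil => simp
  | cons y l ih =>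
    simp only [List.map_cons, List.flatMap_cons] at h
    obtain ⟨h1, h2⟩ := List.append_inj h (hlen y)
    intro x hx
    rcases List.mem_cons.1 hx with rfl | hx
    · exact ha h1
    · exact ih h2 x hx

/-- Functions defined on the conjugates of finite families of indices become terms in the
corresponding entries of the skeleton, with parameters from an elementary extension. -/
theorem exists_coding_skeleton {J : IndexModel τ} (hJ : K J) {Φ : Template τ}
    (hΦ : Φ.InUpsilon K) (α : appLang.{u} →ᴸ Φ.L) {N₀ : Type u} [Φ.L.Structure N₀]
    {A : J → List N₀} (hA : IsGEM J Φ N₀ A) (hA0 : ∀ t, A t ≠ [])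
    (hα : N₀ ⊨ α.onSentence appAxiom) {N : Type u} [Φ.L.Structure N] (g : N₀ ↪ₑ[Φ.L] N)
    {Γ : Type u} {ι : Γ → Type u} [∀ γ, Finite (ι γ)] (s : ∀ γ, ι γ → J)
    (G : ∀ γ, (ι γ → J) → N) :
    ∃ (N' : Type u) (_ : Φ.L.Structure N') (_ : Nonempty N') (g' : N ↪ₑ[Φ.L] N') (c : Γ → N')
      (T : ∀ γ, Φ.L.Term ((ι γ × ℕ) ⊕ Unit)), ∀ (γ : Γ) (u : ι γ → J), SameQf (s γ) u →
        (T γ).realize (Sum.elim (fun y => g' (g (entry A hA0 (u y.1, y.2)))) fun _ => c γ) =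
          g' (G γ u) := by
  classical
  have := fun γ => Fintype.ofFinite (ι γ)
  have hne := (hA.nonempty hΦ hJ).map g
  let en : ∀ γ, List (ι γ) := fun γ => Finset.univ.toList
  have hen : ∀ γ x, x ∈ en γ := fun γ x => by simp [en]
  have hlen : ∀ γ (u : ι γ → J), SameQf (s γ) u → ∀ x, (A (u x)).length = (A (s γ x)).length := by
    intro γ u hu x
    have := length_eq_of_tp_eq (hΦ.indiscernible J N₀ A hJ hA _ _ (hu [x]))
    simpa using this.symm
  have hupd : HasUpdates (appFun (α.onFunction appSymb) N) := by
    have h1 := (g.map_sentence (α.onSentence appAxiom)).1 hα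
    rw [realize_onSentence_reduct] at h1
    let _ : appLang.{u}.Structure N := α.reduct N
    exact (realize_appAxiom N).1 h1
  have hlist : ∀ γ (u : ι γ → J), SameQf (s γ) u → ((en γ).map u).flatMap A =
      (varList (fun k => (A (s γ k)).length) (en γ)).map fun x => entry A hA0 (u x.1, x.2) := by
    intro γ u hu
    rw [flatMap_eq_varList_map A hA0 u]
    simp only [hlen γ u hu]
  let G' : ∀ γ, List N → N := fun γ l =>
    if h : ∃ u : ι γ → J, SameQf (s γ) u ∧ (((en γ).map u).flatMap A).map g = l then
      G γ h.choose else Classical.arbitrary N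
  obtain ⟨N', _, _, g', c, hc⟩ := exists_coding (α.onFunction appSymb) hupd
    (fun γ => {l | ∃ u : ι γ → J, SameQf (s γ) u ∧ (((en γ).map u).flatMap A).map g = l})
    (fun γ => (varList (fun k => (A (s γ k)).length) (en γ)).length) (by
      rintro γ _ ⟨u, hu, rfl⟩
      rw [List.length_map, hlist γ u hu, List.length_map]) G'
  refine ⟨N', inferInstance, inferInstance, g', c, fun γ => appTerm (α.onFunction appSymb)
    (Term.var (Sum.inr ())) ((varList (fun k => (A (s γ k)).length) (en γ)).map fun y =>
      Term.var (Sum.inl y)), fun γ u hu => ?_⟩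
  rw [realize_appTerm, List.map_map]
  have h1 := hc γ _ ⟨u, hu, rfl⟩
  rw [hlist γ u hu, List.map_map, List.map_map] at h1
  refine h1.trans (congrArg g' ?_)
  have hex : ∃ u' : ι γ → J, SameQf (s γ) u' ∧ (((en γ).map u').flatMap A).map g =
      (varList (fun k => (A (s γ k)).length) (en γ)).map
        (g ∘ fun x => entry A hA0 (u x.1, x.2)) :=
    ⟨u, hu, by rw [hlist γ u hu, List.map_map]⟩
  have h2 := hex.choose_spec.2.trans (b := _) (c := (((en γ).map u).flatMap A).map g)
    (by rw [hlist γ u hu, List.map_map])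
  have h3 : hex.choose = u := by
    funext x
    refine flatMap_map_injective (hΦ.nontrivial J N₀ A hJ hA).2 (fun x => ?_)
      (List.map_injective_iff.2 g.injective h2) x (hen γ x)
    rw [hlen γ _ hex.choose_spec.1, hlen γ u hu]
  rw [List.map_map]
  exact (dif_pos hex).trans (congrArg (G γ) h3)

end SkeletonCoding

/-! ### A template omitting the type of a branch -/

section ParamTerm

variable {L : FirstOrder.Language.{u, u}} {Γ : Type u}

/-- A term of `L` with parameters from `Γ`, as a term of `paramLang L Γ`. -/
def paramTerm {α : Type v} (t : L.Term (α ⊕ Γ)) : (paramLang L Γ).Term α :=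
  ((paramIncl L Γ).onTerm t).subst (Sum.elim Term.var paramConst)

theorem realize_onTerm_paramTerm {L' : FirstOrder.Language.{u, u}}
    (i : paramLang L Γ →ᴸ L') {α : Type v} (t : L.Term (α ⊕ Γ)) {N : Type w} [L'.Structure N]
    (v : α → N) : (i.onTerm (paramTerm t)).realize v =
      @Term.realize L N ((i.comp (paramIncl L Γ)).reduct N) _ (Sum.elim v (paramVal i N)) t := by
  let _ : (paramLang L Γ).Structure N := i.reduct N
  let _ : L.Structure N := (paramIncl L Γ).reduct N
  unfold paramTerm
  rw [LHom.realize_onTerm, Term.realize_subst, LHom.realize_onTerm]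
  have : (fun a => Term.realize v (Sum.elim Term.var (paramConst : Γ → (paramLang L Γ).Term α) a)) =
      Sum.elim v (paramVal i N) := by
    funext x
    rcases x with x | γ
    · rfl
    · exact realize_paramConst γ v
  rw [this]
  rfl

end ParamTerm

namespace UnsuperstableData

variable {τ : FirstOrder.Language.{u, u}} {K : IndexModel τ → Prop} {I : IndexModel τ}
  {L₁ : FirstOrder.Language.{u, u}} {T : L₁.Theory} (D : UnsuperstableData K I T)

/-- A template `Ψ ≥ Φ` in which the parameters of the tree are values of terms: the `n`-th
parameter on the branch through `u : Iₙ₊₁ → J` is a term in the part of the skeleton indexed by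
`u`. The functions defining the parameters are coded by elements by means of `app`, which are then
named by the Ramsey property. -/
theorem exists_le_tree {lt : τ.Relations 2} (hK : IsIndexModelClass lt K) {J : IndexModel τ}
    (hJ : IsAlephZeroSaturated K J) {f : I → J} (hf : IsEmbedding I J f)
    (hT : T.IsComplete) {Φ : Template τ} (hΦ : Φ.InUpsilon K) (i₁ : L₁ →ᴸ Φ.L)
    (hi₁ : ∀ φ ∈ T, i₁.onSentence φ ∈ Φ.theory K) (α : appLang.{u} →ᴸ Φ.L)
    (hα : α.onSentence appAxiom ∈ Φ.theory K) :
    ∃ (Ψ : Template τ) (e : Φ.L →ᴸ Ψ.L) (δ : ∀ n, Fin (D.r n) → Ψ.L.Term (D.In (n + 1) × ℕ)),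
      Ψ.InUpsilon K ∧ Le K Φ Ψ e ∧ ∀ (P : Type u) [Ψ.L.Structure P] (a : J → List P)
        (ha : ∀ t, a t ≠ []), IsGEM J Ψ P a → ∀ n : ℕ,
        (∃ x : Fin D.k → P, ∀ (i : ℕ), i < n + 1 → ((e.comp i₁).onFormula (D.ψ i)).Realize
          (Sum.elim x fun j => (δ i j).realize fun y => entry a ha (f y.1, y.2))) ∧
        ∃ (κ : Type u) (_ : Finite κ) (w : κ → D.In (n + 1) → J),
          (∀ j, IsConjugate f (D.mono n.le_succ) (w j)) ∧
            ¬ ∃ x : Fin D.k → P, ∀ j, ((e.comp i₁).onFormula (D.ψ n)).Realize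
              (Sum.elim x fun i => (δ n i).realize fun y => entry a ha (w j y.1, y.2)) := by
  obtain ⟨N₀, _, A, hA⟩ := hΦ.proper J hJ.mem
  have hA0 := (hΦ.nontrivial J N₀ A hJ.mem hA).1
  have := hA.nonempty hΦ hJ.mem
  obtain ⟨N₁, _, _, g, d, hd₁, hd₂⟩ := D.exists_tree hK hJ hf hT i₁ (N := N₀)
    fun φ hφ => hi₁ φ hφ J N₀ A hJ.mem hA
  let Γ : Type u := ULift.{u} (Σ n, Fin (D.r n))
  obtain ⟨N₂, _, _, g', c, t, ht⟩ := exists_coding_skeleton hJ.mem hΦ α hA hA0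
    (hα J N₀ A hJ.mem hA) g (Γ := Γ) (ι := fun γ => D.In (γ.down.1 + 1))
    (fun γ x => f x) fun γ u => d γ.down.1 u γ.down.2
  obtain ⟨T', hT'⟩ : ∃ T' : ∀ n, Fin (D.r n) → Φ.L.Term ((D.In (n + 1) × ℕ) ⊕ Γ),
      ∀ n j (u : D.In (n + 1) → J), SameQf (Subtype.val : D.In (n + 1) → I) u →
        (T' n j).realize (Sum.elim (fun y => g' (g (entry A hA0 (u y.1, y.2)))) c) =
          g' (d n u j) := by
    refine ⟨fun n j => (t ⟨n, j⟩).relabel (Sum.map id fun _ => ⟨n, j⟩), fun n j u hu => ?_⟩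
    rw [Term.realize_relabel]
    refine Eq.trans (congrArg (fun v => Term.realize v (t ⟨n, j⟩)) ?_)
      (ht ⟨n, j⟩ u ((SameQf.of_embedding hf _).symm.trans hu))
    funext x
    rcases x with x | x <;> rfl
  obtain ⟨Ψ, i, hi, hΨ, hle, H⟩ := exists_le_params hK hJ hΦ hA hA0 (g'.comp g) c
  refine ⟨Ψ, i.comp (paramIncl Φ.L Γ), fun n j => i.onTerm (paramTerm (T' n j)), hΨ, hle,
    fun P _ a ha hGEM n => ?_⟩
  obtain ⟨-, -, ha', H'⟩ := H P a hGEM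
  let _ : Φ.L.Structure P := (i.comp (paramIncl Φ.L Γ)).reduct P
  have : Nonempty P := hGEM.nonempty hΨ hJ.mem
  -- formulas about the parameters coded by the terms `T'`
  have key : ∀ {β : Type u} (θ : L₁.Formula β) (m : β → ℕ) (j : ∀ b, Fin (D.r (m b)))
      (u : ∀ b, D.In (m b + 1) → J) (E : Set J), E.Finite → (∀ b y, u b y ∈ E) →
      (∀ h : J → J, IsLocal E h → (i₁.onFormula θ).Realize fun b => d (m b) (h ∘ u b) (j b)) →
      (∀ b, SameQf (Subtype.val : D.In (m b + 1) → I) (u b)) →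
      (i₁.onFormula θ).Realize fun b =>
        (i.onTerm (paramTerm (T' (m b) (j b)))).realize fun y => entry a ha (u b y.1, y.2) := by
    intro β θ m j u E hE huE hu hu'
    have h1 := H' (BoundedFormula.subst (i₁.onFormula θ) fun b =>
      (T' (m b) (j b)).relabel (Sum.map (fun y => (u b y.1, y.2)) id)) E hE ?_ fun h hh => ?_
    · rw [realize_subst_formula] at h1
      refine (iff_of_eq (congrArg (Formula.Realize (i₁.onFormula θ)) (funext fun b => ?_))).1 h1
      rw [realize_onTerm_paramTerm, Term.realize_relabel]
      refine congrArg (fun v => Term.realize v (T' (m b) (j b))) (funext fun x => ?_)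
      rcases x with x | x <;> rfl
    · intro Q _ v v' hv
      rw [realize_subst_formula, realize_subst_formula]
      refine iff_of_eq (congrArg _ (funext fun b => ?_))
      rw [Term.realize_relabel, Term.realize_relabel]
      refine congrArg (fun v => Term.realize v (T' (m b) (j b))) (funext fun x => hv _ ?_)
      rintro y hy
      rcases x with x | x
      · obtain rfl := Sum.inl.inj hy
        exact huE b _
      · exact (Sum.inr_ne_inl hy).elim
    · rw [realize_subst_formula]
      have h2 := (g'.map_formula _ _).2 (hu h hh)
      refine (iff_of_eq (congrArg (Formula.Realize (i₁.onFormula θ)) (funext fun b => ?_))).1 h2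
      rw [Term.realize_relabel]
      refine (hT' _ _ (h ∘ u b) ((hu' b).trans
        (hh.sameQf (u b) fun y => huE b y))).symm.trans ?_
      refine congrArg (fun v => Term.realize v (T' (m b) (j b))) (funext fun x => ?_)
      rcases x with x | x <;> rfl
  let _ : L₁.Structure N₁ := i₁.reduct N₁
  let _ : L₁.Structure P := i₁.reduct P
  simp only [realize_onFormula_reduct] at key hd₁ hd₂
  have hcomp : ∀ {β : Type} (θ : L₁.Formula β) (v : β → P),
      (((i.comp (paramIncl Φ.L Γ)).comp i₁).onFormula θ).Realize v ↔ θ.Realize v :=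
    fun θ v => realize_onFormula_reduct _ θ v
  simp only [hcomp]
  constructor
  · obtain ⟨θ, -, hθ⟩ := D.exists_branch_formula n
    have h1 := key (β := ULift.{u} (Σ i : Fin (n + 1), Fin (D.r i))) (θ.relabel ULift.up)
      (fun b => b.down.1) (fun b => b.down.2) (fun b y => f y) (f '' D.In (n + 1))
      ((D.In (n + 1)).finite_toSet.image f)
      (fun b y => ⟨y, D.mono (Nat.succ_le_of_lt b.down.1.2) y.2, rfl⟩) (fun h hh => by
        obtain ⟨x, hx⟩ := hd₁ n (fun y => h (f y)) ((SameQf.of_embedding hf _).trans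
          (hh.sameQf (fun y : D.In (n + 1) => f y) fun y => ⟨y, y.2, rfl⟩))
        rw [Formula.realize_relabel]
        exact (hθ N₁ fun i j => d i (fun y => h (f y)) j).2 ⟨x, hx⟩)
      (fun b => SameQf.of_embedding hf _)
    rw [Formula.realize_relabel] at h1
    exact (hθ P fun m j => (i.onTerm (paramTerm (T' m j))).realize
      fun y : D.In (m + 1) × ℕ => entry a ha (f y.1, y.2)).1 h1
  · obtain ⟨κ, _, w, hw, hno⟩ := hd₂ n
    refine ⟨κ, inferInstance, w, hw, ?_⟩
    obtain ⟨θ, hθ⟩ := exists_formula_ex_conj fun _ : κ => D.ψ n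
    have h1 := key (β := ULift.{u} (Σ _ : κ, Fin (D.r n))) (θ.not.relabel ULift.up)
      (fun _ => n) (fun b => b.down.2) (fun b => w b.down.1)
      (Set.range (fun x : κ × D.In (n + 1) => w x.1 x.2)) (Set.finite_range _)
      (fun b y => ⟨(b.down.1, y), rfl⟩) (fun h hh => by
        rw [Formula.realize_relabel, Formula.realize_not]
        exact fun h2 => hno h hh ((hθ N₁ fun y => d n (h ∘ w y.1) y.2).1 h2))
      (fun b => (hw _).sameQf)
    rw [Formula.realize_relabel, Formula.realize_not] at h1
    exact fun h2 => h1 ((hθ P _).2 h2)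

end UnsuperstableData

/-! ### Realizing countable types in saturated models -/

section CountableTypes

variable {L : FirstOrder.Language.{u, u}} {M : Type u} [L.Structure M]

/-- Saturation for sets of formulas with all elements as variables, as long as only few of these
are relevant. -/
theorem IsSaturated.exists_realize_unit {μ : Cardinal.{u}} (h : IsSaturated L M μ)
    {p : Set (L.Formula (M ⊕ Unit))} {A : Set M} (hA : Cardinal.mk A < μ)
    (hp : ∀ φ ∈ p, DependsOn φ {x | ∀ m, x = Sum.inl m → m ∈ A})
    (hfin : ∀ F ⊆ p, F.Finite → ∃ x : M, ∀ φ ∈ F, φ.Realize (Sum.elim id fun _ => x)) :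
    ∃ x : M, ∀ φ ∈ p, φ.Realize (Sum.elim id fun _ => x) := by
  classical
  let r : M ⊕ Unit → A ⊕ Unit := fun x => match x with
    | Sum.inl m => if hm : m ∈ A then Sum.inl ⟨m, hm⟩ else Sum.inr ()
    | Sum.inr _ => Sum.inr ()
  have hr : ∀ φ ∈ p, ∀ x : M, (φ.relabel r).Realize (Sum.elim Subtype.val fun _ => x) ↔
      φ.Realize (Sum.elim id fun _ => x) := by
    intro φ hφ x
    rw [Formula.realize_relabel]
    refine hp φ hφ M _ _ fun y hy => ?_
    rcases y with m | y
    · simp [r, hy m rfl]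
    · rfl
  obtain ⟨x, hx⟩ := h A hA ((fun φ => φ.relabel r) '' p) (by
    intro F hF hFp
    obtain ⟨F', hF', hfin', rfl⟩ := Set.exists_subset_image_finite_and.1 ⟨F, hFp, hF, rfl⟩
    obtain ⟨x, hx⟩ := hfin F' hF' hfin'
    refine ⟨x, ?_⟩
    rintro _ ⟨φ, hφ, rfl⟩
    exact (hr φ (hF' hφ) x).2 (hx φ hφ))
  exact ⟨x, fun φ hφ => (hr φ hφ x).1 (hx _ ⟨φ, hφ, rfl⟩)⟩

/-- In an `ℵ₁`-saturated structure, countable types in finitely many variables are realized. -/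
theorem IsSaturated.exists_realize_of_countable [Nonempty M]
    (h : IsSaturated L M (Cardinal.aleph 1)) (k : ℕ) (p : Set (L.Formula (M ⊕ Fin k)))
    (hp : p.Countable)
    (hfin : ∀ F ⊆ p, F.Finite → ∃ x : Fin k → M, ∀ φ ∈ F, φ.Realize (Sum.elim id x)) :
    ∃ x : Fin k → M, ∀ φ ∈ p, φ.Realize (Sum.elim id x) := by
  classical
  induction k with
  | zero =>
    refine ⟨Fin.elim0, fun φ hφ => ?_⟩
    obtain ⟨x, hx⟩ := hfin {φ} (by simpa using hφ) (Set.finite_singleton φ)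
    rw [Subsingleton.elim Fin.elim0 x]
    exact hx φ rfl
  | succ k ih =>
    let ρ : M ⊕ Fin (k + 1) → (M ⊕ Fin k) ⊕ Unit := Sum.elim (fun m => Sum.inl (Sum.inl m))
      (Fin.lastCases (Sum.inr ()) fun i => Sum.inl (Sum.inr i))
    have hρ : ∀ (φ : L.Formula (M ⊕ Fin (k + 1))) (x : Fin k → M) (y : Unit → M),
        (φ.relabel ρ).Realize (Sum.elim (Sum.elim id x) y) ↔
          φ.Realize (Sum.elim id (Fin.snoc x (y ()))) := by
      intro φ x y
      rw [Formula.realize_relabel]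
      refine iff_of_eq (congrArg _ (funext fun z => ?_))
      rcases z with m | i
      · rfl
      · induction i using Fin.lastCases with
        | last => simp [ρ]
        | cast i => simp [ρ]
    have hP : {F | F.Finite ∧ F ⊆ p}.Countable := Set.countable_ofPred_finite_subset hp
    choose θ hθ using fun F : {F | F.Finite ∧ F ⊆ p} =>
      exists_formula_ex ((conj F.1 F.2.1).relabel ρ)
    obtain ⟨x, hx⟩ := ih (Set.range θ) (by
      have := hP.to_subtype
      exact Set.countable_range θ) (by
        intro G hG hGfin
        obtain ⟨𝒢, -, h𝒢, rfl⟩ := Set.exists_subset_image_finite_and.1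
          ⟨G, by rwa [Set.image_univ], hGfin, rfl⟩
        obtain ⟨x, hx⟩ := hfin (⋃ F ∈ 𝒢, F.1) (Set.iUnion₂_subset fun F _ => F.2.2)
          (h𝒢.biUnion fun F _ => F.2.1)
        refine ⟨fun i => x i.castSucc, ?_⟩
        rintro _ ⟨F, hF, rfl⟩
        refine (hθ F M _).2 ⟨fun _ => x (Fin.last k), ?_⟩
        rw [hρ, realize_conj]
        intro φ hφ
        have : (Fin.snoc (fun i => x i.castSucc) (x (Fin.last k)) : Fin (k + 1) → M) = x :=
          Fin.snoc_init_self x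
        rw [this]
        exact hx φ (Set.mem_biUnion hF hφ))
    have hx' : ∀ F ⊆ p, F.Finite → ∃ y : M, ∀ φ ∈ F, φ.Realize (Sum.elim id (Fin.snoc x y)) := by
      intro F hF hFfin
      obtain ⟨y, hy⟩ := (hθ ⟨F, hFfin, hF⟩ M _).1 (hx _ ⟨_, rfl⟩)
      rw [hρ, realize_conj] at hy
      exact ⟨y (), hy⟩
    let σ : M ⊕ Fin (k + 1) → M ⊕ Unit := Sum.map (Sum.elim id x) id ∘ ρ
    have hσ : ∀ (φ : L.Formula (M ⊕ Fin (k + 1))) (y : M),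
        (φ.relabel σ).Realize (Sum.elim id fun _ => y) ↔
          φ.Realize (Sum.elim id (Fin.snoc x y)) := by
      intro φ y
      rw [← hρ φ x fun _ => y, Formula.realize_relabel, Formula.realize_relabel]
      refine iff_of_eq (congrArg _ (funext fun z => ?_))
      change Sum.elim id (fun _ => y) (Sum.map (Sum.elim id x) id (ρ z)) = _
      change _ = Sum.elim (Sum.elim id x) (fun _ => y) (ρ z)
      rcases ρ z with z | z <;> rfl
    choose X hX hXd using fun φ : L.Formula (M ⊕ Unit) => exists_dependsOn φ
    let A : Set M := ⋃ φ ∈ (fun φ : L.Formula (M ⊕ Fin (k + 1)) => φ.relabel σ) '' p,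
      Sum.inl ⁻¹' X φ
    have hA : A.Countable := (hp.image _).biUnion fun φ _ =>
      ((hX φ).preimage Sum.inl_injective.injOn).countable
    obtain ⟨y, hy⟩ := h.exists_realize_unit (A := A)
      (p := (fun φ : L.Formula (M ⊕ Fin (k + 1)) => φ.relabel σ) '' p)
      (Cardinal.lt_aleph_one_iff.2 (Cardinal.le_aleph0_iff_set_countable.2 hA))
      (fun φ hφ => (hXd φ).mono fun z hz m hm => Set.mem_biUnion hφ (by
          subst hm
          exact hz)) (by
        intro F hF hFfin
        obtain ⟨F', hF', hfin', rfl⟩ := Set.exists_subset_image_finite_and.1 ⟨F, hF, hFfin, rfl⟩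
        obtain ⟨y, hy⟩ := hx' F' hF' hfin'
        refine ⟨y, ?_⟩
        rintro _ ⟨φ, hφ, rfl⟩
        exact (hσ φ y).2 (hy φ hφ))
    exact ⟨Fin.snoc x y, fun φ hφ => (hσ φ y).1 (hy _ ⟨φ, hφ, rfl⟩)⟩

end CountableTypes

/-! ### Transfer along elementary embeddings and partial maps of the skeleton -/

section Transfer

/-- An elementary embedding, for a smaller signature. -/
def _root_.FirstOrder.Language.ElementaryEmbedding.ofLHom {L L' : FirstOrder.Language.{u, u}}
    (e : L →ᴸ L') {M N : Type u} [L'.Structure M] [L'.Structure N] (g : M ↪ₑ[L'] N) :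
    letI := e.reduct M
    letI := e.reduct N
    M ↪ₑ[L] N :=
  letI := e.reduct M
  letI := e.reduct N
  ⟨g, fun n φ x => by
    have h1 := g.map_formula (e.onFormula φ) x
    rwa [realize_onFormula_reduct, realize_onFormula_reduct] at h1⟩

theorem entry_eq_of_map_eq {N N' : Type u} {I : Type v} {J : Type w} {a : I → List N}
    {b : J → List N'} {g : N → N'} {f : I → J} (h : ∀ t, (a t).map g = b (f t))
    (ha : ∀ t, a t ≠ []) (hb : ∀ t, b t ≠ []) (t : I) (i : ℕ) :
    entry b hb (f t, i) = g (entry a ha (t, i)) := by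
  unfold entry
  simp only [← h]
  by_cases hi : i < (a t).length
  · simp [hi]
  · simp [hi]

variable {τ : FirstOrder.Language.{u, u}} {K : IndexModel τ → Prop}

theorem Template.IsGEM.realize_iff_of_isLocal {Φ : Template τ} (hΦ : Φ.InUpsilon K)
    {J : IndexModel τ} (hJ : K J) {N : Type u} [Φ.L.Structure N] {a : J → List N}
    (ha : IsGEM J Φ N a) (ha0 : ∀ t, a t ≠ []) {E : Set J} {h : J → J} (hh : IsLocal E h)
    (φ : Φ.L.Formula (J × ℕ)) (hφ : DependsOn φ (Prod.fst ⁻¹' E)) :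
    φ.Realize (entry a ha0) ↔ φ.Realize fun x => entry a ha0 (h x.1, x.2) := by
  classical
  by_cases hE : E.Nonempty
  · obtain ⟨z, hz⟩ := hE
    let r : J × ℕ → E × ℕ := fun x => (if hx : x.1 ∈ E then ⟨x.1, hx⟩ else ⟨z, hz⟩, x.2)
    have hr : ∀ x ∈ Prod.fst ⁻¹' E, (((r x).1.1, (r x).2) : J × ℕ) = x := by
      intro x hx
      have hx' : x.1 ∈ E := hx
      simp [r, hx']
    have key := realize_entry_iff_of_tp a ha0 a ha0 (Subtype.val : E → J) (fun x : E => h x)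
      (fun _ => True) (fun _ => trivial)
      (fun l m φ _ => by rw [hΦ.indiscernible J N a hJ ha _ _ (hh l)]) (φ.relabel r)
      fun _ _ => trivial
    rw [Formula.realize_relabel, Formula.realize_relabel] at key
    refine (hφ N _ _ fun x hx => ?_).trans (key.trans (hφ N _ _ fun x hx => ?_))
    · exact congrArg _ (hr x hx).symm
    · have := hr x hx
      exact congrArg (fun y : J × ℕ => entry a ha0 (h y.1, y.2)) this
  · exact hφ N _ _ fun x hx => (hE ⟨_, hx⟩).elim

end Transfer

namespace UnsuperstableData

variable {τ : FirstOrder.Language.{u, u}} {K : IndexModel τ → Prop} {I : IndexModel τ}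
  {L₁ : FirstOrder.Language.{u, u}} {T : L₁.Theory} (D : UnsuperstableData K I T)

theorem exists_subset_In {E : Set I} (hE : E.Finite) : ∃ n, E ⊆ D.In n := by
  induction E, hE using Set.Finite.induction_on with
  | empty => exact ⟨0, Set.empty_subset _⟩
  | @insert x E _ _ ih =>
    obtain ⟨n, hn⟩ := ih
    obtain ⟨m, hm⟩ := D.cover x
    exact ⟨max n m, Set.insert_subset (D.mono (le_max_right _ _) hm)
      (hn.trans (Finset.coe_subset.2 (D.mono (le_max_left _ _))))⟩

/-- In `GEM(I, Χ)` the type of the branch given by `I` itself is omitted: a realization is generated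
by the part of the skeleton indexed by some `Iₙ`, hence it realizes all conjugates over `Iₙ` of the
`n`-th formula, which are inconsistent. -/
theorem not_isSaturated {J : IndexModel τ} (hI : K I) (hJ : K J) {f : I → J}
    (hf : IsEmbedding I J f) {Ψ : Template τ} (hΨ : Ψ.InUpsilon K) (e₁ : L₁ →ᴸ Ψ.L)
    (δ : ∀ n, Fin (D.r n) → Ψ.L.Term (D.In (n + 1) × ℕ))
    (H : ∀ (P : Type u) [Ψ.L.Structure P] (a : J → List P)
        (ha : ∀ t, a t ≠ []), IsGEM J Ψ P a → ∀ n : ℕ,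
        (∃ x : Fin D.k → P, ∀ (i : ℕ), i < n + 1 → (e₁.onFormula (D.ψ i)).Realize
          (Sum.elim x fun j => (δ i j).realize fun y => entry a ha (f y.1, y.2))) ∧
        ∃ (κ : Type u) (_ : Finite κ) (w : κ → D.In (n + 1) → J),
          (∀ j, IsConjugate f (D.mono n.le_succ) (w j)) ∧
            ¬ ∃ x : Fin D.k → P, ∀ j, (e₁.onFormula (D.ψ n)).Realize
              (Sum.elim x fun i => (δ n i).realize fun y => entry a ha (w j y.1, y.2)))
    {Χ : Template τ} (hΧ : Χ.InUpsilon K) {e' : Ψ.L →ᴸ Χ.L} (hle : Le K Ψ Χ e') {M : Type u}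
    [Χ.L.Structure M] {b : I → List M} (hb : IsGEM I Χ M b) :
    ¬ @IsSaturated L₁ M ((e'.comp e₁).reduct M) (Cardinal.aleph 1) := by
  classical
  intro hsat
  obtain ⟨N, _, c, hc⟩ := hΧ.proper J hJ
  obtain ⟨P, _, a, ha⟩ := hΨ.proper J hJ
  obtain ⟨g, hg⟩ := hΧ.elementary I J f hI hJ hf M b N c hb hc
  let _ : Ψ.L.Structure N := e'.reduct N
  let _ : Ψ.L.Structure M := e'.reduct M
  let _ : L₁.Structure N := e₁.reduct N
  let _ : L₁.Structure M := e₁.reduct M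
  let _ : L₁.Structure P := e₁.reduct P
  obtain ⟨q, hq⟩ := hle.elementary J hJ P a N c ha hc
  let g' : M ↪ₑ[Ψ.L] N := g.ofLHom e'
  let g₁ : M ↪ₑ[L₁] N := g'.ofLHom e₁
  let q₁ : P ↪ₑ[L₁] N := q.ofLHom e₁
  have hb0 := (hΧ.nontrivial I M b hI hb).1
  have hc0 := (hΧ.nontrivial J N c hJ hc).1
  have ha0 := (hΨ.nontrivial J P a hJ ha).1
  have : Nonempty M := hb.nonempty hΧ hI
  have : Nonempty P := ha.nonempty hΨ hJ
  have : Nonempty N := hc.nonempty hΧ hJ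
  have hgb : ∀ y : I × ℕ, g (entry b hb0 y) = entry c hc0 (f y.1, y.2) := fun y =>
    (entry_eq_of_map_eq hg hb0 hc0 y.1 y.2).symm
  have hqa : ∀ y : J × ℕ, q (entry a ha0 y) = entry c hc0 y := fun y =>
    (entry_eq_of_map_eq (f := id) hq ha0 hc0 y.1 y.2).symm
  let dM : ∀ n, Fin (D.r n) → M := fun n j =>
    (δ n j).realize fun y => entry b hb0 (y.1, y.2)
  have hdM : ∀ n j, g (dM n j) = (δ n j).realize fun y => entry c hc0 (f y.1, y.2) := by
    intro n j
    refine (HomClass.realize_term (F := M ↪ₑ[Ψ.L] N) (g := g')).symm.trans ?_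
    exact congrArg (fun v => Term.realize v (δ n j)) (funext fun y => hgb _)
  have hqd : ∀ n j (u : D.In (n + 1) → J),
      q ((δ n j).realize fun y => entry a ha0 (u y.1, y.2)) =
        (δ n j).realize fun y => entry c hc0 (u y.1, y.2) := by
    intro n j u
    refine (HomClass.realize_term (F := P ↪ₑ[Ψ.L] N) (g := q)).symm.trans ?_
    exact congrArg (fun v => Term.realize v (δ n j)) (funext fun y => hqa _)
  have H' := H P a ha0 ha
  simp only [realize_onFormula_reduct] at H'
  -- the type of the branch is consistent
  have hcons : ∀ n, ∃ x : Fin D.k → M, ∀ i < n + 1, (D.ψ i).Realize (Sum.elim x (dM i)) := by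
    intro n
    obtain ⟨θ, -, hθ⟩ := D.exists_branch_formula n
    refine (hθ M dM).1 ((g₁.map_formula _ _).1 ?_)
    have h1 := (q₁.map_formula _ _).2 ((hθ P fun i j =>
      (δ i j).realize fun y => entry a ha0 (f y.1, y.2)).2 (H' n).1)
    refine (iff_of_eq (congrArg (Formula.Realize θ) (funext fun y => ?_))).1 h1
    exact (hqd _ _ fun y => f y.1).trans (hdM _ _).symm
  have hsat' : IsSaturated L₁ M (Cardinal.aleph 1) := hsat
  let p : ℕ → L₁.Formula (M ⊕ Fin D.k) := fun i =>
    (D.ψ i).relabel (Sum.elim Sum.inr fun j => Sum.inl (dM i j))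
  have hp : ∀ i (x : Fin D.k → M), (p i).Realize (Sum.elim id x) ↔
      (D.ψ i).Realize (Sum.elim x (dM i)) := by
    intro i x
    refine Formula.realize_relabel.trans (iff_of_eq (congrArg _ (funext fun y => ?_)))
    rcases y with y | y <;> rfl
  obtain ⟨x, hx⟩ := hsat'.exists_realize_of_countable D.k (Set.range p) (Set.countable_range p) (by
    intro F hF hFfin
    obtain ⟨S, -, hS, rfl⟩ := Set.exists_subset_image_finite_and.1
      ⟨F, by rwa [Set.image_univ], hFfin, rfl⟩
    obtain ⟨n, hn⟩ := hS.bddAbove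
    obtain ⟨x, hx⟩ := hcons n
    refine ⟨x, ?_⟩
    rintro _ ⟨i, hi, rfl⟩
    exact (hp i x).2 (hx i (Nat.lt_succ_of_le (hn hi))))
  have hx' : ∀ i, (D.ψ i).Realize (Sum.elim x (dM i)) := fun i => (hp i x).1 (hx _ ⟨i, rfl⟩)
  -- the realization is generated by the part of the skeleton indexed by some `Iₙ`
  choose t ht using fun j => exists_term_of_closure (v := entry b hb0) (x := x j) (by
    rw [range_entry, hb.generates]
    trivial)
  obtain ⟨n, hn⟩ := D.exists_subset_In (E := ⋃ j, Prod.fst '' ((t j).varFinset : Set (I × ℕ)))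
    (Set.finite_iUnion fun j => (Finset.finite_toSet _).image _)
  have htn : ∀ j, ∀ y ∈ (t j).varFinset, y.1 ∈ D.In n := fun j y hy =>
    hn (Set.mem_iUnion.2 ⟨j, y, hy, rfl⟩)
  obtain ⟨-, κ, _, w, hw, hno⟩ := H' n
  obtain ⟨θ, hθ⟩ := exists_formula_ex_conj fun _ : κ => D.ψ n
  rw [← hθ P fun y => (δ n y.2).realize fun z => entry a ha0 (w y.1 z.1, z.2)] at hno
  have hnoN : ¬ θ.Realize fun y => (δ n y.2).realize fun z => entry c hc0 (w y.1 z.1, z.2) := by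
    intro h1
    refine hno ((q₁.map_formula _ _).1 ?_)
    refine (iff_of_eq (congrArg (Formula.Realize θ) (funext fun y => ?_))).1 h1
    exact (hqd _ _ _).symm
  rw [hθ] at hnoN
  refine hnoN ⟨g ∘ x, fun j => ?_⟩
  let Θ : Χ.L.Formula (J × ℕ) := BoundedFormula.subst ((e'.comp e₁).onFormula (D.ψ n))
    (Sum.elim (fun l => (t l).relabel (Prod.map f id))
      fun i => (e'.onTerm (δ n i)).relabel (Prod.map (fun y => f y.1) id))
  have hΘ : ∀ (Q : Type u) [Χ.L.Structure Q] (v : J × ℕ → Q), Θ.Realize v ↔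
      ((e'.comp e₁).onFormula (D.ψ n)).Realize (Sum.elim
        (fun l => (t l).realize fun y => v (f y.1, y.2))
        fun i => (e'.onTerm (δ n i)).realize fun y => v (f y.1, y.2)) := by
    intro Q _ v
    refine (realize_subst_formula _ _ _).trans (iff_of_eq (congrArg _ (funext fun y => ?_)))
    rcases y with y | y
    · exact Term.realize_relabel
    · exact Term.realize_relabel
  have hft : ∀ l {Q : Type u} [Χ.L.Structure Q] (v v' : J × ℕ → Q),
      (∀ y : I × ℕ, y.1 ∈ D.In n → v (f y.1, y.2) = v' (f y.1, y.2)) →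
      ((t l).realize fun y => v (f y.1, y.2)) = (t l).realize fun y => v' (f y.1, y.2) :=
    fun l Q _ v v' hv => term_realize_congr_of_support (t l) fun y hy => hv y (htn l y hy)
  obtain ⟨h, hh, hhw⟩ := IsLocal.exists_of_sameQf
    ((SameQf.of_embedding hf (Subtype.val : D.In (n + 1) → I)).symm.trans (hw j).sameQf)
  have hΘd : DependsOn Θ (Prod.fst ⁻¹' Set.range (f ∘ (Subtype.val : D.In (n + 1) → I))) := by
    intro Q _ v v' hv
    rw [hΘ, hΘ]
    refine iff_of_eq (congrArg _ (funext fun y => ?_))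
    rcases y with y | y
    · exact hft y v v' fun z hz => hv _ ⟨⟨z.1, D.mono n.le_succ hz⟩, rfl⟩
    · exact congrArg (fun v => Term.realize v (e'.onTerm (δ n y)))
        (funext fun z => hv _ ⟨z.1, rfl⟩)
  have hterm : ∀ i (v : D.In (n + 1) × ℕ → N), (e'.onTerm (δ n i)).realize v =
      (δ n i).realize v := fun i v => LHom.realize_onTerm e' _ _
  have hred : ∀ v : Fin D.k ⊕ Fin (D.r n) → N, ((e'.comp e₁).onFormula (D.ψ n)).Realize v ↔
    (D.ψ n).Realize v := fun v => realize_onFormula_reduct _ _ _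
  have key := (hc.realize_iff_of_isLocal hΧ hJ hc0 hh Θ hΘd).1 (by
    rw [hΘ, hred]
    refine (iff_of_eq (congrArg (Formula.Realize (D.ψ n)) (funext fun y => ?_))).1
      ((g₁.map_formula _ _).2 (hx' n))
    rcases y with y | y
    · change g (x y) = _
      rw [← ht]
      refine (HomClass.realize_term (F := M ↪ₑ[Χ.L] N) (g := g)).symm.trans ?_
      exact congrArg (fun v => Term.realize v (t y)) (funext fun z => hgb _)
    · exact (hdM n y).trans (hterm _ _).symm)
  rw [hΘ, hred] at key
  refine (iff_of_eq (congrArg (Formula.Realize (D.ψ n)) (funext fun y => ?_))).1 key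
  rcases y with y | y
  · change _ = g (x y)
    rw [← ht]
    refine Eq.trans ?_ (HomClass.realize_term (F := M ↪ₑ[Χ.L] N) (g := g))
    refine (hft y (fun z => entry c hc0 (h z.1, z.2)) (entry c hc0) fun z hz => ?_).trans
      (congrArg (fun v => Term.realize v (t y)) (funext fun z => (hgb z).symm))
    have h1 := hhw ⟨z.1, D.mono n.le_succ hz⟩
    have h2 := (hw j).eq_base ⟨z.1, hz⟩
    exact congrArg (fun i => entry c hc0 (i, z.2)) (h1.trans h2)
  · change Term.realize _ (e'.onTerm (δ n y)) = _
    rw [hterm]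
    exact congrArg (fun v => Term.realize v (δ n y))
      (funext fun z => congrArg (fun i => entry c hc0 (i, z.2)) (hhw z.1))

end UnsuperstableData

/-! ### Indiscernible types with parameters -/

section Blueprints

variable {τ : FirstOrder.Language.{u, u}} {K : IndexModel τ → Prop} {J : IndexModel τ}
  {L : FirstOrder.Language.{u, u}} {N₀ : Type u} [L.Structure N₀] {Γ : Type u}

/-- The action of a map of indices on the variables. -/
def move (h : J → J) : (J × ℕ) ⊕ Γ → (J × ℕ) ⊕ Γ := Sum.map (Prod.map h id) id

/-- The variables for entries of the skeleton, and for the parameters in `C`. -/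
def paramsIn (J : Type v) (C : Set Γ) : Set ((J × ℕ) ⊕ Γ) := {x | ∀ γ, x = Sum.inr γ → γ ∈ C}

theorem paramsIn_mono {C C' : Set Γ} (h : C ⊆ C') : paramsIn J C ⊆ paramsIn J C' :=
  fun _ hx γ hγ => h (hx γ hγ)

theorem move_image_paramsIn (h : J → J) (C : Set Γ) : move h '' paramsIn J C ⊆ paramsIn J C := by
  rintro _ ⟨x, hx, rfl⟩ γ hγ
  rcases x with x | γ'
  · exact (Sum.inl_ne_inr hγ).elim
  · exact Sum.inr.inj hγ ▸ hx γ' rfl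

/-- A complete type in the variables for the entries of a skeleton indexed by `J` and for the
parameters in `C`, which extends the type of the given skeleton `v₀`, and which is indiscernible:
invariant under the maps which preserve quantifier-free types of indices. -/
structure IsBlueprint (v₀ : J × ℕ → N₀) (C : Set Γ) (S : Set (L.Formula ((J × ℕ) ⊕ Γ))) :
    Prop where
  realized : ∃ (N : Type u) (_ : L.Structure N) (_ : Nonempty N) (v : (J × ℕ) ⊕ Γ → N),
    ∀ φ, φ ∈ S ↔ DependsOn φ (paramsIn J C) ∧ φ.Realize v
  base : ∀ φ : L.Formula (J × ℕ), φ.Realize v₀ → φ.relabel Sum.inl ∈ S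
  indiscernible : ∀ φ ∈ S, ∀ E : Set J, DependsOn φ (entriesOver Γ E) → ∀ h : J → J,
    IsLocal E h → φ.relabel (move h) ∈ S

namespace IsBlueprint

variable {v₀ : J × ℕ → N₀} {C C' : Set Γ} {S S' : Set (L.Formula ((J × ℕ) ⊕ Γ))}

theorem dependsOn (hS : IsBlueprint v₀ C S) {φ : L.Formula ((J × ℕ) ⊕ Γ)} (hφ : φ ∈ S) :
    DependsOn φ (paramsIn J C) := by
  obtain ⟨N, _, _, v, hv⟩ := hS.realized
  exact ((hv φ).1 hφ).1

theorem not_mem_iff (hS : IsBlueprint v₀ C S) {φ : L.Formula ((J × ℕ) ⊕ Γ)}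
    (hφ : DependsOn φ (paramsIn J C)) : φ.not ∈ S ↔ φ ∉ S := by
  obtain ⟨N, _, _, v, hv⟩ := hS.realized
  rw [hv, hv, Formula.realize_not, dependsOn_not_iff]
  simp [hφ]

/-- A structure realizing a blueprint satisfies exactly its formulas. -/
theorem mem_iff (hS : IsBlueprint v₀ C S) {N : Type u} [L.Structure N] {v : (J × ℕ) ⊕ Γ → N}
    (hv : ∀ φ ∈ S, φ.Realize v) {φ : L.Formula ((J × ℕ) ⊕ Γ)}
    (hφ : DependsOn φ (paramsIn J C)) : φ ∈ S ↔ φ.Realize v := by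
  refine ⟨hv φ, fun h => by_contra fun h' => ?_⟩
  exact (hv _ ((hS.not_mem_iff hφ).2 h')) h

theorem relabel_mem_iff (hS : IsBlueprint v₀ C S) {φ : L.Formula ((J × ℕ) ⊕ Γ)}
    (hφ : DependsOn φ (paramsIn J C)) {E : Set J} (hE : DependsOn φ (entriesOver Γ E))
    {h : J → J} (hh : IsLocal E h) : φ.relabel (move h) ∈ S ↔ φ ∈ S := by
  refine ⟨fun h' => by_contra fun h'' => ?_, fun h' => hS.indiscernible φ h' E hE h hh⟩
  have h1 := hS.indiscernible _ ((hS.not_mem_iff hφ).2 h'') E hE.not h hh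
  obtain ⟨N, _, _, v, hv⟩ := hS.realized
  have h2 := ((hv _).1 h1).2
  have h3 := ((hv _).1 h').2
  rw [Formula.realize_relabel] at h2 h3
  exact h2 h3

/-- The union of a directed system of blueprints is a blueprint. -/
theorem iUnion {ι : Type v} [Nonempty ι] {C : ι → Set Γ} {S : ι → Set (L.Formula ((J × ℕ) ⊕ Γ))}
    (h : ∀ i, IsBlueprint v₀ (C i) (S i))
    (hdir : ∀ i j, ∃ k, (C i ⊆ C k ∧ S i ⊆ S k) ∧ C j ⊆ C k ∧ S j ⊆ S k) :
    IsBlueprint v₀ (⋃ i, C i) (⋃ i, S i) := by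
  have hS : Directed (· ⊆ ·) S := fun i j => (hdir i j).imp fun k hk => ⟨hk.1.2, hk.2.2⟩
  have hC : Directed (· ⊆ ·) C := fun i j => (hdir i j).imp fun k hk => ⟨hk.1.1, hk.2.1⟩
  refine ⟨?_, fun φ hφ => ?_, fun φ hφ E hE g hg => ?_⟩
  · obtain ⟨N, _, _, v, hv⟩ := exists_realize_of_finite (⋃ i, S i) (by
      intro F hF hfin
      obtain ⟨i, hi⟩ := (hS.exists_mem_subset_of_finset_subset_biUnion
        (s := hfin.toFinset) (by simpa using hF))
      obtain ⟨N, _, _, v, hv⟩ := (h i).realized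
      exact ⟨N, inferInstance, inferInstance, v, fun φ hφ =>
        ((hv φ).1 (hi (by simpa using hφ))).2⟩)
    refine ⟨N, inferInstance, inferInstance, v, fun φ => ⟨fun hφ => ⟨?_, hv φ hφ⟩, ?_⟩⟩
    · obtain ⟨i, hi⟩ := Set.mem_iUnion.1 hφ
      exact ((h i).dependsOn hi).mono (paramsIn_mono (Set.subset_iUnion C i))
    · rintro ⟨hφ, hφv⟩
      obtain ⟨X, hX, hXφ⟩ := exists_dependsOn φ
      obtain ⟨i, hi⟩ : ∃ i, DependsOn φ (paramsIn J (C i)) := by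
        have hY := hXφ.inter hφ
        have hfin : {γ | Sum.inr γ ∈ X ∩ paramsIn J (⋃ i, C i)}.Finite :=
          (hX.inter_of_left _).preimage Sum.inr_injective.injOn
        obtain ⟨i, hi⟩ := hC.exists_mem_subset_of_finset_subset_biUnion
          (s := hfin.toFinset) (by
            intro γ hγ
            simp only [Set.Finite.coe_toFinset, Set.mem_ofPred_eq] at hγ
            exact hγ.2 γ rfl)
        refine ⟨i, hY.mono fun x hx γ hγ => hi ?_⟩
        subst hγ
        simpa using hx
      exact Set.mem_iUnion.2 ⟨i, ((h i).mem_iff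
        (fun ψ hψ => hv ψ (Set.mem_iUnion.2 ⟨i, hψ⟩)) hi).2 hφv⟩
  · exact Set.mem_iUnion.2 ⟨Classical.arbitrary ι, (h _).base φ hφ⟩
  · obtain ⟨i, hi⟩ := Set.mem_iUnion.1 hφ
    exact Set.mem_iUnion.2 ⟨i, (h i).indiscernible φ hi E hE g hg⟩

end IsBlueprint

theorem dependsOn_relabel_inl (φ : L.Formula (J × ℕ)) (C : Set Γ) :
    DependsOn (φ.relabel Sum.inl : L.Formula ((J × ℕ) ⊕ Γ)) (paramsIn J C) := by
  intro N _ v v' h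
  rw [Formula.realize_relabel, Formula.realize_relabel]
  exact iff_of_eq (congrArg _ (funext fun x => h _ fun γ hγ => (Sum.inl_ne_inr hγ).elim))

end Blueprints

section Template

variable {τ : FirstOrder.Language.{u, u}} {K : IndexModel τ → Prop} {J : IndexModel τ}
  {Φ : Template τ} {N₀ : Type u} [Φ.L.Structure N₀] {A : J → List N₀} {Γ : Type u}

/-- The complete type of a skeleton and of parameters named by constants is a blueprint. -/
theorem IsBlueprint.of_isGEM (hJ : K J) {Ψ : Template τ} (hΨ : Ψ.InUpsilon K)
    (i : paramLang Φ.L Γ →ᴸ Ψ.L) {P : Type u} [Ψ.L.Structure P] {a : J → List P}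
    (hGEM : IsGEM J Ψ P a) (ha : ∀ t, a t ≠ []) {v₀ : J × ℕ → N₀}
    (h₀ : ∀ φ : Φ.L.Formula (J × ℕ), φ.Realize v₀ →
      @Formula.Realize Φ.L P ((i.comp (paramIncl Φ.L Γ)).reduct P) _ φ (entry a ha)) (C : Set Γ) :
    IsBlueprint v₀ C {φ : Φ.L.Formula ((J × ℕ) ⊕ Γ) | DependsOn φ (paramsIn J C) ∧
      @Formula.Realize Φ.L P ((i.comp (paramIncl Φ.L Γ)).reduct P) _ φ
        (Sum.elim (entry a ha) (paramVal i P))} := by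
  let _ : Φ.L.Structure P := (i.comp (paramIncl Φ.L Γ)).reduct P
  have := hGEM.nonempty hΨ hJ
  refine ⟨⟨P, inferInstance, this, _, fun φ => Iff.rfl⟩, fun φ hφ => ?_, ?_⟩
  · refine ⟨dependsOn_relabel_inl φ C, ?_⟩
    rw [Formula.realize_relabel]
    exact h₀ φ hφ
  · rintro φ ⟨hφC, hφ⟩ E hE h hh
    refine ⟨(hφC.relabel _).mono (move_image_paramsIn h C), ?_⟩
    have h1 := hGEM.realize_iff_of_isLocal hΨ hJ ha hh (i.onFormula (paramFormula φ)) ?_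
    · rw [realize_onFormula_paramFormula, realize_onFormula_paramFormula] at h1
      rw [Formula.realize_relabel]
      refine (iff_of_eq (congrArg (Formula.Realize φ) (funext fun x => ?_))).1 (h1.1 hφ)
      rcases x with x | x <;> rfl
    · intro Q _ v v' hv
      rw [realize_onFormula_paramFormula, realize_onFormula_paramFormula]
      let _ : Φ.L.Structure Q := (i.comp (paramIncl Φ.L Γ)).reduct Q
      refine hE Q _ _ fun x hx => ?_
      rcases x with x | x
      · exact hv x (hx x rfl)
      · rfl

end Template

/-! ### Realizing non-shearing types by terms in the skeleton and new parameters -/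

section Step

variable {τ : FirstOrder.Language.{u, u}} {K : IndexModel τ → Prop} {J : IndexModel τ}
  {Φ : Template τ} {N₀ : Type u} [Φ.L.Structure N₀] {A : J → List N₀} {Γ : Type u}

theorem elim_comp_move {N : Type v} (v : J × ℕ → N) (c : Γ → N) (h : J → J) :
    Sum.elim v c ∘ move h = Sum.elim (fun x => v (h x.1, x.2)) c := by
  funext x
  rcases x with x | x <;> rfl

theorem realize_entry_congr (hJ : K J) (hΦ : Φ.InUpsilon K) (hA : IsGEM J Φ N₀ A)
    (hA0 : ∀ t, A t ≠ []) {φ : Φ.L.Formula (J × ℕ)} (hφ : φ.Realize (entry A hA0)) :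
    ∃ E : Set J, E.Finite ∧ DependsOn φ (Prod.fst ⁻¹' E) ∧ ∀ h : J → J, IsLocal E h →
      φ.Realize fun x => entry A hA0 (h x.1, x.2) := by
  obtain ⟨X, hX, hXφ⟩ := exists_dependsOn φ
  have hE : DependsOn φ (Prod.fst ⁻¹' (Prod.fst '' X)) :=
    hXφ.mono (Set.subset_preimage_image _ _)
  exact ⟨Prod.fst '' X, hX.image _, hE, fun h hh =>
    (hA.realize_iff_of_isLocal hΦ hJ hA0 hh φ hE).1 hφ⟩

/-- Parameters in an elementary extension of `GEM(J, Φ)` give a blueprint, containing the formulas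
which are satisfied throughout a quantifier-free type. -/
theorem exists_isBlueprint_of_params {lt : τ.Relations 2} (hK : IsIndexModelClass lt K)
    (hJ : IsAlephZeroSaturated K J) (hΦ : Φ.InUpsilon K)
    (hA : IsGEM J Φ N₀ A) (hA0 : ∀ t, A t ≠ [])
    {N : Type u} [Φ.L.Structure N] (g : N₀ ↪ₑ[Φ.L] N) (c : Γ → N) (C : Set Γ) :
    ∃ S : Set (Φ.L.Formula ((J × ℕ) ⊕ Γ)), IsBlueprint (entry A hA0) C S ∧
      ∀ φ : Φ.L.Formula ((J × ℕ) ⊕ Γ), DependsOn φ (paramsIn J C) → ∀ E : Set J, E.Finite →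
        DependsOn φ (entriesOver Γ E) →
        (∀ h : J → J, IsLocal E h →
          φ.Realize (Sum.elim (fun x => g (entry A hA0 x)) c ∘ move h)) → φ ∈ S := by
  obtain ⟨Ψ, i, hi, hΨ, hle, H⟩ := exists_le_params hK hJ hΦ hA hA0 g c
  obtain ⟨P, _, a, hGEM⟩ := hΨ.proper J hJ.mem
  obtain ⟨-, -, ha, H'⟩ := H P a hGEM
  refine ⟨_, .of_isGEM hJ.mem hΨ i hGEM ha (fun φ hφ => ?_) C, fun φ hφC E hE hφ hφE =>
    ⟨hφC, H' φ E hE hφ fun h hh => ?_⟩⟩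
  · obtain ⟨E, hE, hφE, hφh⟩ := realize_entry_congr hJ.mem hΦ hA hA0 hφ
    have h1 := H' (φ.relabel Sum.inl) E hE ?_ fun h hh => ?_
    · let _ : Φ.L.Structure P := (i.comp (paramIncl Φ.L Γ)).reduct P
      rw [Formula.realize_relabel] at h1
      exact h1
    · intro Q _ v v' hv
      rw [Formula.realize_relabel, Formula.realize_relabel]
      refine hφE Q _ _ fun x hx => hv _ fun y hy => ?_
      cases hy
      exact hx
    · rw [Formula.realize_relabel]
      exact (g.map_formula _ _).2 (hφh h hh)
  · have := hφE h hh
    rwa [elim_comp_move] at this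

theorem exists_isBlueprint_empty {lt : τ.Relations 2} (hK : IsIndexModelClass lt K)
    (hJ : IsAlephZeroSaturated K J) (hΦ : Φ.InUpsilon K)
    (hA : IsGEM J Φ N₀ A) (hA0 : ∀ t, A t ≠ []) :
    ∃ S : Set (Φ.L.Formula ((J × ℕ) ⊕ Γ)), IsBlueprint (entry A hA0) ∅ S := by
  have := hA.nonempty hΦ hJ.mem
  obtain ⟨S, hS, -⟩ := exists_isBlueprint_of_params hK hJ hΦ hA hA0
    (ElementaryEmbedding.refl Φ.L N₀) (fun _ : Γ => Classical.arbitrary N₀) ∅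
  exact ⟨S, hS⟩

/-- A family of formulas in one variable `x`, with parameters among the entries of the skeleton and
the elements of `Γ`, to be realized by a function of the part of the skeleton with indices in
`base`.  The indices occurring in the `i`-th formula are in `supp i`. -/
structure Scheme (J : IndexModel τ) (L : FirstOrder.Language.{u, u}) (Γ κ : Type u) where
  base : Finset J
  formula : κ → L.Formula (Unit ⊕ ((J × ℕ) ⊕ Γ))
  supp : κ → Finset J

/-- The scheme has parameters in `C` only, and all its conjugates over its base are jointly
finitely satisfiable in the structures realizing `S`. -/
structure Scheme.IsGood {L : FirstOrder.Language.{u, u}} {κ : Type u} (p : Scheme J L Γ κ)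
    (C : Set Γ) {N : Type u} [L.Structure N] (v : (J × ℕ) ⊕ Γ → N) : Prop where
  dependsOn : ∀ i, DependsOn (p.formula i)
    {x | ∀ y, x = Sum.inr y → y ∈ paramsIn J C ∩ entriesOver Γ (p.supp i)}
  satisfiable : ∀ F : Set (κ × (J → J)), F.Finite →
    (∀ x ∈ F, IsLocal (p.base ∪ p.supp x.1 : Set J) x.2 ∧ ∀ y ∈ p.base, x.2 y = y) →
    ∃ z : N, ∀ x ∈ F, (p.formula x.1).Realize (Sum.elim (fun _ => z) (v ∘ move x.2))

/-- The substitution of a term for the variable of a formula in one variable. -/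
def substTerm {L : FirstOrder.Language.{u, u}} {α : Type v} (φ : L.Formula (Unit ⊕ α))
    (t : L.Term α) : L.Formula α :=
  BoundedFormula.subst φ (Sum.elim (fun _ => t) Term.var)

theorem realize_substTerm {L : FirstOrder.Language.{u, u}} {α : Type v}
    (φ : L.Formula (Unit ⊕ α)) (t : L.Term α) {N : Type w} [L.Structure N] (v : α → N) :
    (substTerm φ t).Realize v ↔ φ.Realize (Sum.elim (fun _ => t.realize v) v) := by
  refine (realize_subst_formula _ _ _).trans (iff_of_eq (congrArg _ (funext fun x => ?_)))
  rcases x with x | x <;> rfl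

/-- The satisfiability of finitely many conjugates of a good scheme is preserved by conjugation, and
does not depend on the structure realizing `S`. -/
theorem Scheme.IsGood.exists_realize {lt : τ.Relations 2} (hK : IsIndexModelClass lt K)
    (hJ : IsAlephZeroSaturated K J) {L : FirstOrder.Language.{u, u}} {N₀ : Type u} [L.Structure N₀]
    {v₀ : J × ℕ → N₀} {κ : Type u} {p : Scheme J L Γ κ}
    {C : Set Γ} {S : Set (L.Formula ((J × ℕ) ⊕ Γ))} (hS : IsBlueprint v₀ C S)
    {N N' : Type u} [L.Structure N] [L.Structure N'] {v : (J × ℕ) ⊕ Γ → N}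
    {v' : (J × ℕ) ⊕ Γ → N'} (hv : ∀ φ ∈ S, φ.Realize v) (hv' : ∀ φ ∈ S, φ.Realize v')
    (hp : p.IsGood C v') {u : p.base → J} (F : Set (κ × (J → J)))
    (hF : F.Finite) (hFu : ∀ x ∈ F, IsLocal (p.base ∪ p.supp x.1 : Set J) x.2 ∧
      ∀ y : p.base, x.2 y = u y) (hu : SameQf (Subtype.val : p.base → J) u) :
    ∃ z : N, ∀ x ∈ F, (p.formula x.1).Realize (Sum.elim (fun _ => z) (v ∘ move x.2)) := by
  have hN : ∀ {Q : Type u} (_ : (J × ℕ) ⊕ Γ → Q), Nonempty Q := fun v =>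
    ⟨v (Sum.inl (Classical.choice J.nonempty, 0))⟩
  -- a map taking `u` back to the base
  obtain ⟨k₀, hk₀, hk₀u⟩ := IsLocal.exists_of_sameQf hu.symm
  let E : Set J := ⋃ x ∈ F, x.2 '' (p.base ∪ p.supp x.1 : Set J)
  have hE : E.Finite := hF.biUnion fun x _ =>
    ((p.base.finite_toSet.union (p.supp x.1).finite_toSet).image _)
  obtain ⟨k, hk, hkk⟩ := hk₀.exists_extend hK hJ.mem hJ (Set.finite_range u) hE
  have hku : ∀ y : p.base, k (u y) = y := fun y => (hkk _ ⟨y, rfl⟩).trans (hk₀u y)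
  have := hF.to_subtype
  obtain ⟨θ, hθ⟩ := exists_formula_ex (Formula.iInf fun x : F =>
    (p.formula x.1.1).relabel (Sum.elim Sum.inr (Sum.inl ∘ move x.1.2)))
  have hθ' : ∀ (Q : Type u) [L.Structure Q] (w : (J × ℕ) ⊕ Γ → Q), θ.Realize w ↔
      ∃ z : Q, ∀ x ∈ F, (p.formula x.1).Realize (Sum.elim (fun _ => z) (w ∘ move x.2)) := by
    intro Q _ w
    have := hN w
    rw [hθ]
    constructor
    · rintro ⟨y, hy⟩
      rw [Formula.realize_iInf] at hy
      refine ⟨y (), fun x hx => ?_⟩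
      have := hy ⟨x, hx⟩
      rw [Formula.realize_relabel] at this
      refine (iff_of_eq (congrArg _ (funext fun q => ?_))).1 this
      rcases q with q | q <;> rfl
    · rintro ⟨z, hz⟩
      refine ⟨fun _ => z, ?_⟩
      rw [Formula.realize_iInf]
      intro x
      rw [Formula.realize_relabel]
      refine (iff_of_eq (congrArg _ (funext fun q => ?_))).1 (hz x.1 x.2)
      rcases q with q | q <;> rfl
  have hθd : DependsOn θ (paramsIn J C ∩ entriesOver Γ E) := by
    intro Q _ w w' hww
    rw [hθ', hθ']
    refine exists_congr fun z => forall₂_congr fun x hx => hp.dependsOn x.1 Q _ _ fun q hq => ?_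
    rcases q with q | q
    · rfl
    · have hq' := hq q rfl
      refine hww _ ⟨move_image_paramsIn x.2 C ⟨q, hq'.1, rfl⟩, fun y hy => ?_⟩
      rcases q with q | q
      · obtain rfl := Sum.inl.inj hy
        exact Set.mem_biUnion hx ⟨q.1, Or.inr (hq'.2 q rfl), rfl⟩
      · exact (Sum.inr_ne_inl hy).elim
  have hθC := hθd.mono Set.inter_subset_left
  have hθE := hθd.mono Set.inter_subset_right
  refine (hθ' N v).1 (hv θ ?_)
  rw [← hS.relabel_mem_iff hθC hθE (hk.mono Set.subset_union_right),
    hS.mem_iff hv' ((hθC.relabel _).mono (move_image_paramsIn k C)), Formula.realize_relabel, hθ']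
  obtain ⟨z, hz⟩ := hp.satisfiable ((fun x => (x.1, k ∘ x.2)) '' F) (hF.image _) (by
    rintro _ ⟨x, hx, rfl⟩
    refine ⟨(hFu x hx).1.comp (hk.mono fun y hy => Or.inr (Set.mem_biUnion hx hy)), fun y hy => ?_⟩
    exact (congrArg k ((hFu x hx).2 ⟨y, hy⟩)).trans (hku ⟨y, hy⟩))
  refine ⟨z, fun x hx => ?_⟩
  refine (iff_of_eq (congrArg _ ?_)).1 (hz (x.1, k ∘ x.2) ⟨x, hx, rfl⟩)
  refine congrArg _ (funext fun q => ?_)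
  rcases q with q | q <;> rfl

theorem exists_dependsOn_entriesOver {L : FirstOrder.Language.{u, u}}
    (φ : L.Formula ((J × ℕ) ⊕ Γ)) :
    ∃ E : Set J, E.Finite ∧ DependsOn φ (entriesOver Γ E) := by
  obtain ⟨X, hX, hXφ⟩ := exists_dependsOn φ
  refine ⟨Prod.fst '' (Sum.inl ⁻¹' X), (hX.preimage Sum.inl_injective.injOn).image _,
    hXφ.mono fun x hx y hy => ?_⟩
  subst hy
  exact ⟨y, hx, rfl⟩

theorem IsBlueprint.exists_elementaryEmbedding {L : FirstOrder.Language.{u, u}} {N₀ : Type u}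
    [L.Structure N₀] {v₀ : J × ℕ → N₀} (hgen : Substructure.closure L (Set.range v₀) = ⊤)
    {C : Set Γ} {S : Set (L.Formula ((J × ℕ) ⊕ Γ))} (hS : IsBlueprint v₀ C S) {N : Type u}
    [L.Structure N] {v : (J × ℕ) ⊕ Γ → N} (hv : ∀ φ ∈ S, φ.Realize v) :
    ∃ g : N₀ ↪ₑ[L] N, ∀ x, g (v₀ x) = v (Sum.inl x) := by
  refine exists_elementaryEmbedding_of_realize_iff (v' := fun x => v (Sum.inl x)) hgen fun φ => ?_
  have h1 : ∀ ψ : L.Formula (J × ℕ), ψ.Realize v₀ → ψ.Realize fun x => v (Sum.inl x) :=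
    fun ψ hψ => Formula.realize_relabel.1 (hv _ (hS.base ψ hψ))
  exact ⟨h1 φ, fun h => by_contra fun h' => h1 φ.not h' h⟩

/-- The inductive step: a blueprint over `C` is extended to one over `C'`, in such a way that each
new parameter `γ` codes the realizations of the scheme `p γ` and of its conjugates. -/
theorem IsBlueprint.exists_step {lt : τ.Relations 2} (hK : IsIndexModelClass lt K)
    (hJ : IsAlephZeroSaturated K J) (hΦ : Φ.InUpsilon K) (α : appLang.{u} →ᴸ Φ.L)
    (hα : α.onSentence appAxiom ∈ Φ.theory K) (hA : IsGEM J Φ N₀ A) (hA0 : ∀ t, A t ≠ [])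
    {κ : Type u} (p : Γ → Scheme J Φ.L Γ κ) {C C' : Set Γ} (hC : C ⊆ C')
    {S : Set (Φ.L.Formula ((J × ℕ) ⊕ Γ))} (hS : IsBlueprint (entry A hA0) C S) :
    ∃ S', IsBlueprint (entry A hA0) C' S' ∧ S ⊆ S' ∧ ∀ γ ∈ C' \ C,
      (∃ (N : Type u) (_ : Φ.L.Structure N) (v : (J × ℕ) ⊕ Γ → N),
        (∀ φ ∈ S, φ.Realize v) ∧ (p γ).IsGood C v) →
      ∃ T : Φ.L.Term (((p γ).base × ℕ) ⊕ Γ), ∀ i, substTerm ((p γ).formula i)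
        (T.relabel (Sum.map (Prod.map Subtype.val id) id)) ∈ S' := by
  classical
  obtain ⟨N, _, _, v, hv⟩ := hS.realized
  replace hv : ∀ φ ∈ S, φ.Realize v := fun φ hφ => ((hv φ).1 hφ).2
  obtain ⟨g₀, hg₀⟩ := hS.exists_elementaryEmbedding (by
    rw [range_entry]
    exact hA.generates) hv
  -- realizations of the conjugates of each good scheme with a given base
  let X : Set (Σ γ : Γ, ((p γ).base → J) × (κ × (J → J))) := {x |
    (∃ (N : Type u) (_ : Φ.L.Structure N) (v : (J × ℕ) ⊕ Γ → N),
      (∀ φ ∈ S, φ.Realize v) ∧ (p x.1).IsGood C v) ∧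
    SameQf (Subtype.val : (p x.1).base → J) x.2.1 ∧
    IsLocal ((p x.1).base ∪ (p x.1).supp x.2.2.1 : Set J) x.2.2.2 ∧
    ∀ y : (p x.1).base, x.2.2.2 y = x.2.1 y}
  let F : (Σ γ : Γ, ((p γ).base → J) × (κ × (J → J))) →
      Φ.L.Formula (N ⊕ (Σ γ : Γ, ((p γ).base → J))) := fun x =>
    ((p x.1).formula x.2.2.1).relabel
      (Sum.elim (fun _ => Sum.inr ⟨x.1, x.2.1⟩) fun q => Sum.inl (v (move x.2.2.2 q)))
  have hF : ∀ x (Q : Type u) [Φ.L.Structure Q] (g : N → Q) (z : (Σ γ : Γ, ((p γ).base → J)) → Q),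
      (F x).Realize (Sum.elim g z) ↔ ((p x.1).formula x.2.2.1).Realize
        (Sum.elim (fun _ => z ⟨x.1, x.2.1⟩) (g ∘ v ∘ move x.2.2.2)) := by
    intro x Q _ g z
    refine Formula.realize_relabel.trans (iff_of_eq (congrArg _ (funext fun q => ?_)))
    rcases q with q | q <;> rfl
  obtain ⟨N₁, _, _, g₁, z, hz⟩ := exists_elementary_extension (F '' X) (by
    intro G hG hGfin
    obtain ⟨Δ, hΔ, hΔfin, rfl⟩ := Set.exists_subset_image_finite_and.1 ⟨G, hG, hGfin, rfl⟩
    have hex : ∀ y : (Σ γ : Γ, ((p γ).base → J)), ∃ z : N, ∀ x : κ × (J → J),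
        (⟨y.1, y.2, x⟩ : Σ γ : Γ, ((p γ).base → J) × (κ × (J → J))) ∈ Δ →
        ((p y.1).formula x.1).Realize (Sum.elim (fun _ => z) (v ∘ move x.2)) := by
      intro y
      let Fy : Set (κ × (J → J)) :=
        {x | (⟨y.1, y.2, x⟩ : Σ γ : Γ, ((p γ).base → J) × (κ × (J → J))) ∈ Δ}
      by_cases hne : Fy.Nonempty
      · obtain ⟨x₀, hx₀⟩ := hne
        obtain ⟨⟨N', _, v', hv', hgood⟩, hu, -⟩ := hΔ hx₀
        exact hgood.exists_realize hK hJ hS hv hv' Fy (hΔfin.preimage (by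
          intro a _ b _ hab
          simpa using hab)) (fun x hx => (hΔ hx).2.2) hu
      · exact ⟨Classical.arbitrary N, fun x hx => (hne ⟨x, hx⟩).elim⟩
    choose z hz using hex
    refine ⟨z, ?_⟩
    rintro _ ⟨x, hx, rfl⟩
    exact (hF x N id z).2 (hz ⟨x.1, x.2.1⟩ x.2.2 hx))
  have hz' : ∀ x ∈ X, ((p x.1).formula x.2.2.1).Realize
      (Sum.elim (fun _ => z ⟨x.1, x.2.1⟩) (g₁ ∘ v ∘ move x.2.2.2)) := fun x hx =>
    (hF x N₁ g₁ z).1 (hz _ ⟨x, hx, rfl⟩)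
  obtain ⟨N₂, _, _, g₂, c, T, hT⟩ := exists_coding_skeleton hJ.mem hΦ α hA hA0
    (hα J N₀ A hJ.mem hA) (g₁.comp g₀) (ι := fun γ => (p γ).base) (fun γ => Subtype.val)
    fun γ u => z ⟨γ, u⟩
  let c₂ : Γ → N₂ := fun γ => if γ ∈ C then g₂ (g₁ (v (Sum.inr γ))) else c γ
  have hv₂ : ∀ (h : J → J), ∀ x ∈ paramsIn J C, (g₂ ∘ g₁ ∘ v ∘ move h) x =
      (Sum.elim (fun x => (g₂.comp (g₁.comp g₀)) (entry A hA0 x)) c₂ ∘ move h) x := by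
    intro h x hx
    rcases x with x | γ
    · exact congrArg (fun y => g₂ (g₁ y)) (hg₀ _).symm
    · exact (if_pos (hx γ rfl)).symm
  obtain ⟨S', hS', hmem⟩ := exists_isBlueprint_of_params hK hJ hΦ hA hA0
    (g₂.comp (g₁.comp g₀)) c₂ C'
  refine ⟨S', hS', fun φ hφ => ?_, ?_⟩
  · obtain ⟨E, hE, hφE⟩ := exists_dependsOn_entriesOver φ
    refine hmem φ ((hS.dependsOn hφ).mono (paramsIn_mono hC)) E hE hφE fun h hh => ?_
    have h1 := hv _ (hS.indiscernible φ hφ E hφE h hh)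
    rw [Formula.realize_relabel] at h1
    exact (hS.dependsOn hφ N₂ _ _ (hv₂ h)).1
      ((g₂.map_formula _ _).2 ((g₁.map_formula _ _).2 h1))
  · rintro γ ⟨hγ, hγC⟩ hgood
    have hdep : ∀ i, DependsOn ((p γ).formula i)
        {x | ∀ y, x = Sum.inr y → y ∈ paramsIn J C ∩ entriesOver Γ ((p γ).supp i)} := by
      obtain ⟨N', _, v', -, h⟩ := hgood
      exact h.dependsOn
    refine ⟨(T γ).relabel (Sum.map id fun _ => γ), fun i => ?_⟩
    rw [Term.relabel_relabel]
    have hterm : ∀ {Q : Type u} [Φ.L.Structure Q] (w : (J × ℕ) ⊕ Γ → Q),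
        ((T γ).relabel (Sum.map (Prod.map Subtype.val id) id ∘ Sum.map id fun _ => γ)).realize w =
          (T γ).realize (Sum.elim (fun y => w (Sum.inl (y.1, y.2))) fun _ => w (Sum.inr γ)) := by
      intro Q _ w
      rw [Term.realize_relabel]
      refine congrArg (fun v => Term.realize v (T γ)) (funext fun q => ?_)
      rcases q with q | q <;> rfl
    have hd : DependsOn (substTerm ((p γ).formula i)
        ((T γ).relabel (Sum.map (Prod.map Subtype.val id) id ∘ Sum.map id fun _ => γ)))
        (paramsIn J C' ∩ entriesOver Γ ((p γ).base ∪ (p γ).supp i : Set J)) := by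
      intro Q _ w w' hww
      rw [realize_substTerm, realize_substTerm]
      refine hdep i Q _ _ fun q hq => ?_
      rcases q with q | q
      · change Term.realize w _ = Term.realize w' _
        rw [hterm, hterm]
        refine congrArg (fun v => Term.realize v (T γ)) (funext fun y => ?_)
        rcases y with y | y
        · refine hww _ ⟨fun γ' h => (Sum.inl_ne_inr h).elim, fun y' hy' => ?_⟩
          obtain rfl := Sum.inl.inj hy'
          exact Or.inl y.1.2
        · refine hww _ ⟨fun γ' h => ?_, fun y' hy' => (Sum.inr_ne_inl hy').elim⟩
          obtain rfl := Sum.inr.inj h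
          exact hγ
      · have hq' := hq q rfl
        exact hww q ⟨paramsIn_mono hC hq'.1, fun y hy => Or.inr (hq'.2 y hy)⟩
    refine hmem _ (hd.mono Set.inter_subset_left) _
      ((p γ).base.finite_toSet.union ((p γ).supp i).finite_toSet)
      (hd.mono Set.inter_subset_right) fun h hh => ?_
    rw [realize_substTerm]
    have hu : SameQf (Subtype.val : (p γ).base → J) fun y => h y :=
      hh.sameQf _ fun y => Or.inl y.2
    have h1 := (g₂.map_formula _ _).2 (hz' ⟨γ, fun y => h y, i, h⟩ ⟨hgood, hu, hh, fun y => rfl⟩)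
    refine (hdep i N₂ _ _ fun q hq => ?_).1 h1
    rcases q with q | q
    · change g₂ (z ⟨γ, fun y => h y⟩) = Term.realize _ _
      rw [hterm, ← hT γ _ hu]
      refine congrArg (fun v => Term.realize v (T γ)) (funext fun y => ?_)
      rcases y with y | y
      · rfl
      · exact (if_neg hγC).symm
    · exact hv₂ h q (hq q rfl).1

end Step

/-! ### Iterating the realization of schemes along a well-order -/

section Chain

variable {τ : FirstOrder.Language.{u, u}} {K : IndexModel τ → Prop} {J : IndexModel τ}
  {Φ : Template τ} {N₀ : Type u} [Φ.L.Structure N₀] {A : J → List N₀}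

/-- With parameters indexed by `W × Θ` for a well-order `W`, there is a blueprint in which the
parameter `γ = (w, θ)` codes the realizations of the scheme `p γ`, provided that it is a good scheme
over the parameters of the levels below `w`. -/
theorem exists_isBlueprint_chain {lt : τ.Relations 2} (hK : IsIndexModelClass lt K)
    (hJ : IsAlephZeroSaturated K J) (hΦ : Φ.InUpsilon K) (α : appLang.{u} →ᴸ Φ.L)
    (hα : α.onSentence appAxiom ∈ Φ.theory K) (hA : IsGEM J Φ N₀ A) (hA0 : ∀ t, A t ≠ [])
    {W Θ κ : Type u} [LinearOrder W] [WellFoundedLT W]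
    (p : W × Θ → Scheme J Φ.L (W × Θ) κ) :
    ∃ S, IsBlueprint (entry A hA0) Set.univ S ∧ ∀ γ : W × Θ,
      (∃ (N : Type u) (_ : Φ.L.Structure N) (v : (J × ℕ) ⊕ (W × Θ) → N),
        (∀ φ ∈ S, φ.Realize v) ∧ (p γ).IsGood {γ' | γ'.1 < γ.1} v) →
      ∃ T : Φ.L.Term (((p γ).base × ℕ) ⊕ (W × Θ)), ∀ i, substTerm ((p γ).formula i)
        (T.relabel (Sum.map (Prod.map Subtype.val id) id)) ∈ S := by
  classical
  let X := Set (Φ.L.Formula ((J × ℕ) ⊕ (W × Θ)))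
  obtain ⟨S₀, hS₀⟩ : ∃ S : X, IsBlueprint (entry A hA0) ∅ S :=
    exists_isBlueprint_empty hK hJ hΦ hA hA0
  let P : W → X → X → Prop := fun w S S' =>
    IsBlueprint (entry A hA0) {γ | γ.1 ≤ w} S' ∧ S ⊆ S' ∧
      ∀ γ : W × Θ, γ ∈ {γ : W × Θ | γ.1 ≤ w} \ {γ | γ.1 < w} →
      (∃ (N : Type u) (_ : Φ.L.Structure N) (v : (J × ℕ) ⊕ (W × Θ) → N),
        (∀ φ ∈ S, φ.Realize v) ∧ (p γ).IsGood {γ | γ.1 < w} v) →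
      ∃ T : Φ.L.Term (((p γ).base × ℕ) ⊕ (W × Θ)), ∀ i, substTerm ((p γ).formula i)
        (T.relabel (Sum.map (Prod.map Subtype.val id) id)) ∈ S'
  let next : W → X → X := fun w S => if h : ∃ S', P w S S' then h.choose else ∅
  have hnext : ∀ w S, IsBlueprint (entry A hA0) {γ | γ.1 < w} S → P w S (next w S) := by
    intro w S hS
    have h : ∃ S', P w S S' :=
      hS.exists_step hK hJ hΦ α hα hA hA0 p fun γ hγ => (show γ.1 < w from hγ).le
    simp only [next, dif_pos h]
    exact h.choose_spec
  let Sf : W → X := wellFounded_lt.fix fun w rec => next w (S₀ ∪ ⋃ (w') (h : w' < w), rec w' h)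
  have hSf : ∀ w, Sf w = next w (S₀ ∪ ⋃ (w') (_ : w' < w), Sf w') := fun w =>
    wellFounded_lt.fix_eq _ w
  -- unions over initial segments
  have hunion : ∀ D : Set W, (∀ w ∈ D, IsBlueprint (entry A hA0) {γ | γ.1 ≤ w} (Sf w) ∧
      S₀ ∪ ⋃ (w') (_ : w' < w), Sf w' ⊆ Sf w) →
      IsBlueprint (entry A hA0) {γ | ∃ w ∈ D, γ.1 ≤ w} (S₀ ∪ ⋃ w ∈ D, Sf w) := by
    intro D hD
    have hmono : ∀ w ∈ D, ∀ w' ≤ w, Sf w' ⊆ Sf w := by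
      intro w hw w' hle
      rcases hle.lt_or_eq with hlt | rfl
      · exact (Set.subset_iUnion₂_of_subset w' hlt subset_rfl).trans
          (Set.subset_union_right.trans (hD w hw).2)
      · exact subset_rfl
    have h0 : ∀ w ∈ D, S₀ ⊆ Sf w := fun w hw => Set.subset_union_left.trans (hD w hw).2
    let C : Option D → Set (W × Θ) := fun o => o.elim ∅ fun w => {γ | γ.1 ≤ w.1}
    let S : Option D → X := fun o => o.elim S₀ fun w => Sf w
    have := IsBlueprint.iUnion (v₀ := entry A hA0) (C := C) (S := S) (by
      rintro (_ | w)
      · exact hS₀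
      · exact (hD w w.2).1) (by
      rintro (_ | w) (_ | w')
      · exact ⟨none, ⟨subset_rfl, subset_rfl⟩, subset_rfl, subset_rfl⟩
      · exact ⟨some w', ⟨Set.empty_subset _, h0 _ w'.2⟩, subset_rfl, subset_rfl⟩
      · exact ⟨some w, ⟨subset_rfl, subset_rfl⟩, Set.empty_subset _, h0 _ w.2⟩
      · rcases le_total w.1 w'.1 with h | h
        · exact ⟨some w', ⟨fun γ hγ => le_trans (show γ.1 ≤ w.1 from hγ) h, hmono _ w'.2 _ h⟩,
            subset_rfl, subset_rfl⟩
        · exact ⟨some w, ⟨subset_rfl, subset_rfl⟩,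
            fun γ hγ => le_trans (show γ.1 ≤ w'.1 from hγ) h, hmono _ w.2 _ h⟩)
    rw [Set.iUnion_option, Set.iUnion_option] at this
    convert this using 1
    · ext γ
      simp [C]
    · simp only [S, Option.elim_none, Option.elim_some]
      rw [Set.biUnion_eq_iUnion]
  have hP : ∀ w, IsBlueprint (entry A hA0) {γ | γ.1 < w} (S₀ ∪ ⋃ (w') (_ : w' < w), Sf w') ∧
      P w (S₀ ∪ ⋃ (w') (_ : w' < w), Sf w') (Sf w) := by
    intro w
    induction w using WellFoundedLT.induction with
    | ind w ih =>
      have h1 := hunion {w' | w' < w} fun w' hw' => ⟨(ih w' hw').2.1, (ih w' hw').2.2.1⟩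
      have h2 : {γ : W × Θ | ∃ w' ∈ {w' | w' < w}, γ.1 ≤ w'} = {γ | γ.1 < w} := by
        ext γ
        exact ⟨fun ⟨w', h, h'⟩ => lt_of_le_of_lt h' h, fun h => ⟨γ.1, h, le_rfl⟩⟩
      rw [h2] at h1
      refine ⟨h1, ?_⟩
      have h3 := hnext w _ h1
      rw [hSf w]
      exact h3
  have hfin := hunion Set.univ fun w _ => ⟨(hP w).2.1, (hP w).2.2.1⟩
  have h2 : {γ : W × Θ | ∃ w' ∈ Set.univ, γ.1 ≤ w'} = Set.univ :=
    Set.eq_univ_of_forall fun γ => ⟨γ.1, trivial, le_rfl⟩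
  rw [h2] at hfin
  refine ⟨_, hfin, fun γ ⟨N, _, v, hv, hgood⟩ => ?_⟩
  have hsub : Sf γ.1 ⊆ S₀ ∪ ⋃ w ∈ Set.univ, Sf w := fun φ hφ =>
    Or.inr (Set.mem_biUnion (Set.mem_univ γ.1) hφ)
  obtain ⟨T, hT⟩ := (hP γ.1).2.2.2 γ ⟨le_rfl, lt_irrefl γ.1⟩
    ⟨N, inferInstance, v, fun φ hφ => hv φ (hsub ((hP γ.1).2.2.1 hφ)), hgood⟩
  exact ⟨T, fun i => hsub (hT i)⟩

open Cardinal in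
/-- There are no more schemes than subsets of `κ`. -/
theorem mk_scheme_le {L : FirstOrder.Language.{u, u}} {κ Γ : Type u} [Infinite κ]
    (hL : L.card ≤ #κ) (hJ : #J ≤ #κ) (hΓ : #Γ ≤ 2 ^ #κ) : #(Scheme J L Γ κ) ≤ 2 ^ #κ := by
  have hκ : ℵ₀ ≤ #κ := aleph0_le_mk κ
  have hκ2 : ℵ₀ ≤ 2 ^ #κ := hκ.trans (cantor _).le
  have h1 : #(L.Formula (Unit ⊕ ((J × ℕ) ⊕ Γ))) ≤ 2 ^ #κ := by
    have h2 : #(L.Formula (Unit ⊕ ((J × ℕ) ⊕ Γ))) ≤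
        #(Σ n, L.BoundedFormula (Unit ⊕ ((J × ℕ) ⊕ Γ)) n) :=
      mk_le_of_injective (f := fun φ => ⟨0, φ⟩) fun φ ψ h => by simpa using h
    refine h2.trans (BoundedFormula.card_le.trans (max_le hκ2 ?_))
    refine add_le_of_le hκ2 ?_ ?_
    · have hJ2 : #J ≤ 2 ^ #κ := hJ.trans (cantor _).le
      have h1 : (1 : Cardinal.{u}) ≤ 2 ^ #κ := one_le_aleph0.trans hκ2
      simp only [mk_sum, mk_prod, lift_uzero, lift_id, mk_fintype, Fintype.card_unit, Nat.cast_one,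
        lift_one, mk_nat, lift_aleph0]
      exact add_le_of_le hκ2 h1 (add_le_of_le hκ2 (mul_le_of_le hκ2 hJ2 hκ2) hΓ)
    · simpa using hL.trans (cantor _).le
  have h3 : #(Finset J) ≤ 2 ^ #κ := by
    rcases finite_or_infinite J with h | h
    · exact (lt_aleph0_of_finite _).le.trans hκ2
    · rw [mk_finset_of_infinite]
      exact hJ.trans (cantor _).le
  have h4 : ∀ c : Cardinal.{u}, c ≤ 2 ^ #κ → c ^ #κ ≤ 2 ^ #κ := fun c hc =>
    (power_le_power_right hc).trans (by rw [← power_mul, mul_eq_self hκ])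
  have hinj : Function.Injective fun p : Scheme J L Γ κ => (p.base, p.formula, p.supp) := by
    rintro ⟨a, b, c⟩ ⟨a', b', c'⟩ h
    simpa using h
  refine (mk_le_of_injective hinj).trans ?_
  simp only [mk_prod, lift_id]
  refine mul_le_of_le hκ2 h3 (mul_le_of_le hκ2 ?_ ?_)
  · rw [← power_def]
    exact h4 _ h1
  · rw [← power_def]
    exact h4 _ h3

end Chain

/-! ### Reducts of templates -/

section Reduct

variable {τ : FirstOrder.Language.{u, u}} {K : IndexModel τ → Prop}

theorem _root_.FirstOrder.Language.BoundedFormula.IsQF.onBoundedFormula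
    {L L' : FirstOrder.Language.{u, u}} (e : L →ᴸ L') {α : Type v} {n : ℕ}
    {φ : L.BoundedFormula α n} (h : φ.IsQF) : (e.onBoundedFormula φ).IsQF := by
  induction h with
  | falsum => exact BoundedFormula.IsQF.falsum
  | of_isAtomic hA =>
    cases hA with
    | equal t₁ t₂ => exact (BoundedFormula.IsAtomic.equal _ _).isQF
    | rel R ts => exact (BoundedFormula.IsAtomic.rel _ _).isQF
  | imp _ _ h₁ h₂ => exact h₁.imp h₂

theorem qftp_map_embedding {L : FirstOrder.Language.{u, u}} {N N' : Type u}
    [L.Structure N] [L.Structure N'] (g : N ↪[L] N') (l : List N) :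
    qftp L (l.map g) = qftp L l := by
  ext ⟨m, φ⟩
  refine and_congr_left fun hφ => ?_
  have h1 := mem_tp_map_iff l g φ
  have h2 := mem_tp_map_iff l id φ
  rw [List.map_id] at h2
  rw [h1, h2]
  refine exists_congr fun hm => ?_
  have h3 := BoundedFormula.IsQF.realize_embedding hφ g
    (v := fun i => l.get (i.cast hm.symm)) (xs := default)
  unfold Formula.Realize
  refine Iff.trans (iff_of_eq (congrArg _ (Subsingleton.elim _ _))) h3

theorem tp_reduct_congr {L L' : FirstOrder.Language.{u, u}} (e : L →ᴸ L') {N N' : Type u}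
    [L'.Structure N] [L'.Structure N'] {l : List N} {l' : List N'} (h : tp L' l = tp L' l') :
    @tp L N (e.reduct N) l = @tp L N' (e.reduct N') l' := by
  ext ⟨m, φ⟩
  have h3 := Set.ext_iff.1 h ⟨m, e.onFormula φ⟩
  simp only [tp, Set.mem_ofPred_eq, realize_onFormula_reduct] at h3
  exact h3

/-- The skolemization of the formula `∃ y, φ(x̄, y)` by the function symbol `F`, as a sentence. -/
theorem exists_skolemSentence {L : FirstOrder.Language.{u, u}} {n : ℕ}
    (φ : L.BoundedFormula Empty (n + 1)) (F : L.Functions n) :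
    ∃ σ : L.Sentence, ∀ (N : Type u) [L.Structure N] [Nonempty N], N ⊨ σ ↔ ∀ x : Fin n → N,
      (∃ y : N, φ.Realize default (Fin.snoc x y : Fin (n + 1) → N)) →
      φ.Realize default (Fin.snoc x (Structure.funMap F x) : Fin (n + 1) → N) := by
  let ψ : L.Formula (Fin (n + 1)) := φ.toFormula.relabel (Sum.elim Empty.elim id)
  have hψ : ∀ (N : Type u) [L.Structure N] (x : Fin (n + 1) → N),
      ψ.Realize x ↔ φ.Realize default x := fun N _ x => by
    unfold ψ
    rw [Formula.realize_relabel, BoundedFormula.realize_toFormula]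
    refine iff_of_eq (congrArg₂ _ (Subsingleton.elim _ _) ?_)
    rfl
  obtain ⟨θ, hθ⟩ := exists_formula_ex (α := Fin n) (β := Unit)
    (ψ.relabel (Fin.snoc (fun i => Sum.inl i) (Sum.inr ()) : Fin (n + 1) → Fin n ⊕ Unit))
  let χ : L.Formula (Fin n) := BoundedFormula.subst ψ
    (Fin.snoc (fun i => Term.var i) (Term.func F fun i => Term.var i) :
      Fin (n + 1) → L.Term (Fin n))
  refine ⟨Formula.iAlls (α := Empty) (Fin n) ((θ.imp χ).relabel Sum.inr), fun N _ _ => ?_⟩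
  unfold Sentence.Realize
  rw [Formula.realize_iAlls]
  refine forall_congr' fun x => ?_
  rw [Formula.realize_relabel]
  have h0 : (Sum.elim (default : Empty → N) x ∘ Sum.inr : Fin n → N) = x := rfl
  rw [show (fun a => Sum.elim (default : Empty → N) x a) ∘ Sum.inr = x from rfl,
    Formula.realize_imp, hθ]
  refine imp_congr ⟨?_, ?_⟩ ?_
  · rintro ⟨y, hy⟩
    rw [Formula.realize_relabel, hψ] at hy
    refine ⟨y (), (iff_of_eq (congrArg _ (funext fun i => ?_))).1 hy⟩
    refine Fin.lastCases ?_ (fun i => ?_) i <;> simp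
  · rintro ⟨y, hy⟩
    refine ⟨fun _ => y, ?_⟩
    rw [Formula.realize_relabel, hψ]
    refine (iff_of_eq (congrArg _ (funext fun i => ?_))).1 hy
    refine Fin.lastCases ?_ (fun i => ?_) i <;> simp
  · unfold χ
    rw [realize_subst_formula, hψ]
    refine (iff_of_eq (congrArg _ (funext fun i => ?_)))
    refine Fin.lastCases ?_ (fun i => ?_) i <;> simp

namespace Template

/-- The reduct of a template `Χ` to a smaller signature. -/
abbrev reduct (Χ : Template τ) {L : FirstOrder.Language.{u, u}} (e : L →ᴸ Χ.L) : Template τ where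
  L := L
  map X := {φ | BoundedFormula.IsQF φ.2 ∧
    (⟨φ.1, e.onFormula φ.2⟩ : Σ m : ℕ, Χ.L.Formula (Fin m)) ∈ Χ.map X}

section

variable {Χ : Template τ} {L : FirstOrder.Language.{u, u}} {e : L →ᴸ Χ.L}

theorem IsGEM.qftp_reduct {I : IndexModel τ} {N : Type u} [Χ.L.Structure N] {b : I → List N}
    (hb : IsGEM I Χ N b) (l : List I) :
    @qftp L N (e.reduct N) (l.flatMap b) = (Χ.reduct e).map (I.qfType l) := by
  ext ⟨m, φ⟩
  change _ ↔ BoundedFormula.IsQF φ ∧ _ ∈ Χ.map _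
  rw [← hb.qftp_eq]
  simp only [qftp, tp, Set.mem_ofPred_eq, realize_onFormula_reduct]
  exact ⟨fun h => ⟨h.2, h.1, BoundedFormula.IsQF.onBoundedFormula e h.2⟩,
    fun h => ⟨h.2.1, h.1⟩⟩

/-- The symbol `F` of the reduct is a Skolem function for `φ` in the models `GEM(I, Χ)`. -/
def IsSkolemSymbol (K : IndexModel τ → Prop) (Χ : Template τ) (e : L →ᴸ Χ.L) {n : ℕ}
    (φ : L.BoundedFormula Empty (n + 1)) (F : L.Functions n) : Prop :=
  ∀ (I : IndexModel τ) (N : Type u) [Χ.L.Structure N] (b : I → List N), K I → IsGEM I Χ N b →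
    let _ : L.Structure N := e.reduct N
    ∀ x : Fin n → N, (∃ y : N, φ.Realize default (Fin.snoc x y : Fin (n + 1) → N)) →
      φ.Realize default (Fin.snoc x (Structure.funMap F x) : Fin (n + 1) → N)

/-- A generated model of the reduct of the template is an elementary submodel of the reduct of the
model of the template, by the Tarski–Vaught test. -/
theorem exists_elementaryEmbedding_reduct (hΧ : Χ.InUpsilon K)
    (hS : ∀ (n : ℕ) (φ : L.BoundedFormula Empty (n + 1)), ∃ F, IsSkolemSymbol K Χ e φ F)
    {I : IndexModel τ} (hI : K I) {N : Type u} [L.Structure N] {a : I → List N}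
    (ha : IsGEM I (Χ.reduct e) N a) {N' : Type u} [Χ.L.Structure N'] {b : I → List N'}
    (hb : IsGEM I Χ N' b) :
    let _ : L.Structure N' := e.reduct N'
    ∃ g : N ↪ₑ[L] N', ∀ t, (a t).map g = b t := by
  let _ : L.Structure N' := e.reduct N'
  have hq : ∀ l : List I, qftp L (l.flatMap a) = qftp L (l.flatMap b) := fun l => by
    rw [hb.qftp_reduct (e := e)]
    exact ha.qftp_eq l
  have hb0 := (hΧ.nontrivial I N' b hI hb).1
  have ha0 := ne_nil_of_length_eq hb0 (a' := a) fun t => by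
    simpa using (length_eq_of_qftp_eq (hq [t])).symm
  obtain ⟨g, hg⟩ := exists_embedding_of_qftp_eq ha0 ha.generates hq
  refine ⟨⟨g, fun {_} => g.isElementary_of_exists fun n φ x y hy => ?_⟩, hg⟩
  obtain ⟨F, hF⟩ := hS n φ
  refine ⟨Structure.funMap F x, ?_⟩
  rw [g.map_fun]
  exact hF I N' b hI hb _ ⟨y, hy⟩

theorem exists_isGEM_reduct {I : IndexModel τ} {N : Type u} [Χ.L.Structure N] {b : I → List N}
    (hb : IsGEM I Χ N b) :
    ∃ (P : Type u) (_ : L.Structure P) (a : I → List P), IsGEM I (Χ.reduct e) P a := by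
  let _ : L.Structure N := e.reduct N
  let S := Substructure.closure L {x : N | ∃ t, x ∈ b t}
  let a : I → List S := fun t =>
    (b t).attach.map fun x => ⟨x.1, Substructure.subset_closure ⟨t, x.2⟩⟩
  have ha : ∀ t, (a t).map S.subtype = b t := fun t => by
    unfold a
    rw [List.map_map]
    exact List.attach_map_subtype_val _
  refine ⟨S, inferInstance, a, fun l => ?_, ?_⟩
  · refine Eq.trans ?_ (hb.qftp_reduct (e := e) l)
    refine (qftp_map_embedding S.subtype _).symm.trans ?_
    have := flatMap_map_map (f := id) ha l
    rw [List.map_id] at this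
    rw [this]
  · have h1 : S.subtype '' {x : S | ∃ t, x ∈ a t} = {x : N | ∃ t, x ∈ b t} := by
      ext x
      constructor
      · rintro ⟨y, ⟨t, ht⟩, rfl⟩
        exact ⟨t, ha t ▸ List.mem_map_of_mem ht⟩
      · rintro ⟨t, ht⟩
        rw [← ha t, List.mem_map] at ht
        obtain ⟨y, hy, rfl⟩ := ht
        exact ⟨y, ⟨t, hy⟩, rfl⟩
    refine eq_top_iff.2 fun x _ => ?_
    have h2 : (x : N) ∈ (Substructure.closure L {x : S | ∃ t, x ∈ a t}).map S.subtype.toHom := by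
      rw [Substructure.map_closure]
      have h3 : (S.subtype.toHom : S → N) '' {x : S | ∃ t, x ∈ a t} = _ := h1
      rw [h3]
      exact x.2
    obtain ⟨y, hy, hyx⟩ := h2
    obtain rfl : y = x := Subtype.ext hyx
    exact hy

theorem mem_theory_reduct_iff (hΧ : Χ.InUpsilon K)
    (hS : ∀ (n : ℕ) (φ : L.BoundedFormula Empty (n + 1)), ∃ F, IsSkolemSymbol K Χ e φ F)
    {φ : L.Sentence} : φ ∈ (Χ.reduct e).theory K ↔ e.onSentence φ ∈ Χ.theory K := by
  constructor
  · intro h I N _ b hI hb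
    obtain ⟨P, _, a, ha⟩ := exists_isGEM_reduct (e := e) hb
    obtain ⟨g, -⟩ := exists_elementaryEmbedding_reduct hΧ hS hI ha hb
    rw [realize_onSentence_reduct]
    let _ : L.Structure N := e.reduct N
    exact (g.map_sentence φ).1 (h I P a hI ha)
  · intro h I P hP a hI ha
    let _ : L.Structure P := hP
    obtain ⟨N, _, b, hb⟩ := hΧ.proper I hI
    obtain ⟨g, -⟩ := exists_elementaryEmbedding_reduct hΧ hS hI ha hb
    have := h I N b hI hb
    rw [realize_onSentence_reduct] at this
    let _ : L.Structure N := e.reduct N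
    exact (g.map_sentence φ).2 this

/-- A reduct of a template in `Υ` belongs to `Υ` if it has Skolem functions. -/
theorem InUpsilon.reduct (hΧ : Χ.InUpsilon K) {J : IndexModel τ} (hJ : K J)
    (hS : ∀ (n : ℕ) (φ : L.BoundedFormula Empty (n + 1)), ∃ F, IsSkolemSymbol K Χ e φ F) :
    (Χ.reduct e).InUpsilon K := by
  have hnt : ∀ (I : IndexModel τ) (N : Type u) [L.Structure N] (a : I → List N),
      K I → IsGEM I (Χ.reduct e) N a → (∀ t, a t ≠ []) ∧ Function.Injective a := by
    intro I N _ a hI ha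
    obtain ⟨N', _, b, hb⟩ := hΧ.proper I hI
    obtain ⟨g, hg⟩ := exists_elementaryEmbedding_reduct hΧ hS hI ha hb
    obtain ⟨h1, h2⟩ := hΧ.nontrivial I N' b hI hb
    refine ⟨fun t h => h1 t (by rw [← hg, h, List.map_nil]), fun s t h => h2 ?_⟩
    rw [← hg, ← hg, h]
  have htp : ∀ (I I' : IndexModel τ) (f : I → I'), K I → K I' → IsEmbedding I I' f →
      ∀ (M : Type u) [L.Structure M] (a : I → List M) (N : Type u) [L.Structure N]
        (b : I' → List N), IsGEM I (Χ.reduct e) M a → IsGEM I' (Χ.reduct e) N b →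
        ∃ g : M ↪ₑ[L] N, ∀ t, (a t).map g = b (f t) := by
    intro I I' f hI hI' hf M _ a N _ b ha hb
    obtain ⟨M', _, a', ha'⟩ := hΧ.proper I hI
    obtain ⟨N', _, b', hb'⟩ := hΧ.proper I' hI'
    obtain ⟨g, hg⟩ := exists_elementaryEmbedding_reduct hΧ hS hI ha ha'
    obtain ⟨h, hh⟩ := exists_elementaryEmbedding_reduct hΧ hS hI' hb hb'
    obtain ⟨r, hr⟩ := hΧ.elementary I I' f hI hI' hf M' a' N' b' ha' hb'
    let _ : L.Structure M' := e.reduct M'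
    let _ : L.Structure N' := e.reduct N'
    refine exists_elementaryEmbedding_of_tp_eq (a' := b ∘ f) (hnt I M a hI ha).1 ha.generates
      fun l => ?_
    have h1 := flatMap_map_map (f := id) hg l
    have h2 := flatMap_map_map (f := id) hh (l.map f)
    have h3 := flatMap_map_map hr l
    rw [List.map_id] at h1 h2
    have h4 : l.flatMap (b ∘ f) = (l.map f).flatMap b := by rw [List.flatMap_map]; rfl
    rw [h4, ← tp_map_elementaryEmbedding g, ← tp_map_elementaryEmbedding h, ← h1, ← h2, h3]
    exact (tp_reduct_congr e (tp_map_elementaryEmbedding r _)).symm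
  refine ⟨fun I hI => ?_, hnt, fun n φ => ?_, ⟨?_, fun φ => ?_⟩, ?_, htp, ?_⟩
  · obtain ⟨N, _, b, hb⟩ := hΧ.proper I hI
    exact exists_isGEM_reduct hb
  · obtain ⟨F, hF⟩ := hS n φ
    obtain ⟨σ, hσ⟩ := exists_skolemSentence φ F
    have hσ' : σ ∈ (Χ.reduct e).theory K := by
      refine (mem_theory_reduct_iff hΧ hS).2 fun I N _ b hI hb => ?_
      rw [realize_onSentence_reduct]
      let _ : L.Structure N := e.reduct N
      have := hb.nonempty hΧ hI
      exact (hσ N).2 (hF I N b hI hb)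
    refine ⟨F, fun M hM _ hMT x hx => ?_⟩
    let _ : L.Structure M := hM
    rw [LHom.id_onBoundedFormula] at hx ⊢
    exact (hσ M).1 (hMT.realize_of_mem σ hσ') x hx
  · obtain ⟨N, _, b, hb⟩ := hΧ.proper J hJ
    obtain ⟨P, _, a, ha⟩ := exists_isGEM_reduct (e := e) hb
    have : Nonempty P := by
      obtain ⟨t⟩ := J.nonempty
      exact ⟨(a t).head ((hnt J P a hJ ha).1 t)⟩
    have : P ⊨ (Χ.reduct e).theory K := ha.models hJ
    exact Theory.Model.isSatisfiable P
  · obtain ⟨N, _, b, hb⟩ := hΧ.proper J hJ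
    by_cases h : N ⊨ e.onSentence φ
    · refine Or.inl (Theory.models_sentence_of_mem ?_)
      exact (mem_theory_reduct_iff hΧ hS).2 (mem_theory_of_realize hΧ hJ hb h)
    · refine Or.inr (Theory.models_sentence_of_mem ?_)
      refine (mem_theory_reduct_iff hΧ hS).2 (mem_theory_of_realize hΧ hJ hb ?_)
      exact (Sentence.realize_not N).2 h
  · intro I N hN a hI ha s t hst
    let _ : L.Structure N := hN
    obtain ⟨N', _, b, hb⟩ := hΧ.proper I hI
    obtain ⟨g, hg⟩ := exists_elementaryEmbedding_reduct hΧ hS hI ha hb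
    let _ : L.Structure N' := e.reduct N'
    have h1 := flatMap_map_map (f := id) hg
    simp only [List.map_id] at h1
    change tp L _ = tp L _
    rw [← tp_map_elementaryEmbedding g, ← tp_map_elementaryEmbedding g, ← h1, ← h1]
    exact tp_reduct_congr e (hΧ.indiscernible I N' b hI hb s t hst)
  · intro I hI M hM a N hN b ha hb
    let _ : L.Structure M := hM
    let _ : L.Structure N := hN
    obtain ⟨g, hg⟩ := htp I I id hI hI ⟨fun _ _ h => h,
      fun n F xs => (Part.map_id' (fun _ => rfl) _).symm,
      fun n R xs => Iff.rfl⟩ M a N b ha hb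
    have hsurj : Function.Surjective g := fun y => by
      have hy : y ∈ Substructure.closure L {x : N | ∃ t, x ∈ b t} := by
        have := hb.generates
        change Substructure.closure L _ = ⊤ at this
        rw [this]
        trivial
      have hle : Substructure.closure L {x : N | ∃ t, x ∈ b t} ≤ g.toEmbedding.toHom.range := by
        rw [Substructure.closure_le]
        rintro x ⟨t, ht⟩
        have ht' : x ∈ b (id t) := ht
        rw [← hg, List.mem_map] at ht'
        obtain ⟨z, -, rfl⟩ := ht'
        exact ⟨z, rfl⟩
      obtain ⟨z, hz⟩ := hle hy
      exact ⟨z, hz⟩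
    exact ⟨⟨Equiv.ofBijective g ⟨g.injective, hsurj⟩, fun F x => g.map_fun F x,
      fun R x => g.map_rel R x⟩⟩

end

end Template

end Reduct

/-! ### Eliminating the symbols for terms with parameters -/

section Collapse

variable {L : FirstOrder.Language.{u, u}} {Γ : Type u}

/-- A term of `paramLang L Γ`, as a term of `L` with parameters from `Γ`. -/
def collapseTerm {α : Type v} : (paramLang L Γ).Term α → L.Term (Γ ⊕ α)
  | .var x => .var (Sum.inr x)
  | .func (l := n) F ts =>
    Term.subst (show L.Term (Γ ⊕ Fin n) from F)
      (Sum.elim (fun γ => Term.var (Sum.inl γ)) fun i => collapseTerm (ts i))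

theorem realize_collapseTerm {N : Type w} [(paramLang L Γ).Structure N]
    (hN : IsCoherent (LHom.id (paramLang L Γ)) N) {α : Type v} (t : (paramLang L Γ).Term α)
    (v : α → N) :
    @Term.realize L N ((paramIncl L Γ).reduct N) _
      (Sum.elim (paramVal (LHom.id (paramLang L Γ)) N) v) (collapseTerm t) = t.realize v := by
  let _ : L.Structure N := (paramIncl L Γ).reduct N
  induction t with
  | var x => rfl
  | @func n F ts ih =>
    rw [collapseTerm, Term.realize_subst, Term.realize_func]
    refine Eq.trans ?_ (hN n F fun i => (ts i).realize v).symm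
    refine congrArg (fun w => Term.realize w (show L.Term (Γ ⊕ Fin n) from F)) (funext fun x => ?_)
    rcases x with x | x
    · rfl
    · exact ih x

/-- For coherent structures, formulas of `paramLang L Γ` are formulas of `L` with parameters
from `Γ`. -/
theorem exists_collapse {α : Type v} {n : ℕ} (φ : (paramLang L Γ).BoundedFormula α n) :
    ∃ ψ : L.BoundedFormula (Γ ⊕ α) n, ∀ (N : Type u) [(paramLang L Γ).Structure N],
      IsCoherent (LHom.id (paramLang L Γ)) N → ∀ (v : α → N) (x : Fin n → N),
        @BoundedFormula.Realize L N ((paramIncl L Γ).reduct N) _ _ ψ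
          (Sum.elim (paramVal (LHom.id (paramLang L Γ)) N) v) x ↔ φ.Realize v x := by
  have key : ∀ {n : ℕ} (t : (paramLang L Γ).Term (α ⊕ Fin n)) (N : Type u)
      [(paramLang L Γ).Structure N], IsCoherent (LHom.id (paramLang L Γ)) N →
      ∀ (v : α → N) (x : Fin n → N), @Term.realize L N ((paramIncl L Γ).reduct N) _
        (Sum.elim (Sum.elim (paramVal (LHom.id (paramLang L Γ)) N) v) x)
        ((collapseTerm t).relabel (Equiv.sumAssoc Γ α (Fin n)).symm) =
          t.realize (Sum.elim v x) := by
    intro n t N _ hN v x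
    let _ : L.Structure N := (paramIncl L Γ).reduct N
    rw [← realize_collapseTerm hN, Term.realize_relabel]
    refine congrArg (fun w => Term.realize w (collapseTerm t)) (funext fun y => ?_)
    rcases y with y | y | y <;> rfl
  induction φ with
  | falsum => exact ⟨.falsum, fun N _ _ v x => Iff.rfl⟩
  | equal t₁ t₂ =>
    refine ⟨.equal ((collapseTerm t₁).relabel (Equiv.sumAssoc Γ α (Fin _)).symm)
      ((collapseTerm t₂).relabel (Equiv.sumAssoc Γ α (Fin _)).symm), fun N _ hN v x => ?_⟩
    simp only [BoundedFormula.Realize, key _ N hN]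
  | rel R ts =>
    refine ⟨.rel (show L.Relations _ from R)
      fun i => (collapseTerm (ts i)).relabel (Equiv.sumAssoc Γ α (Fin _)).symm,
      fun N _ hN v x => ?_⟩
    simp only [BoundedFormula.Realize, key _ N hN]
    rfl
  | imp φ₁ φ₂ h₁ h₂ =>
    obtain ⟨ψ₁, h₁⟩ := h₁
    obtain ⟨ψ₂, h₂⟩ := h₂
    refine ⟨ψ₁.imp ψ₂, fun N _ hN v x => ?_⟩
    simp only [BoundedFormula.Realize, h₁ N hN, h₂ N hN]
  | all φ h =>
    obtain ⟨ψ, h⟩ := h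
    refine ⟨ψ.all, fun N _ hN v x => ?_⟩
    simp only [BoundedFormula.Realize, h N hN]

/-- Skolem functions give Skolem terms, for formulas with arbitrary sets of free variables. -/
theorem exists_skolemTerm {T : L.Theory} (hT : HasSkolemFunctionsFor (LHom.id L) T) {β : Type v}
    (θ : L.Formula (β ⊕ Unit)) : ∃ t : L.Term β, ∀ (N : Type u) [L.Structure N] [Nonempty N],
      N ⊨ T → ∀ v : β → N, (∃ y, θ.Realize (Sum.elim v fun _ => y)) →
        θ.Realize (Sum.elim v fun _ => t.realize v) := by
  classical
  obtain ⟨X, hX, hXθ⟩ := exists_dependsOn θ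
  have hfin : (Sum.inl ⁻¹' X : Set β).Finite := hX.preimage Sum.inl_injective.injOn
  obtain ⟨m, b, -, hb⟩ := hfin.fin_param
  let r : β ⊕ Unit → Fin (m + 1) := Sum.elim
    (fun x => if h : ∃ i, b i = x then h.choose.castSucc else Fin.last m) fun _ => Fin.last m
  have hr : ∀ {N : Type u} (v : β → N) (y : N), ∀ x ∈ X,
      (Fin.snoc (v ∘ b) y : Fin (m + 1) → N) (r x) = Sum.elim v (fun _ => y) x := by
    intro N v y x hx
    rcases x with x | x
    · have h : ∃ i, b i = x := by
        have : x ∈ Set.range b := by rw [hb]; exact hx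
        exact this
      simp only [r, Sum.elim_inl, dif_pos h, Fin.snoc_castSucc, Function.comp, h.choose_spec]
    · simp [r]
  let φ : L.BoundedFormula Empty (m + 1) := BoundedFormula.relabel (k := 0)
    (fun i => (Sum.inr i : Empty ⊕ Fin (m + 1))) (θ.relabel r)
  have hφ : ∀ (N : Type u) [L.Structure N] (v : β → N) (y : N),
      φ.Realize default (Fin.snoc (v ∘ b) y : Fin (m + 1) → N) ↔
        θ.Realize (Sum.elim v fun _ => y) := by
    intro N _ v y
    unfold φ
    rw [BoundedFormula.realize_relabel]
    have : ∀ (w : Fin (m + 1) → N) (z : Fin 0 → N),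
        BoundedFormula.Realize (θ.relabel r) w z ↔ θ.Realize (w ∘ r) := by
      intro w z
      rw [← Formula.realize_relabel]
      exact iff_of_eq (congrArg _ (Subsingleton.elim _ _))
    rw [this]
    exact hXθ N _ _ fun x hx => hr v y x hx
  obtain ⟨F, hF⟩ := hT m φ
  refine ⟨Term.func F fun i => Term.var (b i), fun N _ _ hN v ⟨y, hy⟩ => ?_⟩
  have := hF N hN (v ∘ b) ⟨y, by rw [LHom.id_onBoundedFormula]; exact (hφ N v y).2 hy⟩
  rw [LHom.id_onBoundedFormula] at this
  exact (hφ N v _).1 this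

end Collapse

/-! ### The template of a blueprint -/

section BlueprintTemplate

variable {τ : FirstOrder.Language.{u, u}} {K : IndexModel τ → Prop} {I J : IndexModel τ}
  {Φ : Template τ} {N₀ : Type u} [Φ.L.Structure N₀] {A : J → List N₀} {Γ : Type u}

/-- Skolem functions for formulas with parameters are given by terms with parameters. -/
theorem exists_isSkolemSymbol_paramLang (hΦ : Φ.InUpsilon K) {Χ : Template τ}
    (hΧ : Χ.InUpsilon K) {i : paramLang Φ.L Γ →ᴸ Χ.L}
    (hle : Le K Φ Χ (i.comp (paramIncl Φ.L Γ)))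
    (hcoh : ∀ {n : ℕ} (t : Φ.L.Term (Γ ⊕ Fin n)), i.onSentence (coherenceAxiom t) ∈ Χ.theory K)
    {n : ℕ} (φ : (paramLang Φ.L Γ).BoundedFormula Empty (n + 1)) :
    ∃ F, IsSkolemSymbol K Χ i φ F := by
  obtain ⟨ψ, hψ⟩ := exists_collapse φ
  let θ : Φ.L.Formula ((Γ ⊕ Fin n) ⊕ Unit) := ψ.toFormula.relabel
    (Sum.elim (Sum.elim (fun γ => Sum.inl (Sum.inl γ)) Empty.elim)
      (Fin.snoc (fun i => Sum.inl (Sum.inr i)) (Sum.inr ()) :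
        Fin (n + 1) → (Γ ⊕ Fin n) ⊕ Unit))
  obtain ⟨t, ht⟩ := exists_skolemTerm hΦ.skolem θ
  refine ⟨termSymb t, fun I N _ b hI hb => ?_⟩
  let _ : (paramLang Φ.L Γ).Structure N := i.reduct N
  let _ : Φ.L.Structure N := (paramIncl Φ.L Γ).reduct N
  have := hb.nonempty hΧ hI
  have hN : IsCoherent (LHom.id (paramLang Φ.L Γ)) N := fun n t =>
    (realize_coherenceAxiom i t).1 (hcoh t I N b hI hb)
  have hT : N ⊨ Φ.theory K := (Theory.model_iff _).2 fun σ hσ => by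
    have := hle.theory_mono hΦ hσ I N b hI hb
    rwa [realize_onSentence_reduct] at this
  have hθ : ∀ (x : Fin n → N) (y : N),
      θ.Realize (Sum.elim (Sum.elim (paramVal (LHom.id (paramLang Φ.L Γ)) N) x) fun _ => y) ↔
        φ.Realize default (Fin.snoc x y : Fin (n + 1) → N) := by
    intro x y
    rw [← hψ N hN]
    unfold θ
    rw [Formula.realize_relabel, BoundedFormula.realize_toFormula]
    refine iff_of_eq (congrArg₂ _ (funext fun z => ?_) (funext fun z => ?_))
    · rcases z with z | z
      · rfl
      · exact z.elim
    · refine Fin.lastCases ?_ (fun z => ?_) z <;> simp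
  intro _ x ⟨y, hy⟩
  have h1 := ht N hT _ ⟨y, (hθ x y).2 hy⟩
  rw [hθ] at h1
  have h2 := hN n t x
  have h3 : Structure.funMap (termSymb t) x =
      Term.realize (Sum.elim (paramVal (LHom.id (paramLang Φ.L Γ)) N) x) t := h2
  rw [h3]
  exact h1

theorem Template.Le.reduct {Χ : Template τ} (hΦ : Φ.InUpsilon K) (hΧ : Χ.InUpsilon K)
    {L : FirstOrder.Language.{u, u}} {i : L →ᴸ Χ.L} {e : Φ.L →ᴸ L} (he : e.Injective)
    (hle : Le K Φ Χ (i.comp e))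
    (hS : ∀ (n : ℕ) (φ : L.BoundedFormula Empty (n + 1)), ∃ F, IsSkolemSymbol K Χ i φ F) :
    Le K Φ (Χ.reduct i) e where
  injective := he
  elementary H hH M _ a N hN b ha hb := by
    let _ : L.Structure N := hN
    obtain ⟨N', _, c, hc⟩ := hΧ.proper H hH
    obtain ⟨g, hg⟩ := hle.elementary H hH M a N' c ha hc
    let _ : L.Structure N' := i.reduct N'
    obtain ⟨h, hh⟩ := exists_elementaryEmbedding_reduct hΧ hS hH hb hc
    let _ : Φ.L.Structure N := e.reduct N
    let _ : Φ.L.Structure N' := e.reduct N'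
    let h' : N ↪ₑ[Φ.L] N' := h.ofLHom e
    refine exists_elementaryEmbedding_of_tp_eq (hΦ.nontrivial H M a hH ha).1 ha.generates
      fun l => ?_
    have h1 := flatMap_map_map (f := id) hg l
    have h2 := flatMap_map_map (f := id) hh l
    rw [List.map_id] at h1 h2
    refine (tp_map_elementaryEmbedding g _).symm.trans ?_
    refine Eq.trans ?_ (tp_map_elementaryEmbedding h' _)
    rw [← h1]
    exact congrArg (tp Φ.L) h2

/-- Every blueprint for a skeleton and all of the parameters in `Γ` is realized in a template
`Ψ ≥ Φ`.  The members of `GEM(I, Ψ)` are the values of terms in the skeleton and the parameters. -/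
theorem IsBlueprint.exists_template {lt : τ.Relations 2} (hK : IsIndexModelClass lt K) (hI : K I)
    (hJ : IsAlephZeroSaturated K J) {f : I → J} (hf : IsEmbedding I J f) (hΦ : Φ.InUpsilon K)
    (hA : IsGEM J Φ N₀ A) (hA0 : ∀ t, A t ≠ []) {S : Set (Φ.L.Formula ((J × ℕ) ⊕ Γ))}
    (hS : IsBlueprint (entry A hA0) Set.univ S) :
    ∃ (Ψ : Template τ) (e : Φ.L →ᴸ Ψ.L), Ψ.InUpsilon K ∧ Le K Φ Ψ e ∧
      ∀ (M : Type u) [Ψ.L.Structure M] (b : I → List M), IsGEM I Ψ M b →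
        let _ : Φ.L.Structure M := e.reduct M
        ∃ (P : Type u) (_ : Φ.L.Structure P) (v : (J × ℕ) ⊕ Γ → P) (g : M ↪ₑ[Φ.L] P),
          (∀ φ ∈ S, φ.Realize v) ∧ ∀ x : P, x ∈ Set.range g ↔
            ∃ t : Φ.L.Term ((I × ℕ) ⊕ Γ), t.realize (v ∘ Sum.map (Prod.map f id) id) = x := by
  obtain ⟨N, _, _, v, hv⟩ := hS.realized
  replace hv : ∀ φ ∈ S, φ.Realize v := fun φ hφ => ((hv φ).1 hφ).2
  obtain ⟨g₀, hg₀⟩ := hS.exists_elementaryEmbedding (by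
    rw [range_entry]
    exact hA.generates) hv
  obtain ⟨Χ, i, hi, hΧ, hle, H⟩ := exists_le_params hK hJ hΦ hA hA0 g₀ (v ∘ Sum.inr)
  have hcoh : ∀ {n : ℕ} (t : Φ.L.Term (Γ ⊕ Fin n)),
      i.onSentence (coherenceAxiom t) ∈ Χ.theory K := by
    intro n t
    obtain ⟨P, _, a, ha⟩ := hΧ.proper J hJ.mem
    exact mem_theory_of_realize hΧ hJ.mem ha
      ((realize_coherenceAxiom i t).2 ((H P a ha).1 n t))
  have hSk : ∀ (n : ℕ) (φ : (paramLang Φ.L Γ).BoundedFormula Empty (n + 1)),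
      ∃ F, IsSkolemSymbol K Χ i φ F := fun n φ =>
    exists_isSkolemSymbol_paramLang hΦ hΧ hle hcoh φ
  have hΨ := hΧ.reduct hJ.mem hSk
  refine ⟨Χ.reduct i, paramIncl Φ.L Γ, hΨ, hle.reduct hΦ hΧ paramIncl_injective hSk,
    fun M hM b hb => ?_⟩
  let _ : (paramLang Φ.L Γ).Structure M := hM
  let _ : Φ.L.Structure M := (paramIncl Φ.L Γ).reduct M
  obtain ⟨P, _, a, ha⟩ := hΧ.proper J hJ.mem
  obtain ⟨Q, hQ, q, hq⟩ := exists_isGEM_reduct (e := i) ha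
  obtain ⟨g₁, hg₁⟩ := hΨ.elementary I J f hI hJ.mem hf M b Q q hb hq
  obtain ⟨g₂, hg₂⟩ := exists_elementaryEmbedding_reduct hΧ hSk hJ.mem hq ha
  let _ : (paramLang Φ.L Γ).Structure P := i.reduct P
  let _ : Φ.L.Structure P := (paramIncl Φ.L Γ).reduct P
  obtain ⟨hP, -, ha0, hφ⟩ := H P a ha
  replace hP : IsCoherent (LHom.id (paramLang Φ.L Γ)) P := hP
  let g : M ↪ₑ[paramLang Φ.L Γ] P := g₂.comp g₁
  have hg : ∀ t, (b t).map g = a (f t) := fun t => by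
    rw [← hg₂, ← hg₁, List.map_map]
    rfl
  have hb0 := (hΨ.nontrivial I M b hI hb).1
  have hgb : ∀ y : I × ℕ, entry a ha0 (f y.1, y.2) = g (entry b hb0 y) := fun y =>
    entry_eq_of_map_eq hg hb0 ha0 y.1 y.2
  let c : Γ → P := paramVal (LHom.id (paramLang Φ.L Γ)) P
  have hgc : ∀ γ, g (paramVal (LHom.id (paramLang Φ.L Γ)) M γ) = c γ := fun γ => by
    refine (g.map_fun _ _).trans ?_
    exact congrArg _ (Subsingleton.elim _ _)
  have hvals : (Sum.elim (entry a ha0) c ∘ Sum.map (Prod.map f id) id : (I × ℕ) ⊕ Γ → P) =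
      g ∘ Sum.elim (entry b hb0) (paramVal (LHom.id (paramLang Φ.L Γ)) M) := by
    funext y
    rcases y with y | y
    · exact hgb y
    · exact (hgc y).symm
  refine ⟨P, inferInstance, Sum.elim (entry a ha0) c, g.ofLHom (paramIncl Φ.L Γ),
    fun φ hφS => ?_, fun x => ?_⟩
  · obtain ⟨E, hE, hφE⟩ := exists_dependsOn_entriesOver φ
    refine hφ φ E hE hφE fun h hh => ?_
    have h1 := hv _ (hS.indiscernible φ hφS E hφE h hh)
    rw [Formula.realize_relabel] at h1
    refine (iff_of_eq (congrArg (Formula.Realize φ) (funext fun y => ?_))).1 h1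
    rcases y with y | y
    · exact (hg₀ _).symm
    · rfl
  · rw [hvals]
    constructor
    · rintro ⟨z, rfl⟩
      have hz : z ∈ Substructure.closure (paramLang Φ.L Γ) (Set.range (entry b hb0)) := by
        rw [range_entry]
        have h3 : Substructure.closure (paramLang Φ.L Γ) {x | ∃ t, x ∈ b t} = ⊤ := hb.generates
        rw [h3]
        trivial
      obtain ⟨t, rfl⟩ := exists_term_of_closure hz
      refine ⟨(collapseTerm t).relabel Sum.swap, ?_⟩
      rw [Term.realize_relabel]
      have h4 : g (t.realize (entry b hb0)) = t.realize (g ∘ entry b hb0) :=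
        (HomClass.realize_term (F := M ↪ₑ[paramLang Φ.L Γ] P) (g := g)).symm
      refine Eq.trans ?_ h4.symm
      rw [← realize_collapseTerm hP]
      refine congrArg (fun v => Term.realize v (collapseTerm t)) (funext fun y => ?_)
      rcases y with y | y
      · exact hgc y
      · rfl
    · rintro ⟨t, rfl⟩
      refine ⟨t.realize (Sum.elim (entry b hb0) (paramVal (LHom.id (paramLang Φ.L Γ)) M)), ?_⟩
      exact (HomClass.realize_term (F := M ↪ₑ[Φ.L] P) (g := g.ofLHom (paramIncl Φ.L Γ))).symm

end BlueprintTemplate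

/-! ### Shearing in Skolem hulls of parts of the index model -/

namespace IndexModel

variable {τ : FirstOrder.Language.{u, u}} {I J : IndexModel τ}

theorem exists_isLocal_of_qfType_eq {l : List I} {l' : List J} (h : I.qfType l = J.qfType l') :
    ∃ k : I → J, IsLocal {x | x ∈ l} k ∧ l.map k = l' := by
  have hl := length_eq_of_qfType_eq h
  have h1 : (List.finRange l.length).map (fun i => l[i]) = l := by
    rw [← List.ofFn_eq_map]
    exact List.ofFn_get l
  have h2 : (List.finRange l.length).map (fun i => l'[i.1]) = l' := by
    refine List.ext_getElem (by simpa using hl) fun i _ _ => by simp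
  obtain ⟨k, hk, hkk⟩ := IsLocal.exists_of_sameQf
    (SameQf.of_list (s := fun i : Fin l.length => l[i]) (t := fun i : Fin l.length => l'[i.1])
      (List.finRange l.length) List.mem_finRange (by rw [h1, h2, h]))
  refine ⟨k, hk.mono ?_, ?_⟩
  · intro x hx
    obtain ⟨i, hi, rfl⟩ := List.mem_iff_getElem.1 hx
    exact ⟨⟨i, hi⟩, rfl⟩
  · refine List.ext_getElem (by simpa using hl) fun i h3 h4 => ?_
    rw [List.getElem_map]
    rw [List.length_map] at h3
    exact hkk ⟨i, h3⟩

theorem IsLocal.qfType_map {E : Set I} {h : I → J} (hh : IsLocal E h) {l : List I}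
    (hl : ∀ x ∈ l, x ∈ E) : J.qfType (l.map h) = I.qfType l := by
  have := hh (l.attach.map fun x => ⟨x.1, hl x.1 x.2⟩)
  simp only [List.map_map, Function.comp_def] at this
  rw [List.attach_map_val (f := h), List.attach_map_subtype_val] at this
  exact this.symm

end IndexModel

section Hull

variable {τ : FirstOrder.Language.{u, u}} {K : IndexModel τ → Prop} {I J : IndexModel τ}
  {L₀ L : FirstOrder.Language.{u, u}} {Γ : Type u} {P : Type u} [L.Structure P]

/-- The action of a map from `I` to `J` on the variables. -/
def reindex (f : I → J) : (I × ℕ) ⊕ Γ → (J × ℕ) ⊕ Γ := Sum.map (Prod.map f id) id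

theorem move_comp_reindex (h : J → J) (f : I → J) :
    (move h ∘ reindex f : (I × ℕ) ⊕ Γ → (J × ℕ) ⊕ Γ) = reindex (h ∘ f) := by
  funext x
  rcases x with x | x <;> rfl

/-- The value of the term `t` depends only on the values of the variables in `X`. -/
def TermDependsOn {α : Type v} (t : L.Term α) (X : Set α) : Prop :=
  ∀ (N : Type u) [L.Structure N] (v v' : α → N), (∀ x ∈ X, v x = v' x) → t.realize v = t.realize v'

theorem exists_termDependsOn {α : Type v} (t : L.Term α) :
    ∃ X : Set α, X.Finite ∧ TermDependsOn t X := by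
  classical
  exact ⟨t.varFinset, Finset.finite_toSet _, fun N _ v v' h => term_realize_congr_of_support t h⟩

theorem TermDependsOn.mono {α : Type v} {t : L.Term α} {X Y : Set α} (h : TermDependsOn t X)
    (hXY : X ⊆ Y) : TermDependsOn t Y := fun N _ v v' hv => h N v v' fun x hx => hv x (hXY hx)

/-- A family indexed by the entries of a skeleton, and by parameters, is indiscernible. -/
def IsInvariant (v : (J × ℕ) ⊕ Γ → P) : Prop :=
  ∀ (φ : L.Formula ((J × ℕ) ⊕ Γ)) (E : Set J) (h : J → J), DependsOn φ (entriesOver Γ E) →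
    IsLocal E h → (φ.Realize v ↔ φ.Realize (v ∘ move h))

theorem IsBlueprint.isInvariant {N₀ : Type u} [L.Structure N₀] {v₀ : J × ℕ → N₀}
    {S : Set (L.Formula ((J × ℕ) ⊕ Γ))} (hS : IsBlueprint v₀ Set.univ S) {v : (J × ℕ) ⊕ Γ → P}
    (hv : ∀ φ ∈ S, φ.Realize v) : IsInvariant (L := L) v := by
  intro φ E h hE hh
  have huniv : ∀ φ : L.Formula ((J × ℕ) ⊕ Γ), DependsOn φ (paramsIn J Set.univ) :=
    fun φ N _ v v' hv => iff_of_eq (congrArg _ (funext fun x => hv x fun _ _ => trivial))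
  rw [← hS.mem_iff hv (huniv φ), ← Formula.realize_relabel, ← hS.mem_iff hv (huniv _),
    hS.relabel_mem_iff (huniv φ) hE hh]

/-- The elements of `M` which are values of terms in the members of the skeleton with index in `E`,
and in the parameters. -/
def hull (L : FirstOrder.Language.{u, u}) [L.Structure P] {M : Type u} (f : I → J)
    (v : (J × ℕ) ⊕ Γ → P) (g : M → P) (E : Set I) : Set M :=
  {x | ∃ t : L.Term ((I × ℕ) ⊕ Γ), TermDependsOn t (entriesOver Γ E) ∧
    t.realize (v ∘ reindex f) = g x}

theorem hull_mono {M : Type u} {f : I → J} {v : (J × ℕ) ⊕ Γ → P} {g : M → P} {E E' : Set I}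
    (h : E ⊆ E') : hull L f v g E ⊆ hull L f v g E' := fun _ ⟨t, ht, hx⟩ =>
  ⟨t, ht.mono fun _ hx y hy => h (hx y hy), hx⟩

/-- Terms and their conjugates over `E₀` have the same type over the hull of `E₀`. -/
theorem tpOver_map_eq {M : Type u} [L₀.Structure P] (i₀ : L₀ →ᴸ L) [i₀.IsExpansionOn P]
    {f : I → J} {v : (J × ℕ) ⊕ Γ → P} (hv : IsInvariant (L := L) v) {g : M → P} {E₀ : Set I}
    {E : Set J} (hE₀ : f '' E₀ ⊆ E) {h : J → J} (hh : IsLocal E h) (hf : ∀ x ∈ E₀, h (f x) = f x)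
    (T : List (L.Term ((J × ℕ) ⊕ Γ))) (hT : ∀ t ∈ T, TermDependsOn t (entriesOver Γ E)) :
    tpOver L₀ (g '' hull L f v g E₀) (T.map fun t => t.realize v) =
      tpOver L₀ (g '' hull L f v g E₀) (T.map fun t => t.realize (v ∘ move h)) := by
  choose x hx hgx using fun y : g '' hull L f v g E₀ => y.2
  choose t ht htx using hx
  ext ⟨m, φ⟩
  simp only [tpOver, Set.mem_ofPred_eq, List.length_map]
  refine exists_congr fun hm => ?_
  let θ : L.Formula ((J × ℕ) ⊕ Γ) := BoundedFormula.subst (i₀.onFormula φ)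
    (Sum.elim (fun y => (t y).relabel (reindex f)) fun i => T.get (i.cast hm.symm))
  have hθ : ∀ w : (J × ℕ) ⊕ Γ → P, (∀ y ∈ entriesOver Γ E₀, w (reindex f y) = v (reindex f y)) →
      (θ.Realize w ↔ φ.Realize (Sum.elim Subtype.val
        (tuple (T.map fun t => t.realize w) (by simpa using hm)))) := by
    intro w hw
    unfold θ
    rw [realize_subst_formula, LHom.realize_onFormula]
    refine iff_of_eq (congrArg _ (funext fun y => ?_))
    rcases y with y | y
    · simp only [Sum.elim_inl, Term.realize_relabel]
      rw [← hgx, ← htx]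
      exact ht y P _ _ hw
    · simp [tuple]
  rw [← hθ v fun _ _ => rfl, ← hθ (v ∘ move h)]
  · refine hv θ E h (fun Q _ w w' hw => ?_) hh
    unfold θ
    rw [realize_subst_formula, realize_subst_formula]
    refine iff_of_eq (congrArg _ (funext fun y => ?_))
    rcases y with y | y
    · simp only [Sum.elim_inl, Term.realize_relabel]
      refine ht y Q _ _ fun z hz => hw _ fun z' hz' => ?_
      rcases z with z | z
      · obtain rfl := Sum.inl.inj hz'
        exact hE₀ ⟨z.1, hz z rfl, rfl⟩
      · exact (Sum.inr_ne_inl hz').elim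
    · exact hT _ (List.get_mem _ _) Q _ _ hw
  · intro y hy
    rcases y with y | y
    · change v (Sum.inl (h (f y.1), y.2)) = v (Sum.inl (f y.1, y.2))
      rw [hf _ (hy y rfl)]
    · rfl

/-- A formula shears if finitely many conjugates of it over `I₀` are jointly inconsistent: the
indiscernible sequence consists of the values of the terms defining its parameters. -/
theorem shears_of_inconsistent {M : Type u} [L₀.Structure M] [L₀.Structure P] (i₀ : L₀ →ᴸ L)
    [i₀.IsExpansionOn P] (hJ : IsAlephZeroSaturated K J) {f : I → J} (hf : IsEmbedding I J f)
    {v : (J × ℕ) ⊕ Γ → P} (hv : IsInvariant (L := L) v) (g : M ↪ₑ[L₀] P) {k : ℕ}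
    (ψ : ParamFormula L₀ M k) (t : Fin ψ.arity → L.Term ((I × ℕ) ⊕ Γ))
    (ht : ∀ j, (t j).realize (v ∘ reindex f) = g (ψ.params j)) {I₀ I₁ : Finset I} (h01 : I₀ ⊆ I₁)
    (htd : ∀ j, TermDependsOn (t j) (entriesOver Γ (I₁ : Set I))) {H : Set (J → J)}
    (hfin : H.Finite) (hH : ∀ h ∈ H, IsLocal (f '' I₁) h ∧ ∀ y ∈ I₀, h (f y) = f y)
    (hno : ¬ ∃ z : Fin k → P, ∀ h ∈ H, ψ.formula.Realize
      (Sum.elim z fun j => (t j).realize (v ∘ move h ∘ reindex f))) :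
    Shears K I (hull L f v g I₀) ψ I₀ I₁ := by
  classical
  obtain ⟨z₀⟩ := J.nonempty
  let s := I₁.toList
  have hs : ∀ i, i ∈ s ↔ i ∈ I₁ := fun i => Finset.mem_toList
  have hidx : ∀ i ∈ I₁, s.idxOf i < s.length := fun i hi =>
    List.idxOf_lt_length_of_mem ((hs i).2 hi)
  let q : List J → I → J := fun r i => r.getD (s.idxOf i) z₀
  have hq : ∀ (r : List J), r.length = s.length → ∀ i ∈ I₁, q r i ∈ r := by
    intro r hr i hi
    have h1 : s.idxOf i < r.length := hr ▸ hidx i hi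
    simp [q, h1]
  have hqmap : ∀ (r : List J) (h : J → J), r.length = s.length → ∀ i ∈ I₁,
      q (r.map h) i = h (q r i) := by
    intro r h hr i hi
    have h1 : s.idxOf i < r.length := hr ▸ hidx i hi
    simp [q, h1]
  have hqs : ∀ (h : I → J), ∀ i ∈ I₁, q (s.map h) i = h i := by
    intro h i hi
    have h1 := hidx i hi
    simp [q, h1]
  let bT : List J → List (L.Term ((J × ℕ) ⊕ Γ)) := fun r =>
    if r.length = s.length then List.ofFn fun j => (t j).relabel (reindex (q r)) else []
  let b : List J → List P := fun r => (bT r).map fun T => T.realize v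
  have hb : ∀ (r : List J) (h : J → J), b (r.map h) =
      (bT r).map fun T => T.realize (v ∘ move h) := by
    intro r h
    simp only [b, bT, List.length_map]
    split_ifs with hr
    · simp only [List.map_ofFn]
      refine congrArg _ (funext fun j => ?_)
      simp only [Function.comp, Term.realize_relabel]
      refine htd j P _ _ fun y hy => ?_
      rcases y with y | y
      · have h1 := hqmap r h hr y.1 (hy y rfl)
        exact congrArg (fun i => v (Sum.inl (i, y.2))) h1
      · rfl
    · rfl
  have hbs : ∀ h : I → J, b (s.map h) = List.ofFn fun j => (t j).realize (v ∘ reindex h) := by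
    intro h
    simp only [b, bT, List.length_map, if_true, List.map_ofFn]
    refine congrArg _ (funext fun j => ?_)
    simp only [Function.comp, Term.realize_relabel]
    refine htd j P _ _ fun y hy => ?_
    rcases y with y | y
    · exact congrArg (fun i => v (Sum.inl (i, y.2))) (hqs h y.1 (hy y rfl))
    · rfl
  refine ⟨h01, P, inferInstance, g, J, f, I₀.toList, s, b, hJ, hf,
    ⟨Finset.nodup_toList _, fun x => Finset.mem_toList⟩,
    ⟨Finset.nodup_toList _, fun x => Finset.mem_toList⟩, ?_, ?_, ?_⟩
  · intro ts ts' hlen hts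
    obtain ⟨h, hh, hmap⟩ := exists_isLocal_of_qfType_eq hts
    rw [List.map_append] at hmap
    obtain ⟨h1, h2⟩ := List.append_inj hmap (by simp)
    have hts' : ts' = ts.map (List.map h) := by
      rw [List.eq_iff_flatten_eq]
      refine ⟨?_, ?_⟩
      · rw [← h2, List.map_flatten]
      · rw [← hlen]
        simp [Function.comp_def]
    have h3 : ts.flatMap b = (ts.flatMap bT).map fun T => T.realize v := by
      rw [List.map_flatMap]
    have h4 : ts'.flatMap b = (ts.flatMap bT).map fun T => T.realize (v ∘ move h) := by
      rw [hts', List.flatMap_map, List.map_flatMap]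
      simp only [hb]
    rw [h3, h4]
    refine tpOver_map_eq i₀ hv ?_ hh (fun x hx => ?_) _ fun T hT => ?_
    · rintro _ ⟨x, hx, rfl⟩
      exact List.mem_append_left _ (List.mem_map_of_mem (Finset.mem_toList.2 hx))
    · rw [List.map_map] at h1
      exact (List.map_inj_left.1 h1) x (Finset.mem_toList.2 hx)
    · obtain ⟨r, hr, hTr⟩ := List.mem_flatMap.1 hT
      simp only [bT] at hTr
      split_ifs at hTr with hrl
      · rw [List.mem_ofFn] at hTr
        obtain ⟨j, rfl⟩ := hTr
        intro Q _ w w' hw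
        rw [Term.realize_relabel, Term.realize_relabel]
        refine htd j Q _ _ fun y hy => hw _ fun z hz => ?_
        rcases y with y | y
        · obtain rfl := Sum.inl.inj hz
          exact List.mem_append_right _ (List.mem_flatten.2 ⟨r, hr, hq r hrl _ (hy y rfl)⟩)
        · exact (Sum.inr_ne_inl hz).elim
      · simp at hTr
  · rw [hbs, List.map_ofFn]
    exact congrArg _ (funext fun j => (ht j).symm)
  · intro hsat
    let χ : (J → J) → ParamFormula L₀ P k := fun h =>
      ⟨ψ.arity, ψ.formula, fun j => (t j).realize (v ∘ move h ∘ reindex f)⟩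
    obtain ⟨z, hz⟩ := hsat (χ '' H) (by
      rintro _ ⟨h, hhH, rfl⟩
      obtain ⟨hh, hfix⟩ := hH h hhH
      refine ⟨(s.map f).map h, _, ?_, ?_, rfl⟩
      · have h1 : I₀.toList.map f = (I₀.toList.map f).map h := by
          rw [List.map_map]
          exact List.map_congr_left fun y hy => (hfix y (Finset.mem_toList.1 hy)).symm
        rw [h1, ← List.map_append, ← List.map_append, hh.qfType_map, hf.qfType_map]
        intro x hx
        obtain ⟨y, hy, rfl⟩ := List.mem_map.1 hx
        refine ⟨y, ?_, rfl⟩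
        rcases List.mem_append.1 hy with hy | hy
        · exact h01 (Finset.mem_toList.1 hy)
        · exact Finset.mem_toList.1 hy
      · rw [List.map_map, hbs, ← move_comp_reindex]) (hfin.image χ)
    exact hno ⟨z, fun h hh => hz (χ h) ⟨h, hh, rfl⟩⟩

/-- If shearing over every finite part of a countable index model occurs in a finitely satisfiable
set of formulas, then the theory is unsuperstable. -/
theorem isUnsuperstable_of_forall_shears [Countable I] {M : Type u} [L₀.Structure M]
    {T₀ : L₀.Theory} (hM : M ⊨ T₀) {f : I → J} {v : (J × ℕ) ⊕ Γ → P} {g : M → P}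
    (hg : ∀ t : L.Term ((I × ℕ) ⊕ Γ), t.realize (v ∘ reindex f) ∈ Set.range g) {k : ℕ}
    {Q : Set (ParamFormula L₀ M k)} (hQ : FinSat Q)
    (hstep : ∀ I₀ : Finset I, ∃ I₁ : Finset I, ∃ ψ ∈ Q, (∀ j, ψ.params j ∈ hull L f v g I₁) ∧
      I₀ ⊆ I₁ ∧ ∀ I₂ : Finset I, I₁ ⊆ I₂ → Shears K I (hull L f v g I₀) ψ I₀ I₂) :
    IsUnsuperstable K I T₀ := by
  classical
  have := I.nonempty
  obtain ⟨enum, henum⟩ := exists_surjective_nat I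
  choose I₁ ψ hψQ hψ hI₁ hsh using hstep
  let s : ℕ → List I := fun n => Nat.rec [enum 0]
    (fun n l => l ++ ((I₁ l.toFinset ∪ {enum n}) \ l.toFinset).toList) n
  let In : ℕ → Finset I := fun n => (s n).toFinset
  have hIn : ∀ n, In (n + 1) = In n ∪ (I₁ (In n) ∪ {enum n}) := by
    intro n
    ext x
    simp only [In, s, List.toFinset_append, Finset.toList_toFinset, Finset.mem_union,
      Finset.mem_sdiff]
    tauto
  have hmono : Monotone In := monotone_nat_of_le_succ fun n => by
    rw [hIn]
    exact Finset.subset_union_left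
  have hI₁n : ∀ n, I₁ (In n) ⊆ In (n + 1) := fun n => by
    rw [hIn]
    exact Finset.subset_union_left.trans Finset.subset_union_right
  have hne : ∀ n, (In n).Nonempty := fun n =>
    ⟨enum 0, hmono (Nat.zero_le n) (by simp [In, s])⟩
  have hnodup : ∀ n, (s n).Nodup := by
    intro n
    induction n with
    | zero => exact List.nodup_singleton _
    | succ n ih =>
      refine List.Nodup.append ih (Finset.nodup_toList _) fun x hx hx' => ?_
      rw [Finset.mem_toList, Finset.mem_sdiff, List.mem_toFinset] at hx'
      exact hx'.2 hx
  have hB : Monotone fun n => hull L f v g (In n) := fun m n h =>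
    hull_mono (Finset.coe_subset.2 (hmono h))
  have hMne : ∀ E : Set I, E.Nonempty → (hull L f v g E).Nonempty := by
    rintro E ⟨y, hy⟩
    obtain ⟨x, hx⟩ := hg (Term.var (Sum.inl (y, 0)))
    refine ⟨x, _, fun N _ w w' hw => ?_, hx.symm⟩
    refine hw (Sum.inl (y, 0)) fun z hz => ?_
    obtain rfl := Sum.inl.inj hz
    exact hy
  have hpar : ∀ n j, (ψ (In n)).params j ∈ hull L f v g (In (n + 1)) := fun n j =>
    hull_mono (Finset.coe_subset.2 (hI₁n n)) (hψ (In n) j)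
  refine ⟨M, inferInstance, ?_, k, In, s, fun n => hull L f v g (In n),
    Set.range fun n => ψ (In n), hM, hmono, hne, fun x => ?_,
    fun n => ⟨⟨hnodup n, fun x => List.mem_toFinset.symm⟩, List.prefix_append _ _⟩,
    hB, fun n => hMne _ (hne n), fun F hF hfin => ?_, ?_, fun n => ?_⟩
  · obtain ⟨x, -⟩ := hMne _ (hne 0)
    exact ⟨x⟩
  · obtain ⟨n, rfl⟩ := henum x
    refine ⟨n + 1, ?_⟩
    rw [hIn]
    simp
  · exact hQ F (hF.trans (by rintro _ ⟨n, rfl⟩; exact hψQ _)) hfin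
  · rintro _ ⟨n, rfl⟩ j
    exact Set.mem_iUnion.2 ⟨n + 1, hpar n j⟩
  · exact ⟨_, ⟨n, rfl⟩, hpar n, hsh (In n) _ (hI₁n n)⟩

end Hull

/-! ### Saturation -/

section Saturation

open Cardinal in
theorem exists_forall_lt_of_mk_le {c : Cardinal.{u}} (hc : ℵ₀ ≤ c)
    (s : Set (Order.succ c).ord.ToType) (hs : #s ≤ c) : ∃ w, ∀ x ∈ s, x < w := by
  by_contra! h
  have h1 : IsCofinal s := fun w => h w
  have h2 := Order.cof_le h1
  rw [Ordinal.cof_toType] at h2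
  have h3 := (isRegular_succ hc).2.trans (h2.trans hs)
  exact absurd h3 (not_le.2 (Order.lt_succ c))

variable {τ : FirstOrder.Language.{u, u}} {K : IndexModel τ → Prop} {I J : IndexModel τ}
  {L₀ L : FirstOrder.Language.{u, u}} {P : Type u} [L.Structure P]

/-- The formula `φ(x, a)`, where the parameters `a` are replaced by terms. -/
def schemeFormula {A Γ : Type u} (i₀ : L₀ →ᴸ L) (f : I → J) (t : A → L.Term ((I × ℕ) ⊕ Γ))
    (φ : L₀.Formula (A ⊕ Unit)) : L.Formula (Unit ⊕ ((J × ℕ) ⊕ Γ)) :=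
  BoundedFormula.subst (i₀.onFormula φ)
    (Sum.elim (fun x => (t x).relabel (Sum.inr ∘ reindex f)) fun _ => Term.var (Sum.inl ()))

theorem realize_schemeFormula {A Γ : Type u} (i₀ : L₀ →ᴸ L) (f : I → J)
    (t : A → L.Term ((I × ℕ) ⊕ Γ)) (φ : L₀.Formula (A ⊕ Unit)) {N : Type u} [L.Structure N]
    [L₀.Structure N] [i₀.IsExpansionOn N] (z : N) (w : (J × ℕ) ⊕ Γ → N) :
    (schemeFormula i₀ f t φ).Realize (Sum.elim (fun _ => z) w) ↔
      φ.Realize (Sum.elim (fun x => (t x).realize (w ∘ reindex f)) fun _ => z) := by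
  unfold schemeFormula
  rw [realize_subst_formula, LHom.realize_onFormula]
  refine iff_of_eq (congrArg _ (funext fun x => ?_))
  rcases x with x | x
  · exact Term.realize_relabel
  · rfl

open Cardinal in
/-- Assume that each good scheme is realized at a later level of the blueprint `S`. In a model of a
superstable theory, which is generated by part of a realization of `S`, a type over few parameters
gives a good scheme over some finite base, and is thus realized. -/
theorem isSaturated_of_isSuperstable {lt : τ.Relations 2} (hK : IsIndexModelClass lt K)
    (hJ : IsAlephZeroSaturated K J) [Countable I] {f : I → J} (hf : IsEmbedding I J f)
    {T₀ : L₀.Theory} (h₀ : IsSuperstable K I T₀) {κ Θ : Type u} [Infinite κ]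
    (hκ : L₀.card ≤ #κ)
    (p : (Order.succ #κ).ord.ToType × Θ →
      Scheme J L ((Order.succ #κ).ord.ToType × Θ) κ)
    (hp : ∀ s, ∃ θ, ∀ w, p (w, θ) = s)
    {v : (J × ℕ) ⊕ ((Order.succ #κ).ord.ToType × Θ) → P} (hv : IsInvariant (L := L) v)
    (hvp : ∀ γ, (p γ).IsGood {γ' | γ'.1 < γ.1} v → ∃ T : L.Term (((p γ).base × ℕ) ⊕ _),
      ∀ i, (substTerm ((p γ).formula i)
        (T.relabel (Sum.map (Prod.map Subtype.val id) id))).Realize v)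
    (i₀ : L₀ →ᴸ L) [L₀.Structure P] [i₀.IsExpansionOn P] {M : Type u} [L₀.Structure M]
    (hM : M ⊨ T₀) (g : M ↪ₑ[L₀] P) (hg : ∀ x : P, x ∈ Set.range g ↔
      ∃ t : L.Term ((I × ℕ) ⊕ _), t.realize (v ∘ reindex f) = x) :
    IsSaturated L₀ M (Order.succ #κ) := by
  classical
  intro A hA q hq
  have hκ0 : ℵ₀ ≤ #κ := aleph0_le_mk κ
  replace hA : #A ≤ #κ := Order.lt_succ_iff.1 hA
  -- terms for the parameters, and a bound on the levels occurring in them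
  choose t ht using fun x : A => (hg (g x)).1 ⟨x, rfl⟩
  choose X hX hXt using fun x => exists_termDependsOn (t x)
  obtain ⟨w, hw⟩ := exists_forall_lt_of_mk_le hκ0
    (⋃ x, {y | ∃ γ, Sum.inr γ ∈ X x ∧ γ.1 = y}) (by
      refine (mk_iUnion_le _).trans (mul_le_of_le hκ0 hA (ciSup_le' fun x => ?_))
      have : {y | ∃ γ, Sum.inr γ ∈ X x ∧ γ.1 = y} = Prod.fst '' (Sum.inr ⁻¹' X x) := rfl
      rw [this]
      exact (((hX x).preimage Sum.inr_injective.injOn).image _).lt_aleph0.le.trans hκ0)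
  replace hw : ∀ x γ, Sum.inr γ ∈ X x → γ.1 < w := fun x γ hγ =>
    hw _ (Set.mem_iUnion.2 ⟨x, γ, hγ, rfl⟩)
  -- the formulas of the type, indexed by `κ`
  obtain ⟨φ, hφ⟩ : ∃ φ : κ → L₀.Formula (A ⊕ Unit), Set.range φ = insert ⊤ q := by
    have h1 : #(L₀.Formula (A ⊕ Unit)) ≤ #κ := by
      have h2 : #(L₀.Formula (A ⊕ Unit)) ≤ #(Σ n, L₀.BoundedFormula (A ⊕ Unit) n) :=
        mk_le_of_injective (f := fun φ => ⟨0, φ⟩) fun φ ψ h => by simpa using h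
      refine h2.trans (BoundedFormula.card_le.trans (max_le hκ0 (add_le_of_le hκ0 ?_ ?_)))
      · simp only [mk_sum, lift_uzero, mk_fintype, Fintype.card_unit, Nat.cast_one, lift_one,
          lift_id]
        exact add_le_of_le hκ0 hA (one_le_aleph0.trans hκ0)
      · simpa using hκ
    obtain ⟨j⟩ := (mk_set_le (insert ⊤ q)).trans h1
    have : Nonempty (insert ⊤ q : Set (L₀.Formula (A ⊕ Unit))) := ⟨⟨⊤, Or.inl rfl⟩⟩
    have h3 := Function.invFun_surjective j.injective
    refine ⟨fun i => (Function.invFun j i).1, ?_⟩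
    ext ψ
    constructor
    · rintro ⟨i, rfl⟩
      exact (Function.invFun j i).2
    · intro hψ
      obtain ⟨i, hi⟩ := h3 ⟨ψ, hψ⟩
      exact ⟨i, congrArg Subtype.val hi⟩
  choose Y hY hYφ using fun i => exists_dependsOn (φ i)
  have hE : ∀ i, {y : I | ∃ x, Sum.inl x ∈ Y i ∧ ∃ n, Sum.inl (y, n) ∈ X x}.Finite := by
    intro i
    refine (((hY i).preimage Sum.inl_injective.injOn).biUnion (t := fun x =>
      Prod.fst '' (Sum.inl ⁻¹' X x)) fun x _ =>
      ((hX x).preimage Sum.inl_injective.injOn).image _).subset ?_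
    rintro y ⟨x, hx, n, hn⟩
    exact Set.mem_biUnion hx ⟨(y, n), hn, rfl⟩
  let E : κ → Finset I := fun i => (hE i).toFinset
  have hEmem : ∀ i x, Sum.inl x ∈ Y i → ∀ y, Sum.inl y ∈ X x → y.1 ∈ E i := fun i x hx y hy =>
    (hE i).mem_toFinset.2 ⟨x, hx, y.2, hy⟩
  let sch : Finset I → Scheme J L _ κ := fun I₀ =>
    ⟨I₀.image f, fun i => schemeFormula i₀ f t (φ i), fun i => (E i).image f⟩
  have hdep : ∀ I₀ i, DependsOn ((sch I₀).formula i) {x | ∀ y, x = Sum.inr y →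
      y ∈ paramsIn J {γ' | γ'.1 < w} ∩ entriesOver _ ((sch I₀).supp i)} := by
    intro I₀ i N _ u u' hu
    let _ : L₀.Structure N := i₀.reduct N
    have hsum : ∀ {β : Type u} (u : Unit ⊕ β → N),
        u = Sum.elim (fun _ => u (Sum.inl ())) (u ∘ Sum.inr) := fun u => by
      funext y
      rcases y with y | y <;> rfl
    rw [hsum u, hsum u']
    refine (realize_schemeFormula i₀ f t (φ i) _ _).trans
      (Iff.trans ?_ (realize_schemeFormula i₀ f t (φ i) _ _).symm)
    refine hYφ i N _ _ fun x hx => ?_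
    rcases x with x | x
    · refine hXt x N _ _ fun y hy => hu _ fun z hz => ?_
      obtain rfl := Sum.inr.inj hz
      rcases y with y | y
      · refine ⟨fun γ h => (Sum.inl_ne_inr h).elim, fun z hz => ?_⟩
        obtain rfl := Sum.inl.inj hz
        exact Finset.mem_coe.2 (Finset.mem_image_of_mem f (hEmem i x hx y hy))
      · refine ⟨fun γ h => ?_, fun z hz => (Sum.inr_ne_inl hz).elim⟩
        obtain rfl := Sum.inr.inj h
        exact hw x _ hy
    · exact hu _ fun z hz => (Sum.inl_ne_inr hz).elim
  by_cases hgood : ∃ I₀, (sch I₀).IsGood {γ' | γ'.1 < w} v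
  · obtain ⟨I₀, hI₀⟩ := hgood
    obtain ⟨θ, hθ⟩ := hp (sch I₀)
    have h1 := hvp (w, θ)
    rw [hθ w] at h1
    obtain ⟨T, hT⟩ := h1 hI₀
    have hbase : ∀ y : (sch I₀).base, ∃ z : I, f z = y := fun y => by
      obtain ⟨z, -, hz⟩ := Finset.mem_image.1 y.2
      exact ⟨z, hz⟩
    choose k hk using hbase
    obtain ⟨x, hx⟩ := (hg ((T.relabel (Sum.map (Prod.map Subtype.val id) id)).realize v)).2
      ⟨T.relabel (Sum.map (Prod.map k id) id), by
        rw [Term.realize_relabel, Term.realize_relabel]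
        refine congrArg (fun v => Term.realize v T) (funext fun y => ?_)
        rcases y with y | y
        · exact congrArg (fun z => v (Sum.inl (z, y.2))) (hk y.1)
        · rfl⟩
    refine ⟨x, fun ψ hψ => ?_⟩
    obtain ⟨i, rfl⟩ : ψ ∈ Set.range φ := hφ ▸ Or.inr hψ
    have h2 := (realize_substTerm _ _ _).1 (hT i)
    rw [← hx] at h2
    have h3 := (realize_schemeFormula i₀ f t (φ i) _ _).1 h2
    refine (g.map_formula (φ i) _).1 ((iff_of_eq (congrArg _ (funext fun y => ?_))).1 h3)
    rcases y with y | y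
    · exact ht y
    · rfl
  · -- otherwise the type would witness that `T₀` is unsuperstable
    refine (h₀ ?_).elim
    let Q : Set (ParamFormula L₀ M 1) := {ψ | ∃ F : Set (L₀.Formula (A ⊕ Unit)), F.Finite ∧ F ⊆ q ∧
      ∀ x : M, (∀ χ ∈ F, χ.Realize (Sum.elim Subtype.val fun _ => x)) →
        ψ.formula.Realize (Sum.elim (fun _ => x) ψ.params)}
    have hQ : FinSat Q := by
      intro G hG hGfin
      have hG' : ∀ ψ, ψ ∈ G → ∃ F : Set (L₀.Formula (A ⊕ Unit)), F.Finite ∧ F ⊆ q ∧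
          ∀ x : M, (∀ χ ∈ F, χ.Realize (Sum.elim Subtype.val fun _ => x)) →
            ψ.formula.Realize (Sum.elim (fun _ => x) ψ.params) := fun ψ hψ => hG hψ
      choose! F hF hFq hFψ using hG'
      obtain ⟨x, hx⟩ := hq (⋃ ψ ∈ G, F ψ) (hGfin.biUnion fun ψ hψ => hF ψ hψ)
        (Set.iUnion₂_subset fun ψ hψ => hFq ψ hψ)
      exact ⟨fun _ => x, fun ψ hψ => hFψ ψ hψ x fun χ hχ => hx χ (Set.mem_biUnion hψ hχ)⟩
    refine isUnsuperstable_of_forall_shears (L := L) hM (f := f) (v := v) (g := g)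
      (fun t => (hg _).2 ⟨t, rfl⟩) hQ fun I₀ => ?_
    have hbad : ¬ ∀ F : Set (κ × (J → J)), F.Finite →
        (∀ x ∈ F, IsLocal ((sch I₀).base ∪ (sch I₀).supp x.1 : Set J) x.2 ∧
          ∀ y ∈ (sch I₀).base, x.2 y = y) →
        ∃ z : P, ∀ x ∈ F, ((sch I₀).formula x.1).Realize
          (Sum.elim (fun _ => z) (v ∘ move x.2)) := fun h =>
      hgood ⟨I₀, hdep I₀, h⟩
    push Not at hbad
    obtain ⟨F, hF, hFloc, hno⟩ := hbad
    let G : Set κ := Prod.fst '' F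
    have hG : G.Finite := hF.image _
    obtain ⟨r, a, -, ha⟩ := (hG.biUnion fun i _ =>
      (hY i).preimage Sum.inl_injective.injOn).fin_param
    have ha' : ∀ i ∈ G, ∀ x, Sum.inl x ∈ Y i → ∃ j, a j = x := fun i hi x hx => by
      have : x ∈ Set.range a := by
        rw [ha]
        exact Set.mem_biUnion hi hx
      exact this
    have haE : ∀ j, ∃ i ∈ G, Sum.inl (a j) ∈ Y i := fun j => by
      have : a j ∈ Set.range a := ⟨j, rfl⟩
      rw [ha] at this
      simpa using this
    let ρ : A ⊕ Unit → Fin 1 ⊕ Fin r := Sum.elim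
      (fun x => if h : ∃ j, a j = x then Sum.inr h.choose else Sum.inl 0) fun _ => Sum.inl 0
    let ψ : ParamFormula L₀ M 1 := ⟨r, conj ((fun i => (φ i).relabel ρ) '' G) (hG.image _),
      fun j => (a j).1⟩
    have hψ : ∀ {N : Type u} [L₀.Structure N] (z : Fin 1 → N) (u : A → N),
        ψ.formula.Realize (Sum.elim z (u ∘ a)) ↔
          ∀ i ∈ G, (φ i).Realize (Sum.elim u fun _ => z 0) := by
      intro N _ z u
      refine (realize_conj (hG.image fun i => (φ i).relabel ρ) _).trans ?_
      rw [Set.forall_mem_image]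
      refine forall₂_congr fun i hi => ?_
      rw [Formula.realize_relabel]
      refine hYφ i N _ _ fun x hx => ?_
      rcases x with x | x
      · have h := ha' i hi x hx
        simp only [ρ, Function.comp, Sum.elim_inl, dif_pos h, Sum.elim_inr, h.choose_spec]
      · rfl
    let I₁ : Finset I := I₀ ∪ hG.toFinset.biUnion E
    have hEI₁ : ∀ i ∈ G, E i ⊆ I₁ := fun i hi =>
      (Finset.subset_biUnion_of_mem E (hG.mem_toFinset.2 hi)).trans Finset.subset_union_right
    have hterm : ∀ I₂ : Finset I, I₁ ⊆ I₂ → ∀ j,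
        TermDependsOn (t (a j)) (entriesOver _ (I₂ : Set I)) := by
      intro I₂ h12 j
      obtain ⟨i, hi, hij⟩ := haE j
      refine (hXt (a j)).mono fun y hy z hz => ?_
      subst hz
      exact Finset.mem_coe.2 (h12 (hEI₁ i hi (hEmem i _ hij z hy)))
    refine ⟨I₁, ψ, ⟨φ '' G ∩ q, (hG.image _).inter_of_left _, Set.inter_subset_right,
      fun x hx => ?_⟩, fun j => ⟨t (a j), hterm I₁ subset_rfl j, ht (a j)⟩,
      Finset.subset_union_left, fun I₂ h12 => ?_⟩
    · refine (hψ (fun _ => x) Subtype.val).2 fun i hi => ?_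
      have h1 : φ i ∈ insert ⊤ q := hφ ▸ ⟨i, rfl⟩
      rcases h1 with h1 | h1
      · rw [h1]
        exact Formula.realize_top.2 trivial
      · exact hx _ ⟨⟨i, hi, rfl⟩, h1⟩
    · -- the maps witnessing inconsistency, extended to all indices in `I₂`
      have := J.nonempty
      have hext : ∀ x : κ × (J → J), x ∈ F → ∃ h : J → J,
          IsLocal (((sch I₀).base ∪ (sch I₀).supp x.1 : Set J) ∪ f '' I₂) h ∧
            ∀ y ∈ ((sch I₀).base ∪ (sch I₀).supp x.1 : Set J), h y = x.2 y := fun x hx =>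
        (hFloc x hx).1.exists_extend hK hJ.mem hJ
          ((Finset.finite_toSet _).union (Finset.finite_toSet _)) ((Finset.finite_toSet _).image _)
      choose! e he heq using hext
      refine shears_of_inconsistent i₀ hJ hf hv g ψ (fun j => t (a j)) (fun j => ht (a j))
        (Finset.subset_union_left.trans h12) (hterm I₂ h12) (hF.image e) ?_ ?_
      · rintro _ ⟨x, hx, rfl⟩
        refine ⟨(he x hx).mono Set.subset_union_right, fun y hy => ?_⟩
        have hy' : f y ∈ (sch I₀).base := Finset.mem_image_of_mem f hy
        rw [heq x hx _ (Or.inl hy'), (hFloc x hx).2 _ hy']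
      · rintro ⟨z, hz⟩
        obtain ⟨x, hx, hnx⟩ := hno (z 0)
        refine hnx ((realize_schemeFormula i₀ f t (φ x.1) _ _).2 ?_)
        have h1 := (hψ z fun y => (t y).realize (v ∘ move (e x) ∘ reindex f)).1
          (hz (e x) ⟨x, hx, rfl⟩) x.1 ⟨x, hx, rfl⟩
        refine (hYφ x.1 P _ _ fun y hy => ?_).1 h1
        rcases y with y | y
        · refine hXt y P _ _ fun s hs => ?_
          rcases s with s | s
          · have h2 : f s.1 ∈ ((sch I₀).base ∪ (sch I₀).supp x.1 : Set J) := Or.inr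
              (Finset.mem_coe.2 (Finset.mem_image_of_mem f (hEmem x.1 y hy s hs)))
            exact congrArg (fun j => v (Sum.inl (j, s.2))) (heq x hx _ h2)
          · rfl
        · rfl

end Saturation

/-! ### Separating a superstable theory from an unsuperstable one -/

section DisjointIn

variable {L₁ L₂ L L' : FirstOrder.Language.{u, u}}

theorem DisjointIn.symm {e₁ : L₁ →ᴸ L} {e₂ : L₂ →ᴸ L} (h : DisjointIn e₁ e₂) :
    DisjointIn e₂ e₁ :=
  ⟨fun n F G => (h.1 n G F).symm, fun n R S => (h.2 n S R).symm⟩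

theorem DisjointIn.comp_left {e₁ : L₁ →ᴸ L} {e₂ : L₂ →ᴸ L} (h : DisjointIn e₁ e₂)
    (j : L' →ᴸ L₁) : DisjointIn (e₁.comp j) e₂ :=
  ⟨fun n _ G => h.1 n _ G, fun n _ S => h.2 n _ S⟩

theorem DisjointIn.map {e₁ : L₁ →ᴸ L} {e₂ : L₂ →ᴸ L} (h : DisjointIn e₁ e₂) {j : L →ᴸ L'}
    (hj : j.Injective) : DisjointIn (j.comp e₁) (j.comp e₂) :=
  ⟨fun n F G hFG => h.1 n F G (hj.onFunction hFG), fun n R S hRS => h.2 n R S (hj.onRelation hRS)⟩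

end DisjointIn

section Main

variable {τ : FirstOrder.Language.{u, u}} {lt : τ.Relations 2} {K : IndexModel τ → Prop}
  {I : IndexModel τ}

theorem Template.Le.refl {Φ : Template τ} (hΦ : Φ.InUpsilon K) : Le K Φ Φ (LHom.id Φ.L) where
  injective := ⟨fun h => h, fun h => h⟩
  elementary I hI M _ a N _ b ha hb :=
    hΦ.elementary I I id hI hI ⟨fun _ _ h => h, fun _ _ _ => (Part.map_id' (fun _ => rfl) _).symm,
      fun _ _ _ => Iff.rfl⟩ M a N b ha hb

/-- A theory with infinite models can be added to a template, unless it is already there. -/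
theorem IsCountableContext.exists_le_of_option (hc : IsCountableContext lt K I) {Φ : Template τ}
    (hΦ : Φ.InUpsilon K) {L : FirstOrder.Language.{u, u}} (T : L.Theory)
    (hT : ∃ (M : Type u) (_ : L.Structure M), Infinite M ∧ M ⊨ T) (j : Option (L →ᴸ Φ.L))
    (hj : ∀ x ∈ j, Φ.InUpsilonOver K T x) :
    ∃ (Ψ : Template τ) (e : Φ.L →ᴸ Ψ.L) (i : L →ᴸ Ψ.L), Le K Φ Ψ e ∧ Ψ.InUpsilonOver K T i ∧
      (∀ x ∈ j, i = e.comp x) ∧ (j = none → DisjointIn e i) := by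
  rcases j with _ | j
  · obtain ⟨Ψ, e, i, h1, h2, h3⟩ := hc.exists_le_of_theory hΦ T hT
    exact ⟨Ψ, e, i, h1, h2, fun _ h => (Option.not_mem_none _ h).elim, fun _ => h3⟩
  · refine ⟨Φ, LHom.id _, j, .refl hΦ, hj j rfl, fun x hx => ?_, fun h => (nomatch h)⟩
    obtain rfl := Option.some_inj.1 hx
    rfl

theorem exists_infinite_models_appAxiom :
    ∃ (M : Type u) (_ : appLang.{u}.Structure M),
      Infinite M ∧ M ⊨ ({appAxiom} : appLang.Theory) := by
  obtain ⟨app, happ⟩ := exists_hasUpdates (ULift.{u} ℕ)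
  let _ : appLang.{u}.Structure (ULift.{u} ℕ) :=
    { funMap := fun {n} F => match n, F with
        | _, .app => fun x => app (x 0) (x 1)
      RelMap := fun R => nomatch R }
  refine ⟨ULift.{u} ℕ, inferInstance, inferInstance, (Theory.model_iff _).2 fun φ hφ => ?_⟩
  obtain rfl := Set.mem_singleton_iff.1 hφ
  exact (realize_appAxiom _).2 happ

/-- A template containing a superstable and an unsuperstable theory is extended to one in which
models are saturated for the first theory, but not for the second. -/
theorem IsCountableContext.exists_le_isSaturated (hc : IsCountableContext lt K I)
    {L₀ L₁ : FirstOrder.Language.{u, u}} {T₀ : L₀.Theory} {T₁ : L₁.Theory} (hT₁ : T₁.IsComplete)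
    (h₀ : IsSuperstable K I T₀) (h₁ : IsUnsuperstable K I T₁) {Φ : Template τ}
    {i₀ : L₀ →ᴸ Φ.L} {i₁ : L₁ →ᴸ Φ.L} (hΦ₀ : Φ.InUpsilonOver K T₀ i₀)
    (hΦ₁ : Φ.InUpsilonOver K T₁ i₁) (c : Cardinal.{u}) :
    ∃ μ : Cardinal.{u}, c ≤ μ ∧ ∃ (Ψ : Template τ) (e : Φ.L →ᴸ Ψ.L), Le K Φ Ψ e ∧
      Ψ.InUpsilon K ∧ ∀ (M : Type u) [Ψ.L.Structure M] (a : I → List M), IsGEM I Ψ M a →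
        @IsSaturated L₀ M ((e.comp i₀).reduct M) μ ∧
        ¬ @IsSaturated L₁ M ((e.comp i₁).reduct M) (Cardinal.aleph 1) := by
  have hK := hc.isIndexModelClass
  have := hc.countable
  obtain ⟨J, f, hJ, hf⟩ := hK.saturated_extension I hc.mem
  -- an operation coding functions by elements, and the parameters of the unsuperstable theory
  obtain ⟨Φ₁, e₁, α, hle₁, hα, -⟩ :=
    hc.exists_le_of_theory hΦ₀.mem _ exists_infinite_models_appAxiom.{u}
  have hα' := hα.le_theory _ rfl
  have hΦ₁₁ := hΦ₁.mono hα.mem hle₁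
  obtain ⟨D⟩ := h₁.nonempty_data
  obtain ⟨Φ₂, e₂, δ, hΦ₂, hle₂, H⟩ := D.exists_le_tree hK hJ hf hT₁ hα.mem (e₁.comp i₁)
    hΦ₁₁.le_theory α hα'
  have hle₁₂ := hle₁.trans hα.mem hle₂
  have hΦ₂₀ := hΦ₀.mono hΦ₂ hle₁₂
  have hα₂ : (e₂.comp α).onSentence appAxiom ∈ Φ₂.theory K :=
    (hα.mono hΦ₂ hle₂).le_theory _ rfl
  obtain ⟨N₀, _, A, hA⟩ := hΦ₂.proper J hJ.mem
  have hA0 := (hΦ₂.nontrivial J N₀ A hJ.mem hA).1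
  -- a large set of indices for the formulas of a type
  let κ : Type u := (max c (max Cardinal.aleph0 (max L₀.card (max Φ₂.L.card
    (Cardinal.mk J))))).out
  have hκ : Cardinal.mk κ = max c (max Cardinal.aleph0 (max L₀.card (max Φ₂.L.card
    (Cardinal.mk J)))) := Cardinal.mk_out _
  have hκc : c ≤ Cardinal.mk κ := by rw [hκ]; exact le_max_left _ _
  have hκ0 : Cardinal.aleph0 ≤ Cardinal.mk κ := by
    rw [hκ]; exact (le_max_left _ _).trans (le_max_right _ _)
  have hκL₀ : L₀.card ≤ Cardinal.mk κ := by
    rw [hκ]; exact (le_max_left _ _).trans ((le_max_right _ _).trans (le_max_right _ _))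
  have hκL : Φ₂.L.card ≤ Cardinal.mk κ := by
    rw [hκ]
    exact (le_max_left _ _).trans
      ((le_max_right _ _).trans ((le_max_right _ _).trans (le_max_right _ _)))
  have hκJ : Cardinal.mk J ≤ Cardinal.mk κ := by
    rw [hκ]
    exact (le_max_right _ _).trans
      ((le_max_right _ _).trans ((le_max_right _ _).trans (le_max_right _ _)))
  have : Infinite κ := Cardinal.infinite_iff.2 hκ0
  let W : Type u := (Order.succ (Cardinal.mk κ)).ord.ToType
  have hΓ : Cardinal.mk (W × Set κ) ≤ 2 ^ Cardinal.mk κ := by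
    have h1 : Cardinal.mk W ≤ 2 ^ Cardinal.mk κ := by
      rw [Cardinal.mk_ord_toType]
      exact Order.succ_le_of_lt (Cardinal.cantor _)
    rw [Cardinal.mk_prod, Cardinal.lift_id, Cardinal.lift_id, Cardinal.mk_set]
    exact Cardinal.mul_le_of_le (hκ0.trans (Cardinal.cantor _).le) h1 le_rfl
  -- all schemes are listed at each level
  obtain ⟨dec, hdec⟩ : ∃ dec : Set κ → Scheme J Φ₂.L (W × Set κ) κ, Function.Surjective dec := by
    have h1 := mk_scheme_le (L := Φ₂.L) (κ := κ) hκL hκJ hΓ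
    rw [← Cardinal.mk_set] at h1
    obtain ⟨j⟩ := h1
    have : Nonempty (Scheme J Φ₂.L (W × Set κ) κ) := ⟨⟨∅, fun _ => ⊤, fun _ => ∅⟩⟩
    exact ⟨Function.invFun j, Function.invFun_surjective j.injective⟩
  obtain ⟨S, hS, hSp⟩ := exists_isBlueprint_chain hK hJ hΦ₂ (e₂.comp α) hα₂ hA hA0
    (W := W) (Θ := Set κ) fun γ => dec γ.2
  obtain ⟨Ψ, e, hΨ, hle, HΨ⟩ := hS.exists_template hK hc.mem hJ hf hΦ₂ hA hA0
  refine ⟨_, hκc.trans (Order.le_succ _), Ψ, e.comp (e₂.comp e₁), hle₁₂.trans hΦ₂ hle, hΨ,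
    fun M _ a ha => ⟨?_, ?_⟩⟩
  · let _ : Φ₂.L.Structure M := e.reduct M
    obtain ⟨P, _, v, g, hv, hg⟩ := HΨ M a ha
    let i : L₀ →ᴸ Φ₂.L := (e₂.comp e₁).comp i₀
    let _ : L₀.Structure M := i.reduct M
    let _ : L₀.Structure P := i.reduct P
    have hM : M ⊨ T₀ := (Theory.model_iff _).2 fun φ hφ => by
      have h1 := (hΦ₂₀.mono hΨ hle).le_theory φ hφ I M a hc.mem ha
      rw [realize_onSentence_reduct] at h1
      exact h1
    exact isSaturated_of_isSuperstable hK hJ hf h₀ hκL₀ (fun γ => dec γ.2)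
      (fun s => (hdec s).imp fun θ hθ _ => hθ) (hS.isInvariant hv)
      (fun γ hγ => (hSp γ ⟨P, inferInstance, v, hv, hγ⟩).imp fun T hT i => hv _ (hT i)) i hM
      (g.ofLHom i) hg
  · exact D.not_isSaturated hc.mem hJ.mem hf hΦ₂ (e₂.comp (e₁.comp i₁)) δ H hΨ hle ha

/-- Both theories are added to the template, in disjoint signatures, before it is extended to one
which separates them. -/
theorem IsCountableContext.exists_separating_template (hc : IsCountableContext lt K I)
    {L₀ L₁ : FirstOrder.Language.{u, u}} {T₀ : L₀.Theory} {T₁ : L₁.Theory} (hT₁ : T₁.IsComplete)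
    (hinf : ∃ (M : Type u) (_ : L₀.Structure M), Infinite M ∧ M ⊨ T₀)
    (h₀ : IsSuperstable K I T₀) (h₁ : IsUnsuperstable K I T₁) {Φ : Template τ}
    (hΦ : Φ.InUpsilon K) (j₀ : Option (L₀ →ᴸ Φ.L)) (j₁ : Option (L₁ →ᴸ Φ.L))
    (hj₀ : ∀ j ∈ j₀, Φ.InUpsilonOver K T₀ j) (hj₁ : ∀ j ∈ j₁, Φ.InUpsilonOver K T₁ j)
    (hj : ∀ j ∈ j₀, ∀ j' ∈ j₁, DisjointIn j j') (κ : Cardinal.{u}) :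
    ∃ μ : Cardinal.{u}, κ ≤ μ ∧
      ∃ (Ψ : Template τ) (e : Φ.L →ᴸ Ψ.L) (i₀ : L₀ →ᴸ Ψ.L) (i₁ : L₁ →ᴸ Ψ.L),
        Template.Le K Φ Ψ e ∧ Ψ.InUpsilonOver K T₀ i₀ ∧ Ψ.InUpsilonOver K T₁ i₁ ∧
        DisjointIn i₀ i₁ ∧
        (∀ j ∈ j₀, i₀ = e.comp j) ∧ (j₀ = none → DisjointIn e i₀) ∧
        (∀ j ∈ j₁, i₁ = e.comp j) ∧ (j₁ = none → DisjointIn e i₁) ∧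
        ∀ (M : Type u) [Ψ.L.Structure M] (a : I → List M), Template.IsGEM I Ψ M a →
          @IsSaturated L₀ M (i₀.reduct M) μ ∧
          ¬ @IsSaturated L₁ M (i₁.reduct M) (Cardinal.aleph 1) := by
  obtain ⟨Φ₀, e₀, i₀, hle₀, hΦ₀, hi₀, hd₀⟩ := hc.exists_le_of_option hΦ T₀ hinf j₀ hj₀
  obtain ⟨Φ₁, e₁, i₁, hle₁, hΦ₁, hi₁, hd₁⟩ := hc.exists_le_of_option hΦ₀.mem T₁ (by
    obtain ⟨D⟩ := h₁.nonempty_data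
    let _ := D.str
    exact ⟨D.M, D.str, D.infinite, D.models⟩) (j₁.map fun j => e₀.comp j) (by
    intro x hx
    obtain ⟨j, hj, rfl⟩ := Option.mem_map.1 hx
    exact (hj₁ j hj).mono hΦ₀.mem hle₀)
  replace hi₁ : ∀ j ∈ j₁, i₁ = e₁.comp (e₀.comp j) := fun j hj =>
    hi₁ _ (Option.mem_map_of_mem _ hj)
  replace hd₁ : j₁ = none → DisjointIn e₁ i₁ := fun h => hd₁ (by rw [h]; rfl)
  have hle := hle₀.trans hΦ₀.mem hle₁
  have hΦ₁₀ := hΦ₀.mono hΦ₁.mem hle₁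
  have hdisj : DisjointIn (e₁.comp i₀) i₁ := by
    rcases j₁ with _ | j'
    · exact (hd₁ rfl).comp_left i₀
    · rw [hi₁ j' rfl]
      refine DisjointIn.map ?_ hle₁.injective
      rcases j₀ with _ | j
      · exact ((hd₀ rfl).comp_left j').symm
      · rw [hi₀ j rfl]
        exact (hj j rfl j' rfl).map hle₀.injective
  obtain ⟨μ, hμ, Ψ, e, hleΨ, hΨ, H⟩ := hc.exists_le_isSaturated hT₁ h₀ h₁ hΦ₁₀ hΦ₁ κ
  refine ⟨μ, hμ, Ψ, e.comp (e₁.comp e₀), e.comp (e₁.comp i₀), e.comp i₁, hle.trans hΦ₁.mem hleΨ,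
    hΦ₁₀.mono hΨ hleΨ, hΦ₁.mono hΨ hleΨ, hdisj.map hleΨ.injective, fun j hj => ?_, fun h => ?_,
    fun j hj => ?_, fun h => ?_, H⟩
  · rw [hi₀ j hj]
    rfl
  · exact ((hd₀ h).map hle₁.injective).map hleΨ.injective
  · rw [hi₁ j hj]
    rfl
  · exact ((hd₁ h).comp_left e₀).map hleΨ.injective

/-- A large model of the given theory is turned into a template by the Ramsey property, and this
template is extended to one which separates the two theories. -/
theorem IsCountableContext.exists_separating_model (hc : IsCountableContext lt K I)
    {L₀ L₁ : FirstOrder.Language.{u, u}} {T₀ : L₀.Theory} {T₁ : L₁.Theory} (hT₀ : T₀.IsComplete)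
    (hT₁ : T₁.IsComplete) (hinf : ∃ (M : Type u) (_ : L₀.Structure M), Infinite M ∧ M ⊨ T₀)
    (h₀ : IsSuperstable K I T₀) (h₁ : IsUnsuperstable K I T₁)
    {L : FirstOrder.Language.{u, u}} {T : L.Theory} {i₀ : L₀ →ᴸ L} {i₁ : L₁ →ᴸ L}
    (hT : T.IsSatisfiable) (hi₀ : i₀.Injective) (hi₁ : i₁.Injective)
    (hTT₀ : ∀ φ ∈ T₀, T ⊨ᵇ i₀.onSentence φ) (hTT₁ : ∀ φ ∈ T₁, T ⊨ᵇ i₁.onSentence φ)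
    (κ : Cardinal.{u}) :
    ∃ μ : Cardinal.{u}, κ ≤ μ ∧
      ∃ (M : Type u) (_ : L.Structure M), Nonempty M ∧ M ⊨ T ∧
        @IsSaturated L₀ M (i₀.reduct M) μ ∧
        ¬ @IsSaturated L₁ M (i₁.reduct M) (Cardinal.aleph 1) := by
  have hK := hc.isIndexModelClass
  obtain ⟨J, f, hJ, hf⟩ := hK.saturated_extension I hc.mem
  -- the models of `T` are infinite
  have hTinf : ∃ M : Theory.ModelType.{u, u, max u u} T, Infinite M := by
    obtain ⟨M⟩ := hT
    obtain ⟨M₀, _, _, hM₀⟩ := hinf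
    refine ⟨M, ?_⟩
    let _ : L₀.Structure M := i₀.reduct M
    have hM : M ⊨ T₀ := (Theory.model_iff _).2 fun φ hφ =>
      (realize_onSentence_reduct i₀ φ).1 ((hTT₀ φ hφ).realize_sentence M)
    have : M₀ ≅[L₀] M := elementarilyEquivalent_iff.2 fun φ => by
      rw [hT₀.realize_sentence_iff φ M₀, hT₀.realize_sentence_iff φ M]
    exact this.infinite_iff.1 inferInstance
  obtain ⟨N, hN⟩ := Theory.exists_model_card_eq hTinf
    (max Cardinal.aleph0 (max L.card (Cardinal.mk J))) (le_max_left _ _) (by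
      rw [Cardinal.lift_id, Cardinal.lift_id]
      exact (le_max_left _ _).trans (le_max_right _ _))
  obtain ⟨b⟩ : Cardinal.mk J ≤ Cardinal.mk N := by
    rw [hN]
    exact (le_max_right _ _).trans (le_max_right _ _)
  obtain ⟨Φ, e, he, hΦ, H⟩ := exists_ramsey_extension (L := L) (N := N) hK hJ (fun t => [b t])
    (fun _ _ _ => rfl) (fun _ => List.cons_ne_nil _ _)
    fun s t h => b.injective (List.cons_eq_cons.1 h).1
  have htheory : ∀ φ : L.Sentence, N ⊨ φ → e.onSentence φ ∈ Φ.theory K := by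
    intro φ hφ
    obtain ⟨N', _, a, ha⟩ := hΦ.proper J hJ.mem
    obtain ⟨ha0, hR⟩ := H N' a ha
    exact mem_theory_of_realize hΦ hJ.mem ha (hR.realize_sentence hφ)
  have hover : ∀ {L₂ : FirstOrder.Language.{u, u}} (T₂ : L₂.Theory) (i : L₂ →ᴸ L), i.Injective →
      (∀ φ ∈ T₂, T ⊨ᵇ i.onSentence φ) → Φ.InUpsilonOver K T₂ (e.comp i) := by
    intro L₂ T₂ i hi hTT
    refine .of_subset hΦ (he.comp hi) fun φ hφ H' N' _ a hH' ha => ?_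
    have h1 := htheory _ ((hTT φ hφ).realize_sentence N) H' N' a hH' ha
    let _ : L.Structure N' := e.reduct N'
    rw [realize_onSentence_reduct] at h1 ⊢
    rw [realize_onSentence_reduct] at h1
    exact h1
  obtain ⟨μ, hμ, Ψ, e', hle, hΨ, HΨ⟩ := hc.exists_le_isSaturated hT₁ h₀ h₁
    (hover T₀ i₀ hi₀ hTT₀) (hover T₁ i₁ hi₁ hTT₁) κ
  obtain ⟨M, _, a, ha⟩ := hΨ.proper I hc.mem
  refine ⟨μ, hμ, M, (e'.comp e).reduct M, ha.nonempty hΨ hc.mem, ?_, HΨ M a ha⟩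
  let _ : Φ.L.Structure M := e'.reduct M
  let _ : L.Structure M := e.reduct M
  refine (Theory.model_iff _).2 fun φ hφ => ?_
  have h1 := hle.theory_mono hΦ (htheory φ (N.is_model.realize_of_mem φ hφ)) I M a hc.mem ha
  rw [realize_onSentence_reduct, realize_onSentence_reduct] at h1
  exact h1

end Main

end Shearing

theorem mainTheorem1 {τ : FirstOrder.Language.{u, u}} (lt : τ.Relations 2) (K : IndexModel τ → Prop)
    (I : IndexModel τ) (hc : IsCountableContext lt K I)
    {L₀ L₁ : FirstOrder.Language.{u, u}} (T₀ : L₀.Theory) (T₁ : L₁.Theory)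
    (hT₀ : T₀.IsComplete) (hT₁ : T₁.IsComplete)
    (hinf : ∃ (M : Type u) (_ : L₀.Structure M), Infinite M ∧ M ⊨ T₀)
    (h₀ : IsSuperstable K I T₀) (h₁ : IsUnsuperstable K I T₁) :
    -- Each signature is either disjoint from that of `Φ` (`none`), or it is already included in
    -- it (`some j`) and `Φ ∈ Υ[Tᵢ]`.
    (∀ (Φ : Template τ), Φ.InUpsilon K →
      ∀ (j₀ : Option (L₀ →ᴸ Φ.L)) (j₁ : Option (L₁ →ᴸ Φ.L)),
        (∀ j ∈ j₀, Φ.InUpsilonOver K T₀ j) → (∀ j ∈ j₁, Φ.InUpsilonOver K T₁ j) →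
        (∀ j ∈ j₀, ∀ j' ∈ j₁, DisjointIn j j') →
        ∀ κ : Cardinal.{u}, ∃ μ : Cardinal.{u}, κ ≤ μ ∧
          ∃ (Ψ : Template τ) (e : Φ.L →ᴸ Ψ.L) (i₀ : L₀ →ᴸ Ψ.L) (i₁ : L₁ →ᴸ Ψ.L),
            Template.Le K Φ Ψ e ∧ Ψ.InUpsilonOver K T₀ i₀ ∧ Ψ.InUpsilonOver K T₁ i₁ ∧
            DisjointIn i₀ i₁ ∧
            (∀ j ∈ j₀, i₀ = e.comp j) ∧ (j₀ = none → DisjointIn e i₀) ∧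
            (∀ j ∈ j₁, i₁ = e.comp j) ∧ (j₁ = none → DisjointIn e i₁) ∧
            ∀ (M : Type u) [Ψ.L.Structure M] (a : I → List M), Template.IsGEM I Ψ M a →
              @IsSaturated L₀ M (i₀.reduct M) μ ∧
              ¬ @IsSaturated L₁ M (i₁.reduct M) (Cardinal.aleph 1)) ∧
    -- Every theory extending both, in a signature including the two disjoint ones, has such a model.
    (∀ (L : FirstOrder.Language.{u, u}) (T : L.Theory) (i₀ : L₀ →ᴸ L) (i₁ : L₁ →ᴸ L),
      T.IsSatisfiable → i₀.Injective → i₁.Injective → DisjointIn i₀ i₁ →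
      (∀ φ ∈ T₀, T ⊨ᵇ i₀.onSentence φ) → (∀ φ ∈ T₁, T ⊨ᵇ i₁.onSentence φ) →
      ∀ κ : Cardinal.{u}, ∃ μ : Cardinal.{u}, κ ≤ μ ∧
        ∃ (M : Type u) (_ : L.Structure M), Nonempty M ∧ M ⊨ T ∧
          @IsSaturated L₀ M (i₀.reduct M) μ ∧
          ¬ @IsSaturated L₁ M (i₁.reduct M) (Cardinal.aleph 1)) := by
  refine ⟨fun Φ hΦ j₀ j₁ hj₀ hj₁ hj κ =>
    hc.exists_separating_template hT₁ hinf h₀ h₁ hΦ j₀ j₁ hj₀ hj₁ hj κ, ?_⟩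
  intro L T i₀ i₁ hT hi₀ hi₁ _ hTT₀ hTT₁ κ
  exact hc.exists_separating_model hT₀ hT₁ hinf h₀ h₁ hT hi₀ hi₁ hTT₀ hTT₁ κ
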